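/- Let $P\subset\mathbb{R}^2$ be a polygonal domain, i.e. a non-void compact simply connected set whose interior is a Lipschitz domain and whose boundary is a simple closed polygon with pairwise distinct nodes $z_1,\dots,z_m$ ($m\ge 3$, $z_{m+1}:=z_1$) and edges $E(j)=\mathrm{conv}\{z_j,z_{j+1}\}$: $\partial P=E(1)\cup\dots\cup E(m)$, consecutive edges meet exactly in their common node, and non-consecutive edges are disjoint (angles equal to $\pi$ are allowed). Let $\mathcal{E}(P)=\{E(1),\dots,E(m)\}$, so $|\mathcal{E}(P)|=m$, let $\mathbf{n}_P$ be the outer unit normal, $\mathcal{P}_k$ the polynomials of degree at most $k$, and $H^1(P):=H^1(\mathrm{int}\,P)$, with boundary values of $H^1$ functions understood as traces. Define $$\widehat V_h(P):=\Big\{v\in H^1(P):\ \Delta v\in\mathcal{P}_1(P)\ \text{ and }\ \tfrac{\partial v}{\partial \mathbf{n}_P}\big|_E\in\mathcal{P}_0(E)\ \text{ for all } E\in\mathcal{E}(P)\Big\},$$ where $\Delta v$ is the distributional Laplacian and the normal derivative $g=\partial v/\partial\mathbf{n}_P\in L^2(\partial P)$ is understood weakly through Green's formula $\int_P\nabla v\cdot\nabla\varphi\,dx+\int_P(\Delta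 v)\,\varphi\,dx=\int_{\partial P}g\,\varphi\,ds$ for all $\varphi\in C^\infty(\mathbb{R}^2)$. For $v\in H^1(P)$ let the Ritz projection $\Pi^\nabla_1 v\in\mathcal{P}_1(P)$ be defined by $(\nabla\Pi^\nabla_1v-\nabla v,\nabla\chi)_{L^2(P)}=0$ for all $\chi\in\mathcal{P}_1(P)$ and $\int_{\partial P}\Pi^\nabla_1v\,ds=\int_{\partial P}v\,ds$, and set $$V_h(P):=\big\{v\in\widehat V_h(P):\ v-\Pi^\nabla_1v\perp\mathcal{P}_1(P)\ \text{in } L^2(P)\big\},\qquad \mathrm{dof}_E(v):=\frac1{|E|}\int_E v\,ds\quad(E\in\mathcal{E}(P)).$$ Then: (a) $\dim\widehat V_h(P)=3+|\mathcal{E}(P)|$. (b) $\dim V_h(P)=|\mathcal{E}(P)|$, and the triplet $(P,V_h(P),(\mathrm{dof}_E:E\in\mathcal{E}(P)))$ is a finite element in the sense of Ciarlet; that is, $P$ is compact with non-empty interior and Lipschitz boundary, $V_h(P)$ is a finite-dimensional function space, and the $\mathrm{dof}_E$ are linearly independent linear forms on $V_h(P)$ such that for all reals $(\alpha_E)_{E\in\mathcal{E}(P)}$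 there is exactly one $v\in V_h(P)$ with $\mathrm{dof}_E(v)=\alpha_E$ for all $E\in\mathcal{E}(P)$. -/

import Mathlib

open MeasureTheory Topology Filter
open scoped ContDiff NNReal ENNReal

noncomputable section

namespace VirtualElement

/-- The Euclidean plane `ℝ²`. -/
abbrev Plane := EuclideanSpace ℝ (Fin 2)

/-! ### Polygonal domains -/

/-- A closed set `K` has a Lipschitz boundary: near each of its boundary points, after an isometric
change of the coordinates, the interior of `K` is the part of the plane strictly above the graph of
a Lipschitz function. -/
def HasLipschitzBoundary (K : Set Plane) : Prop :=
  ∀ x ∈ frontier K, ∃ r > 0, ∃ R : Plane ≃ₗᵢ[ℝ] Plane, ∃ L : ℝ≥0, ∃ γ : ℝ → ℝ,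
    LipschitzWith L γ ∧ ∀ y ∈ Metric.ball x r, y ∈ interior K ↔ γ (R y 0) < R y 1

/-- A polygonal domain with `m` nodes (equivalently, `m` edges): a non-void compact simply connected
set whose interior is a Lipschitz domain and whose boundary is a simple closed polygon with
(pairwise distinct) nodes `z 0, …, z (m - 1)`. The `i`-th edge is the segment from `z i` to the
cyclically next node `z (finRotate m i)`. Angles of size `π` (hanging nodes) are allowed. -/
structure PolygonalDomain (m : ℕ) where
  /-- The compact set itself. -/
  carrier : Set Plane
  /-- The boundary polygon, given by its nodes. -/
  polygon : Polygon Plane m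
  three_le : 3 ≤ m
  nonempty : carrier.Nonempty
  isCompact : IsCompact carrier
  isSimplyConnected : IsSimplyConnected carrier
  isConnected_interior : IsConnected (interior carrier)
  hasLipschitzBoundary : HasLipschitzBoundary carrier
  vertices_injective : Function.Injective polygon.vertices
  frontier_eq : frontier carrier = polygon.boundary ℝ
  /-- Consecutive edges meet in their common node only. -/
  edge_inter_edge : ∀ i, polygon.edgeSet ℝ i ∩ polygon.edgeSet ℝ (finRotate m i) =
    {polygon.vertices (finRotate m i)}
  /-- Edges that are not consecutive are disjoint (being compact, they have positive distance). -/
  edge_disjoint : ∀ i j, i ≠ j → j ≠ finRotate m i → i ≠ finRotate m j →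
    Disjoint (polygon.edgeSet ℝ i) (polygon.edgeSet ℝ j)

/-! ### The Sobolev space `H¹` -/

/-- `G` is the weak (distributional) gradient of `u` in the open set `Ω`. -/
def IsWeakGradient (Ω : Set Plane) (u : Plane → ℝ) (G : Plane → Plane) : Prop :=
  ∀ φ : Plane → ℝ, ContDiff ℝ ∞ φ → HasCompactSupport φ → tsupport φ ⊆ Ω →
    ∫ x in Ω, u x • gradient φ x = - ∫ x in Ω, φ x • G x

/-- Lebesgue measure on an open subset of the plane. -/
abbrev vol (Ω : TopologicalSpace.Opens Plane) : Measure Plane := volume.restrict (Ω : Set Plane)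

theorem continuous_gradient {φ : Plane → ℝ} (h : ContDiff ℝ ∞ φ) : Continuous (gradient φ) :=
  (LinearIsometryEquiv.continuous _).comp (h.continuous_fderiv (by simp))

theorem hasCompactSupport_gradient {φ : Plane → ℝ} (h : HasCompactSupport φ) :
    HasCompactSupport (gradient φ) :=
  (h.fderiv (𝕜 := ℝ)).comp_left (map_zero _)

theorem integrable_smul_grad {Ω : TopologicalSpace.Opens Plane} (u : Lp ℝ 2 (vol Ω))
    {φ : Plane → ℝ} (h : ContDiff ℝ ∞ φ) (hc : HasCompactSupport φ) :
    Integrable (fun x ↦ u x • gradient φ x) (vol Ω) :=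
  memLp_one_iff_integrable.1 (MemLp.smul (p := 2) (q := 2) (r := 1)
    ((continuous_gradient h).memLp_of_hasCompactSupport (hasCompactSupport_gradient hc))
    (Lp.memLp u))

theorem integrable_test_smul {Ω : TopologicalSpace.Opens Plane} (G : Lp Plane 2 (vol Ω))
    {φ : Plane → ℝ} (h : ContDiff ℝ ∞ φ) (hc : HasCompactSupport φ) :
    Integrable (fun x ↦ φ x • G x) (vol Ω) :=
  memLp_one_iff_integrable.1 (MemLp.smul (p := 2) (q := 2) (r := 1)
    (Lp.memLp G) (h.continuous.memLp_of_hasCompactSupport hc))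

theorem IsWeakGradient.zero (Ω : TopologicalSpace.Opens Plane) :
    IsWeakGradient Ω (0 : Lp ℝ 2 (vol Ω)) (0 : Lp Plane 2 (vol Ω)) := by
  intro φ _ _ _
  rw [integral_congr_ae (g := fun _ ↦ 0),
    integral_congr_ae (f := fun x ↦ φ x • (0 : Lp Plane 2 (vol Ω)) x) (g := fun _ ↦ 0)]
  · simp
  · filter_upwards [Lp.coeFn_zero Plane 2 (vol Ω)] with x hx
    rw [hx, Pi.zero_apply, smul_zero]
  · filter_upwards [Lp.coeFn_zero ℝ 2 (vol Ω)] with x hx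
    rw [hx, Pi.zero_apply, zero_smul]

theorem IsWeakGradient.add {Ω : TopologicalSpace.Opens Plane} {u v : Lp ℝ 2 (vol Ω)}
    {G H : Lp Plane 2 (vol Ω)} (hu : IsWeakGradient Ω u G) (hv : IsWeakGradient Ω v H) :
    IsWeakGradient Ω (u + v : Lp ℝ 2 (vol Ω)) (G + H : Lp Plane 2 (vol Ω)) := by
  intro φ h hc hs
  rw [integral_congr_ae (g := fun x ↦ u x • gradient φ x + v x • gradient φ x),
    integral_congr_ae (f := fun x ↦ φ x • (G + H : Lp Plane 2 (vol Ω)) x)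
      (g := fun x ↦ φ x • G x + φ x • H x),
    integral_add (integrable_smul_grad u h hc) (integrable_smul_grad v h hc),
    integral_add (integrable_test_smul G h hc) (integrable_test_smul H h hc),
    hu φ h hc hs, hv φ h hc hs, neg_add]
  · filter_upwards [Lp.coeFn_add G H] with x hx
    rw [hx, Pi.add_apply, smul_add]
  · filter_upwards [Lp.coeFn_add u v] with x hx
    rw [hx, Pi.add_apply, add_smul]

theorem IsWeakGradient.smul {Ω : TopologicalSpace.Opens Plane} {u : Lp ℝ 2 (vol Ω)}
    {G : Lp Plane 2 (vol Ω)} (c : ℝ) (hu : IsWeakGradient Ω u G) :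
    IsWeakGradient Ω (c • u : Lp ℝ 2 (vol Ω)) (c • G : Lp Plane 2 (vol Ω)) := by
  intro φ h hc hs
  rw [integral_congr_ae (g := fun x ↦ c • (u x • gradient φ x)),
    integral_congr_ae (f := fun x ↦ φ x • (c • G : Lp Plane 2 (vol Ω)) x)
      (g := fun x ↦ c • (φ x • G x)),
    integral_smul, integral_smul, hu φ h hc hs, smul_neg]
  · filter_upwards [Lp.coeFn_smul c G] with x hx
    rw [hx, Pi.smul_apply, smul_comm]
  · filter_upwards [Lp.coeFn_smul c u] with x hx
    rw [hx, Pi.smul_apply, smul_assoc]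

/-- Weak gradients are unique. -/
theorem IsWeakGradient.unique {Ω : TopologicalSpace.Opens Plane} {u : Lp ℝ 2 (vol Ω)}
    {G H : Lp Plane 2 (vol Ω)} (hG : IsWeakGradient Ω u G) (hH : IsWeakGradient Ω u H) :
    G = H := by
  have key : ∀ᵐ x ∂(vol Ω), x ∈ (Ω : Set Plane) → (G - H : Lp Plane 2 (vol Ω)) x = 0 := by
    refine Ω.isOpen.ae_eq_zero_of_integral_contDiff_smul_eq_zero
      (((Lp.memLp (G - H)).locallyIntegrable (by norm_num)).locallyIntegrableOn _) ?_
    intro φ h hc hs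
    rw [integral_congr_ae (g := fun x ↦ φ x • G x - φ x • H x),
      integral_sub (integrable_test_smul G h hc) (integrable_test_smul H h hc), sub_eq_zero]
    · exact neg_injective ((hG φ h hc hs).symm.trans (hH φ h hc hs))
    · filter_upwards [Lp.coeFn_sub G H] with x hx
      rw [hx, Pi.sub_apply, smul_sub]
  have hm : ∀ᵐ x ∂(vol Ω), x ∈ (Ω : Set Plane) :=
    ae_restrict_mem Ω.isOpen.measurableSet
  rw [← sub_eq_zero, Lp.eq_zero_iff_ae_eq_zero]
  filter_upwards [key, hm] with x hx hx'
  exact hx hx'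

/-- The Sobolev space `H¹(Ω)` of all `u ∈ L²(Ω)` with a weak gradient in `L²(Ω; ℝ²)`. -/
def H1 (Ω : TopologicalSpace.Opens Plane) : Submodule ℝ (Lp ℝ 2 (vol Ω)) where
  carrier := {u | ∃ G : Lp Plane 2 (vol Ω), IsWeakGradient Ω u G}
  zero_mem' := ⟨0, .zero Ω⟩
  add_mem' := fun ⟨G, hG⟩ ⟨H, hH⟩ ↦ ⟨G + H, hG.add hH⟩
  smul_mem' := fun c _ ⟨G, hG⟩ ↦ ⟨c • G, hG.smul c⟩

/-- The weak gradient `H¹(Ω) → L²(Ω; ℝ²)`. -/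
def weakGrad (Ω : TopologicalSpace.Opens Plane) : H1 Ω →ₗ[ℝ] Lp Plane 2 (vol Ω) where
  toFun v := v.2.choose
  map_add' v w := (v + w).2.choose_spec.unique (v.2.choose_spec.add w.2.choose_spec)
  map_smul' c v := (c • v).2.choose_spec.unique (v.2.choose_spec.smul c)

theorem isWeakGradient_weakGrad {Ω : TopologicalSpace.Opens Plane} (v : H1 Ω) :
    IsWeakGradient Ω v.1 (weakGrad Ω v) :=
  v.2.choose_spec

/-- The interior of a set, as an open set. -/
abbrev inside (K : Set Plane) : TopologicalSpace.Opens Plane := ⟨interior K, isOpen_interior⟩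

/-- The arc length measure `ds` on the boundary of a subset of the plane. -/
abbrev arc (K : Set Plane) : Measure Plane := (μH[1]).restrict (frontier K)

/-- `g ∈ L²(∂K)` is the trace of `v ∈ H¹(int K)`: there are smooth functions on the plane that
converge to `v` in `H¹(int K)` and whose restrictions to `∂K` converge to `g` in `L²(∂K)`. -/
def HasTrace (K : Set Plane) (v : H1 (inside K)) (g : Lp ℝ 2 (arc K)) : Prop :=
  ∃ φ : ℕ → Plane → ℝ, (∀ k, ContDiff ℝ ∞ (φ k)) ∧
    Tendsto (fun k ↦ eLpNorm (φ k - ⇑v.1) 2 (vol (inside K))) atTop (𝓝 0) ∧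
    Tendsto (fun k ↦ eLpNorm (gradient (φ k) - ⇑(weakGrad _ v)) 2 (vol (inside K)))
      atTop (𝓝 0) ∧
    Tendsto (fun k ↦ eLpNorm (φ k - ⇑g) 2 (arc K)) atTop (𝓝 0)

theorem gradient_add_of_contDiff {φ ψ : Plane → ℝ} (h : ContDiff ℝ ∞ φ) (h' : ContDiff ℝ ∞ ψ) :
    gradient (φ + ψ) = gradient φ + gradient ψ := by
  ext1 x
  simp only [gradient, Pi.add_apply, ← map_add]
  rw [fderiv_add ((h.differentiable (by simp)) x) ((h'.differentiable (by simp)) x)]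

theorem gradient_smul_of_contDiff {φ : Plane → ℝ} (c : ℝ) (h : ContDiff ℝ ∞ φ) :
    gradient (c • φ) = c • gradient φ := by
  ext1 x
  simp only [gradient, Pi.smul_apply]
  rw [fderiv_const_smul ((h.differentiable (by simp)) x)]
  simp

theorem gradient_zero_fun : gradient (0 : Plane → ℝ) = 0 := by
  ext1 x
  simp [gradient]

theorem tendsto_eLpNorm_add {E : Type*} [NormedAddCommGroup E] {μ : Measure Plane}
    {a b : ℕ → Plane → E} {u v w : Plane → E} (ha : ∀ k, Continuous (a k))
    (hb : ∀ k, Continuous (b k)) (hu : AEStronglyMeasurable u μ) (hv : AEStronglyMeasurable v μ)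
    [SecondCountableTopology E] [MeasurableSpace E] [BorelSpace E]
    (hw : w =ᵐ[μ] u + v) (h : Tendsto (fun k ↦ eLpNorm (a k - u) 2 μ) atTop (𝓝 0))
    (h' : Tendsto (fun k ↦ eLpNorm (b k - v) 2 μ) atTop (𝓝 0)) :
    Tendsto (fun k ↦ eLpNorm (a k + b k - w) 2 μ) atTop (𝓝 0) := by
  refine tendsto_of_tendsto_of_tendsto_of_le_of_le tendsto_const_nhds
    (by simpa using h.add h') (fun _ ↦ zero_le) fun k ↦ ?_
  have e : a k + b k - w =ᵐ[μ] (a k - u) + (b k - v) := by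
    filter_upwards [hw] with x hx
    simp only [Pi.add_apply, Pi.sub_apply, hx]
    abel
  rw [eLpNorm_congr_ae e]
  exact eLpNorm_add_le ((ha k).aestronglyMeasurable.sub hu)
    ((hb k).aestronglyMeasurable.sub hv) (by norm_num)

theorem tendsto_eLpNorm_smul {E : Type*} [NormedAddCommGroup E] [NormedSpace ℝ E]
    {μ : Measure Plane} {a : ℕ → Plane → E} {u w : Plane → E} (c : ℝ) (hw : w =ᵐ[μ] c • u)
    (h : Tendsto (fun k ↦ eLpNorm (a k - u) 2 μ) atTop (𝓝 0)) :
    Tendsto (fun k ↦ eLpNorm (c • a k - w) 2 μ) atTop (𝓝 0) := by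
  have e : ∀ k, eLpNorm (c • a k - w) 2 μ = ‖c‖ₑ * eLpNorm (a k - u) 2 μ := by
    intro k
    rw [← eLpNorm_const_smul]
    refine eLpNorm_congr_ae ?_
    filter_upwards [hw] with x hx
    simp only [Pi.smul_apply, Pi.sub_apply, hx, smul_sub]
  simp only [e]
  simpa using ENNReal.Tendsto.const_mul h (Or.inr (by simp : ‖c‖ₑ ≠ ⊤))

theorem HasTrace.zero (K : Set Plane) : HasTrace K 0 0 := by
  refine ⟨fun _ ↦ 0, fun _ ↦ contDiff_const, ?_, ?_, ?_⟩
  · refine tendsto_const_nhds.congr fun k ↦ ?_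
    rw [eLpNorm_congr_ae (g := 0), eLpNorm_zero]
    filter_upwards [Lp.coeFn_zero ℝ 2 (vol (inside K))] with x hx
    simpa using hx
  · refine tendsto_const_nhds.congr fun k ↦ ?_
    rw [eLpNorm_congr_ae (g := 0), eLpNorm_zero]
    filter_upwards [Lp.coeFn_zero Plane 2 (vol (inside K))] with x hx
    rw [map_zero, Pi.sub_apply, hx, gradient_zero_fun, Pi.zero_apply, sub_zero]
  · refine tendsto_const_nhds.congr fun k ↦ ?_
    rw [eLpNorm_congr_ae (g := 0), eLpNorm_zero]
    filter_upwards [Lp.coeFn_zero ℝ 2 (arc K)] with x hx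
    simpa using hx

theorem HasTrace.add {K : Set Plane} {v w : H1 (inside K)} {g h : Lp ℝ 2 (arc K)}
    (hv : HasTrace K v g) (hw : HasTrace K w h) : HasTrace K (v + w) (g + h) := by
  obtain ⟨a, ha, ha1, ha2, ha3⟩ := hv
  obtain ⟨b, hb, hb1, hb2, hb3⟩ := hw
  refine ⟨fun k ↦ a k + b k, fun k ↦ (ha k).add (hb k), ?_, ?_, ?_⟩
  · exact tendsto_eLpNorm_add (fun k ↦ (ha k).continuous) (fun k ↦ (hb k).continuous)
      (Lp.aestronglyMeasurable _) (Lp.aestronglyMeasurable _) (Lp.coeFn_add v.1 w.1) ha1 hb1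
  · simp only [fun k ↦ gradient_add_of_contDiff (ha k) (hb k)]
    exact tendsto_eLpNorm_add (fun k ↦ continuous_gradient (ha k))
      (fun k ↦ continuous_gradient (hb k)) (Lp.aestronglyMeasurable _) (Lp.aestronglyMeasurable _)
      (by rw [map_add]; exact Lp.coeFn_add _ _) ha2 hb2
  · exact tendsto_eLpNorm_add (fun k ↦ (ha k).continuous) (fun k ↦ (hb k).continuous)
      (Lp.aestronglyMeasurable _) (Lp.aestronglyMeasurable _) (Lp.coeFn_add g h) ha3 hb3

theorem HasTrace.smul {K : Set Plane} {v : H1 (inside K)} {g : Lp ℝ 2 (arc K)} (c : ℝ)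
    (hv : HasTrace K v g) : HasTrace K (c • v) (c • g) := by
  obtain ⟨a, ha, ha1, ha2, ha3⟩ := hv
  refine ⟨fun k ↦ c • a k, fun k ↦ contDiff_const.smul (ha k), ?_, ?_, ?_⟩
  · exact tendsto_eLpNorm_smul c (Lp.coeFn_smul c v.1) ha1
  · simp only [fun k ↦ gradient_smul_of_contDiff c (ha k)]
    exact tendsto_eLpNorm_smul c (by rw [map_smul]; exact Lp.coeFn_smul _ _) ha2
  · exact tendsto_eLpNorm_smul c (Lp.coeFn_smul c g) ha3

open Classical in
/-- The trace on `∂K` of a function `v ∈ H¹(int K)`. -/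
def boundaryTrace (K : Set Plane) (v : H1 (inside K)) : Lp ℝ 2 (arc K) :=
  if h : ∃ g, HasTrace K v g then h.choose else 0

/-! ### Laplacian and normal derivative -/

/-- `Δ v = f` in the sense of distributions in `Ω`, for `v ∈ H¹(Ω)`. -/
def IsWeakLaplacian (Ω : TopologicalSpace.Opens Plane) (v : H1 Ω) (f : Plane → ℝ) : Prop :=
  ∀ φ : Plane → ℝ, ContDiff ℝ ∞ φ → HasCompactSupport φ → tsupport φ ⊆ Ω →
    - ∫ x in Ω, inner ℝ (weakGrad Ω v x) (gradient φ x) = ∫ x in Ω, f x * φ x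

/-- `g ∈ L²(∂K)` is the outward normal derivative `∂v/∂n` of `v ∈ H¹(int K)` with Laplacian
`Δ v = f`, in the usual weak sense, that is, Green's formula
`∫_K ∇v ⬝ ∇φ dx + ∫_K f φ dx = ∫_{∂K} g φ ds` holds for all smooth `φ`. -/
def IsNormalDerivative (K : Set Plane) (v : H1 (inside K)) (f : Plane → ℝ) (g : Lp ℝ 2 (arc K)) :
    Prop :=
  ∀ φ : Plane → ℝ, ContDiff ℝ ∞ φ →
    (∫ x in interior K, inner ℝ (weakGrad _ v x) (gradient φ x)) +
        (∫ x in interior K, f x * φ x) =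
      ∫ x in frontier K, g x * φ x ∂μH[1]

namespace PolygonalDomain

variable {m : ℕ} (P : PolygonalDomain m)

/-- The interior of the polygonal domain. -/
abbrev dom : TopologicalSpace.Opens Plane := inside P.carrier

/-- The `i`-th edge. -/
abbrev edge (i : Fin m) : Set Plane := P.polygon.edgeSet ℝ i

instance : IsFiniteMeasure (vol P.dom) :=
  ⟨by
    rw [Measure.restrict_apply_univ]
    exact (measure_mono interior_subset).trans_lt P.isCompact.measure_lt_top⟩

instance : IsFiniteMeasure (arc P.carrier) :=
  ⟨by
    rw [Measure.restrict_apply_univ, P.frontier_eq]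
    refine (measure_iUnion_le _).trans_lt ?_
    rw [tsum_fintype]
    refine ENNReal.sum_lt_top.2 fun i _ ↦ ?_
    rw [Polygon.edgeSet, affineSegment_eq_segment, hausdorffMeasure_segment]
    exact edist_lt_top _ _⟩

theorem memLp_dom {E : Type*} [NormedAddCommGroup E] [SecondCountableTopology E]
    [MeasurableSpace E] [BorelSpace E] {φ : Plane → E} (h : Continuous φ) :
    MemLp φ 2 (vol P.dom) := by
  obtain ⟨C, hC⟩ := P.isCompact.exists_bound_of_continuousOn h.continuousOn
  refine MemLp.of_bound h.aestronglyMeasurable C ?_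
  filter_upwards [ae_restrict_mem isOpen_interior.measurableSet] with x hx
  exact hC x (interior_subset hx)

theorem memLp_arc {φ : Plane → ℝ} (h : Continuous φ) : MemLp φ 2 (arc P.carrier) := by
  obtain ⟨C, hC⟩ := P.isCompact.exists_bound_of_continuousOn h.continuousOn
  refine MemLp.of_bound h.aestronglyMeasurable C ?_
  filter_upwards [ae_restrict_mem isClosed_frontier.measurableSet] with x hx
  exact hC x (P.isCompact.isClosed.frontier_subset hx)

theorem integrable_inner {f g : Plane → Plane} (hf : MemLp f 2 (vol P.dom))
    (hg : MemLp g 2 (vol P.dom)) : Integrable (fun x ↦ inner ℝ (f x) (g x)) (vol P.dom) := by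
  refine Integrable.mono' (hf.norm.integrable_mul hg.norm)
    (hf.aestronglyMeasurable.inner hg.aestronglyMeasurable) ?_
  filter_upwards with x
  exact norm_inner_le_norm _ _

theorem contDiff_affine (q : Plane →ᴬ[ℝ] ℝ) : ContDiff ℝ ∞ q := q.contDiff

variable {P}

theorem _root_.VirtualElement.IsWeakLaplacian.zero :
    IsWeakLaplacian P.dom 0 (0 : Plane →ᴬ[ℝ] ℝ) := by
  intro φ _ _ _
  rw [integral_congr_ae (g := fun _ ↦ 0)]
  · simp
  · rw [map_zero]
    filter_upwards [Lp.coeFn_zero Plane 2 (vol P.dom)] with x hx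
    rw [hx, Pi.zero_apply, inner_zero_left]

theorem integral_inner_add (v w : H1 P.dom) {ψ : Plane → Plane} (h : Continuous ψ) :
    ∫ x in interior P.carrier, inner ℝ (weakGrad P.dom (v + w) x) (ψ x) =
      (∫ x in interior P.carrier, inner ℝ (weakGrad P.dom v x) (ψ x)) +
      ∫ x in interior P.carrier, inner ℝ (weakGrad P.dom w x) (ψ x) := by
  have e : ∫ x in interior P.carrier, (inner ℝ (weakGrad P.dom v x) (ψ x) +
      inner ℝ (weakGrad P.dom w x) (ψ x)) = _ :=
    integral_add (P.integrable_inner (Lp.memLp (weakGrad P.dom v)) (P.memLp_dom h))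
      (P.integrable_inner (Lp.memLp (weakGrad P.dom w)) (P.memLp_dom h))
  rw [← e, map_add]
  refine integral_congr_ae ?_
  filter_upwards [Lp.coeFn_add (weakGrad P.dom v) (weakGrad P.dom w)] with x hx
  rw [hx, Pi.add_apply, inner_add_left]

theorem integral_inner_smul (c : ℝ) (v : H1 P.dom) (ψ : Plane → Plane) :
    ∫ x in interior P.carrier, inner ℝ (weakGrad P.dom (c • v) x) (ψ x) =
      c * ∫ x in interior P.carrier, inner ℝ (weakGrad P.dom v x) (ψ x) := by
  rw [← integral_const_mul, map_smul]
  refine integral_congr_ae ?_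
  filter_upwards [Lp.coeFn_smul c (weakGrad P.dom v)] with x hx
  rw [hx, Pi.smul_apply, real_inner_smul_left]

theorem integral_affine_add (p q : Plane →ᴬ[ℝ] ℝ) {φ : Plane → ℝ} (h : Continuous φ) :
    ∫ x in interior P.carrier, (p + q) x * φ x =
      (∫ x in interior P.carrier, p x * φ x) + ∫ x in interior P.carrier, q x * φ x := by
  have := integral_add ((P.memLp_dom p.continuous).integrable_mul (P.memLp_dom h))
    ((P.memLp_dom q.continuous).integrable_mul (P.memLp_dom h))
  simp only [Pi.mul_apply] at this
  simp only [ContinuousAffineMap.add_apply, add_mul]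
  exact this

theorem integral_affine_smul (c : ℝ) (p : Plane →ᴬ[ℝ] ℝ) (φ : Plane → ℝ) :
    ∫ x in interior P.carrier, (c • p) x * φ x = c * ∫ x in interior P.carrier, p x * φ x := by
  rw [← integral_const_mul]
  simp only [ContinuousAffineMap.smul_apply, smul_eq_mul, mul_assoc]

variable (P)

/-- The extended local space `V̂_h(P)`: all `v ∈ H¹(P)` with affine Laplacian `p` and edgewise
constant normal derivative `g`. -/
def extendedSpace : Submodule ℝ (H1 P.dom) where
  carrier := {v | ∃ p : Plane →ᴬ[ℝ] ℝ, IsWeakLaplacian P.dom v p ∧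
    ∃ g : Lp ℝ 2 (arc P.carrier), IsNormalDerivative P.carrier v p g ∧
      ∀ i, ∃ c : ℝ, ∀ᵐ x ∂(arc P.carrier), x ∈ P.edge i → g x = c}
  zero_mem' := by
    refine ⟨0, .zero, 0, fun φ _ ↦ ?_, fun i ↦ ⟨0, ?_⟩⟩
    · have h := integral_inner_smul (0 : ℝ) (0 : H1 P.dom) (gradient φ)
      rw [zero_smul, zero_mul] at h
      rw [h, integral_congr_ae (μ := arc P.carrier) (g := fun _ ↦ 0)]
      · simp
      · filter_upwards [Lp.coeFn_zero ℝ 2 (arc P.carrier)] with x hx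
        rw [hx, Pi.zero_apply, zero_mul]
    · filter_upwards [Lp.coeFn_zero ℝ 2 (arc P.carrier)] with x hx _
      rw [hx, Pi.zero_apply]
  add_mem' := by
    rintro v w ⟨p, hp, g, hg, hc⟩ ⟨q, hq, h, hh, hd⟩
    refine ⟨p + q, fun φ hφ h1 h2 ↦ ?_, g + h, fun φ hφ ↦ ?_, fun i ↦ ?_⟩
    · have e1 := integral_inner_add v w (continuous_gradient hφ)
      have e2 := integral_affine_add (P := P) p q hφ.continuous
      have e3 := hp φ hφ h1 h2
      have e4 := hq φ hφ h1 h2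
      simp only [TopologicalSpace.Opens.coe_mk] at e3 e4 ⊢
      linarith
    · have ig : Integrable (fun x ↦ g x * φ x) (arc P.carrier) :=
        (Lp.memLp g).integrable_mul (P.memLp_arc hφ.continuous)
      have ih : Integrable (fun x ↦ h x * φ x) (arc P.carrier) :=
        (Lp.memLp h).integrable_mul (P.memLp_arc hφ.continuous)
      rw [integral_inner_add v w (continuous_gradient hφ),
        integral_affine_add (P := P) p q hφ.continuous,
        integral_congr_ae (μ := arc P.carrier) (g := fun x ↦ g x * φ x + h x * φ x),
        integral_add ig ih, ← hg φ hφ, ← hh φ hφ]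
      · ring
      · filter_upwards [Lp.coeFn_add g h] with x hx
        rw [hx, Pi.add_apply, add_mul]
    · obtain ⟨c, hc⟩ := hc i
      obtain ⟨d, hd⟩ := hd i
      refine ⟨c + d, ?_⟩
      filter_upwards [hc, hd, Lp.coeFn_add g h] with x h1 h2 h3 hx
      rw [h3, Pi.add_apply, h1 hx, h2 hx]
  smul_mem' := by
    rintro a v ⟨p, hp, g, hg, hc⟩
    refine ⟨a • p, fun φ hφ h1 h2 ↦ ?_, a • g, fun φ hφ ↦ ?_, fun i ↦ ?_⟩
    · have e1 := integral_inner_smul a v (gradient φ)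
      have e2 := integral_affine_smul (P := P) a p φ
      have e3 := hp φ hφ h1 h2
      simp only [TopologicalSpace.Opens.coe_mk] at e3 ⊢
      rw [e1, e2, ← e3]
      ring
    · rw [integral_inner_smul, integral_affine_smul,
        integral_congr_ae (μ := arc P.carrier) (g := fun x ↦ a * (g x * φ x)),
        integral_const_mul, ← hg φ hφ]
      · ring
      · filter_upwards [Lp.coeFn_smul a g] with x hx
        rw [hx, Pi.smul_apply, smul_eq_mul, mul_assoc]
    · obtain ⟨c, hc⟩ := hc i
      refine ⟨a * c, ?_⟩
      filter_upwards [hc, Lp.coeFn_smul a g] with x h1 h3 hx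
      rw [h3, Pi.smul_apply, h1 hx, smul_eq_mul]

/-- The affine function `q` is the Ritz projection of `v ∈ H¹(P)`:
`(∇q - ∇v, ∇χ)_{L²(P)} = 0` for all affine `χ`, and `∫_{∂P} q ds = ∫_{∂P} v ds`. -/
def IsRitzProjection (v : H1 P.dom) (q : Plane →ᴬ[ℝ] ℝ) : Prop :=
  (∀ χ : Plane →ᴬ[ℝ] ℝ, ∫ x in interior P.carrier,
    inner ℝ (gradient q x - weakGrad P.dom v x) (gradient χ x) = 0) ∧
  ∃ g, HasTrace P.carrier v g ∧
    ∫ x in frontier P.carrier, q x ∂μH[1] = ∫ x in frontier P.carrier, g x ∂μH[1]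

/-- The enhanced local space `V_h(P)`: all `v ∈ V̂_h(P)` such that the difference of `v` and its
Ritz projection is `L²(P)`-orthogonal to the affine functions. -/
def enhancedSpace : Submodule ℝ (H1 P.dom) where
  carrier := {v | v ∈ P.extendedSpace ∧ ∃ q, P.IsRitzProjection v q ∧
    ∀ χ : Plane →ᴬ[ℝ] ℝ, ∫ x in interior P.carrier, (v.1 x - q x) * χ x = 0}
  zero_mem' := by
    refine ⟨zero_mem _, 0, ⟨fun χ ↦ ?_, 0, .zero _, ?_⟩, fun χ ↦ ?_⟩
    · rw [integral_congr_ae (g := fun _ ↦ 0)]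
      · simp
      · filter_upwards [Lp.coeFn_zero Plane 2 (vol P.dom)] with x hx
        rw [map_zero, hx, ContinuousAffineMap.coe_zero, gradient_zero_fun]
        simp
    · rw [integral_congr_ae (μ := arc P.carrier) (Lp.coeFn_zero ℝ 2 (arc P.carrier))]
      simp
    · rw [integral_congr_ae (g := fun _ ↦ 0)]
      · simp
      · filter_upwards [Lp.coeFn_zero ℝ 2 (vol P.dom)] with x hx
        have hx' : ((0 : H1 P.dom) : Lp ℝ 2 (vol P.dom)) x = 0 := hx
        rw [hx', ContinuousAffineMap.zero_apply, sub_zero, zero_mul]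
  add_mem' := by
    rintro v w ⟨hv, q, ⟨hq, g, hg, hqg⟩, ho⟩ ⟨hw, r, ⟨hr, h, hh, hrh⟩, ho'⟩
    refine ⟨add_mem hv hw, q + r, ⟨fun χ ↦ ?_, g + h, hg.add hh, ?_⟩, fun χ ↦ ?_⟩
    · have hχ := P.memLp_dom (continuous_gradient (contDiff_affine χ))
      rw [integral_congr_ae (g := fun x ↦
          inner ℝ (gradient q x - weakGrad P.dom v x) (gradient χ x) +
          inner ℝ (gradient r x - weakGrad P.dom w x) (gradient χ x)),
        integral_add, hq χ, hr χ, add_zero]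
      · exact P.integrable_inner
          ((P.memLp_dom (continuous_gradient (contDiff_affine q))).sub (Lp.memLp _)) hχ
      · exact P.integrable_inner
          ((P.memLp_dom (continuous_gradient (contDiff_affine r))).sub (Lp.memLp _)) hχ
      · filter_upwards [Lp.coeFn_add (weakGrad P.dom v) (weakGrad P.dom w)] with x hx
        rw [map_add, hx, ContinuousAffineMap.coe_add,
          gradient_add_of_contDiff (contDiff_affine q) (contDiff_affine r), ← inner_add_left,
          Pi.add_apply, Pi.add_apply, add_sub_add_comm]
    · rw [integral_congr_ae (μ := arc P.carrier) (Lp.coeFn_add g h)]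
      simp only [ContinuousAffineMap.add_apply, Pi.add_apply]
      rw [integral_add ((P.memLp_arc q.continuous).integrable (by norm_num))
        ((P.memLp_arc r.continuous).integrable (by norm_num)),
        integral_add ((Lp.memLp g).integrable (by norm_num))
        ((Lp.memLp h).integrable (by norm_num)), hqg, hrh]
    · rw [integral_congr_ae (g := fun x ↦ (v.1 x - q x) * χ x + (w.1 x - r x) * χ x),
        integral_add, ho χ, ho' χ, add_zero]
      · exact ((Lp.memLp v.1).sub (P.memLp_dom q.continuous)).integrable_mul
          (P.memLp_dom χ.continuous)
      · exact ((Lp.memLp w.1).sub (P.memLp_dom r.continuous)).integrable_mul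
          (P.memLp_dom χ.continuous)
      · filter_upwards [Lp.coeFn_add v.1 w.1] with x hx
        have hx' : (v + w).1 x = v.1 x + w.1 x := hx
        rw [hx', ContinuousAffineMap.add_apply]
        ring
  smul_mem' := by
    rintro a v ⟨hv, q, ⟨hq, g, hg, hqg⟩, ho⟩
    refine ⟨Submodule.smul_mem _ _ hv, a • q, ⟨fun χ ↦ ?_, a • g, hg.smul a, ?_⟩, fun χ ↦ ?_⟩
    · rw [integral_congr_ae (g := fun x ↦
          a * inner ℝ (gradient q x - weakGrad P.dom v x) (gradient χ x)),
        integral_const_mul, hq χ, mul_zero]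
      filter_upwards [Lp.coeFn_smul a (weakGrad P.dom v)] with x hx
      rw [map_smul, hx, ContinuousAffineMap.coe_smul,
        gradient_smul_of_contDiff a (contDiff_affine q), ← real_inner_smul_left,
        Pi.smul_apply, Pi.smul_apply, smul_sub]
    · rw [integral_congr_ae (μ := arc P.carrier) (Lp.coeFn_smul a g)]
      simp only [ContinuousAffineMap.smul_apply, Pi.smul_apply, smul_eq_mul]
      rw [integral_const_mul, integral_const_mul, hqg]
    · rw [integral_congr_ae (g := fun x ↦ a * ((v.1 x - q x) * χ x)), integral_const_mul, ho χ,
        mul_zero]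
      filter_upwards [Lp.coeFn_smul a v.1] with x hx
      have hx' : (a • v).1 x = a * v.1 x := hx
      rw [hx', ContinuousAffineMap.smul_apply, smul_eq_mul]
      ring

/-- The degree of freedom `dof_E`: the integral mean over the `i`-th edge (of the trace). -/
def dof (i : Fin m) (v : H1 P.dom) : ℝ :=
  ⨍ x in P.edge i, boundaryTrace P.carrier v x ∂μH[1]

end PolygonalDomain

/-- Finite elements `(K, V, N)` in the sense of Ciarlet: `K` is a compact set with non-empty
interior and Lipschitz boundary, `V` is a finite-dimensional space of functions on `K` (here of
`H¹` functions), and `N` is a finite linearly independent family of linear forms on `V` that is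
`V`-unisolvent: any prescribed values are attained by exactly one function in `V`. -/
structure IsCiarletFiniteElement {ι : Type*} [Finite ι] (K : Set Plane)
    (V : Submodule ℝ (H1 (inside K))) (N : ι → V → ℝ) : Prop where
  isCompact : IsCompact K
  nonempty_interior : (interior K).Nonempty
  hasLipschitzBoundary : HasLipschitzBoundary K
  finiteDimensional : FiniteDimensional ℝ V
  isLinearMap : ∀ i, IsLinearMap ℝ (N i)
  linearIndependent : LinearIndependent ℝ N
  unisolvent : ∀ α : ι → ℝ, ∃! v : V, ∀ i, N i v = α i

end VirtualElement

end

open MeasureTheory Topology Filter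
open scoped ContDiff NNReal ENNReal

noncomputable section

namespace VirtualElement

/-! ### Differences of smooth functions and Poincaré inequalities -/

/-! A function in the extended space is a weak solution of a Neumann problem: an affine Laplacian
`p` and constant fluxes `c i` on the edges, with Green's formula holding for all smooth test
functions. The data `(p, c)` range over a space of dimension `3 + m`. They are determined by the
solution (test inside the domain, then near edge midpoints), and a solution exists exactly when `∫ p
= ∑ c i |E i|`, one nontrivial linear condition. The solutions with zero data are the constants.
Hence the dimension is `(3 + m - 1) + 1`.

The enhanced space contains the functions on which three further linear forms vanish, namely the
moments of `v - Π v` against the affine functions, so its dimension is at least `m`. Conversely the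
`m` edge means are injective on it. If they all vanish, Gauss' theorem makes the mean of `∇v`
vanish, and the boundary mean of `v` vanishes too, so the Ritz projection is zero and `v` is
orthogonal to the affine functions. Green's formula tested with `v` itself then reads `‖∇v‖² = ∑ c i
∫_{E i} v - ∫ p v = 0`, so `v` is a constant orthogonal to `1`, that is, zero. Thus the dimension is
`m` and the edge means are a bijection onto `ℝ^m`, which is unisolvence.

Four analytic facts carry this: the Poincaré inequality (solvability, and that `∇v = 0` forces
constants), a trace inequality on each edge, density of smooth functions in `H¹` (which allows `v`
itself as a test function), and Gauss' theorem on the polygon. The first three rest on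
`HasInwardCones`: near every point of the closure the domain can be pushed into itself in a fixed
direction with room to spare. The geometry needed is that every edge lies in the closure of the
interior (`frontier_subset_closure_interior`) and that the interior lies on one side of each open
edge (`exists_inward`). Gauss' theorem is reduced to half planes near inner edge points, and the
nodes are removed by cutoffs whose contribution vanishes in the limit. Neumann solutions come from
the Riesz representation theorem on the closure of the space of smooth gradients. -/

theorem sq_lintegral_le {α : Type*} [MeasurableSpace α] {μ : Measure α} [IsProbabilityMeasure μ]
    {f : α → ℝ≥0∞} (hf : AEMeasurable f μ) : (∫⁻ x, f x ∂μ) ^ 2 ≤ ∫⁻ x, f x ^ 2 ∂μ := by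
  have h := ENNReal.lintegral_mul_le_Lp_mul_Lq μ Real.HolderConjugate.two_two hf
    (aemeasurable_const (b := (1 : ℝ≥0∞)))
  simp only [Pi.mul_apply, mul_one, ENNReal.one_rpow, lintegral_const, measure_univ] at h
  calc (∫⁻ x, f x ∂μ) ^ 2 ≤ ((∫⁻ x, f x ^ (2 : ℝ) ∂μ) ^ (1 / 2 : ℝ)) ^ 2 := by gcongr
    _ = ∫⁻ x, f x ^ 2 ∂μ := by
      rw [← ENNReal.rpow_natCast, ← ENNReal.rpow_mul]
      simp

theorem hasDerivAt_comp_line {φ : Plane → ℝ} (hφ : ContDiff ℝ ∞ φ) (y h : Plane) (r : ℝ) :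
    HasDerivAt (fun r : ℝ ↦ φ (y + r • h)) (inner ℝ (gradient φ (y + r • h)) h) r := by
  have h1 : HasDerivAt (fun r : ℝ ↦ y + r • h) h r := by
    simpa using ((hasDerivAt_id r).smul_const h).const_add y
  have h2 := ((hφ.differentiable (by simp)) (y + r • h)).hasFDerivAt.comp_hasDerivAt r h1
  rw [gradient, InnerProductSpace.toDual_symm_apply]
  exact h2

/-- The fundamental theorem of calculus along the segment, followed by Cauchy–Schwarz on the unit
interval. -/
theorem enorm_sub_sq_le {φ : Plane → ℝ} (hφ : ContDiff ℝ ∞ φ) (y h : Plane) {t : ℝ}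
    (h0 : 0 ≤ t) (h1 : t ≤ 1) : ‖φ (y + t • h) - φ y‖ₑ ^ 2 ≤
      ‖h‖ₑ ^ 2 * ∫⁻ r in Set.Ioc (0 : ℝ) 1, ‖gradient φ (y + r • h)‖ₑ ^ 2 := by
  have hc : Continuous fun r : ℝ ↦ gradient φ (y + r • h) :=
    (continuous_gradient hφ).comp (by fun_prop)
  have e : φ (y + t • h) - φ y = ∫ r in 0..t, inner ℝ (gradient φ (y + r • h)) h := by
    rw [intervalIntegral.integral_eq_sub_of_hasDerivAt
      (fun r _ ↦ hasDerivAt_comp_line hφ y h r)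
      ((hc.inner continuous_const).intervalIntegrable _ _)]
    simp
  have : IsProbabilityMeasure (volume.restrict (Set.Ioc (0 : ℝ) 1)) := ⟨by simp⟩
  calc ‖φ (y + t • h) - φ y‖ₑ ^ 2
      ≤ (∫⁻ r in Set.Ioc (0 : ℝ) 1, ‖h‖ₑ * ‖gradient φ (y + r • h)‖ₑ) ^ 2 := by
        gcongr
        rw [e, intervalIntegral.integral_of_le h0]
        refine (enorm_integral_le_lintegral_enorm _).trans ?_
        refine (lintegral_mono_set (Set.Ioc_subset_Ioc_right h1)).trans ?_
        refine lintegral_mono fun r ↦ ?_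
        rw [mul_comm, ← ofReal_norm, ← ofReal_norm, ← ofReal_norm,
          ← ENNReal.ofReal_mul (norm_nonneg _)]
        exact ENNReal.ofReal_le_ofReal (norm_inner_le_norm _ _)
    _ ≤ _ := by
        refine (sq_lintegral_le (hc.enorm.measurable.const_mul _).aemeasurable).trans ?_
        simp only [mul_pow]
        rw [lintegral_const_mul _ (hc.enorm.measurable.pow_const 2)]

theorem measurable_gradient_line {φ : Plane → ℝ} (hφ : ContDiff ℝ ∞ φ) (h : Plane) :
    Measurable fun z : Plane × ℝ ↦ ‖gradient φ (z.1 + z.2 • h)‖ₑ ^ 2 :=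
  ((continuous_gradient hφ).comp (by fun_prop)).enorm.measurable.pow_const 2

theorem setLIntegral_comp_add_le {U V : Set Plane} (hU : MeasurableSet U) (hV : MeasurableSet V)
    (f : Plane → ℝ≥0∞) {k : Plane} (h : ∀ y ∈ U, y + k ∈ V) :
    ∫⁻ y in U, f (y + k) ≤ ∫⁻ y in V, f y := by
  rw [← lintegral_indicator hU, ← lintegral_indicator hV,
    ← lintegral_add_right_eq_self (V.indicator f) k]
  refine lintegral_mono fun y ↦ ?_
  by_cases hy : y ∈ U
  · rw [Set.indicator_of_mem hy, Set.indicator_of_mem (h y hy)]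
  · simp [hy]

/-- Integrate the pointwise estimate over `U` and exchange the integrals: for each fixed time `r`
the shifted set stays in `Ω`, and translation preserves the measure. -/
theorem lintegral_sub_sq_le {φ : Plane → ℝ} (hφ : ContDiff ℝ ∞ φ) {U Ω : Set Plane}
    (hU : MeasurableSet U) (hΩ : MeasurableSet Ω) {h : Plane}
    (hh : ∀ y ∈ U, ∀ t ∈ Set.Ioc (0 : ℝ) 1, y + t • h ∈ Ω) :
    ∫⁻ y in U, ‖φ (y + h) - φ y‖ₑ ^ 2 ≤ ‖h‖ₑ ^ 2 * ∫⁻ y in Ω, ‖gradient φ y‖ₑ ^ 2 := by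
  calc ∫⁻ y in U, ‖φ (y + h) - φ y‖ₑ ^ 2
      ≤ ∫⁻ y in U, ‖h‖ₑ ^ 2 * ∫⁻ r in Set.Ioc (0 : ℝ) 1, ‖gradient φ (y + r • h)‖ₑ ^ 2 :=
        lintegral_mono fun y ↦ by
          simpa using enorm_sub_sq_le hφ y h zero_le_one le_rfl
    _ = ‖h‖ₑ ^ 2 * ∫⁻ r in Set.Ioc (0 : ℝ) 1, ∫⁻ y in U, ‖gradient φ (y + r • h)‖ₑ ^ 2 := by
        rw [lintegral_const_mul, lintegral_lintegral_swap]
        · exact (measurable_gradient_line hφ h).aemeasurable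
        · exact (measurable_gradient_line hφ h).lintegral_prod_right'
    _ ≤ ‖h‖ₑ ^ 2 * ∫⁻ r in Set.Ioc (0 : ℝ) 1, ∫⁻ y in Ω, ‖gradient φ y‖ₑ ^ 2 := by
        gcongr ‖h‖ₑ ^ 2 * ?_
        refine setLIntegral_mono measurable_const fun r hr ↦ ?_
        exact setLIntegral_comp_add_le hU hΩ (fun y ↦ ‖gradient φ y‖ₑ ^ 2)
          fun y hy ↦ hh y hy r hr
    _ = _ := by simp

/-- A set `U` on which the Poincaré inequality holds with the gradient on `Ω`. -/
def PoincareOn (Ω U : Set Plane) : Prop :=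
  ∃ C : ℝ≥0, ∀ φ : Plane → ℝ, ContDiff ℝ ∞ φ → ∃ c : ℝ,
    ∫⁻ y in U, ‖φ y - c‖ₑ ^ 2 ≤ C * ∫⁻ y in Ω, ‖gradient φ y‖ₑ ^ 2

theorem enorm_add_sq_le (a b : ℝ) : ‖a + b‖ₑ ^ 2 ≤ 2 * (‖a‖ₑ ^ 2 + ‖b‖ₑ ^ 2) := by
  simp only [← ofReal_norm, Real.norm_eq_abs]
  rw [← ENNReal.ofReal_pow (by positivity), ← ENNReal.ofReal_pow (by positivity),
    ← ENNReal.ofReal_pow (by positivity), ← ENNReal.ofReal_add (by positivity) (by positivity),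
    show (2 : ℝ≥0∞) = ENNReal.ofReal 2 by simp, ← ENNReal.ofReal_mul (by positivity)]
  refine ENNReal.ofReal_le_ofReal ?_
  simp only [sq_abs]
  nlinarith [sq_nonneg (a - b)]

theorem PoincareOn.mono {Ω U V : Set Plane} (h : PoincareOn Ω V) (hUV : U ⊆ V) :
    PoincareOn Ω U := by
  obtain ⟨C, hC⟩ := h
  exact ⟨C, fun φ hφ ↦ (hC φ hφ).imp fun c hc ↦ (lintegral_mono_set hUV).trans hc⟩

/-- The two constants `c` and `d` are both close to `φ` on the overlap, which has positive measure,
so they are close to each other. Hence `c` also serves on `V`. -/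
theorem PoincareOn.union {Ω U V : Set Plane} (hU : PoincareOn Ω U) (hV : PoincareOn Ω V)
    (hm : volume (U ∩ V) ≠ 0) (hf : volume V ≠ ⊤) : PoincareOn Ω (U ∪ V) := by
  obtain ⟨C, hC⟩ := hU
  obtain ⟨D, hD⟩ := hV
  have hm' : volume (U ∩ V) ≠ ⊤ := ((measure_mono Set.inter_subset_right).trans_lt hf.lt_top).ne
  -- On `V` one has `|φ - c|² ≤ 2 |φ - d|² + 2 |d - c|²`; the quotient is the bound for `|d - c|²`
  -- obtained on the overlap.
  refine ⟨C + 2 * (D + (volume V).toNNReal * (2 * (C + D) / (volume (U ∩ V)).toNNReal)),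
    fun φ hφ ↦ ?_⟩
  obtain ⟨c, hc⟩ := hC φ hφ
  obtain ⟨d, hd⟩ := hD φ hφ
  refine ⟨c, ?_⟩
  set I := ∫⁻ y in Ω, ‖gradient φ y‖ₑ ^ 2
  have hmeas : ∀ a : ℝ, Measurable fun y ↦ ‖φ y - a‖ₑ ^ 2 := fun a ↦
    (hφ.continuous.sub continuous_const).enorm.measurable.pow_const 2
  have key : ‖d - c‖ₑ ^ 2 * volume (U ∩ V) ≤ 2 * (C + D) * I := by
    calc ‖d - c‖ₑ ^ 2 * volume (U ∩ V) = ∫⁻ y in U ∩ V, ‖d - c‖ₑ ^ 2 := by simp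
      _ ≤ ∫⁻ y in U ∩ V, 2 * (‖φ y - c‖ₑ ^ 2 + ‖φ y - d‖ₑ ^ 2) := by
          refine lintegral_mono fun y ↦ ?_
          have := enorm_add_sq_le (φ y - c) (-(φ y - d))
          rwa [enorm_neg, show φ y - c + -(φ y - d) = d - c by ring] at this
      _ = 2 * ((∫⁻ y in U ∩ V, ‖φ y - c‖ₑ ^ 2) + ∫⁻ y in U ∩ V, ‖φ y - d‖ₑ ^ 2) := by
          rw [lintegral_const_mul 2 (f := fun y ↦ ‖φ y - c‖ₑ ^ 2 + ‖φ y - d‖ₑ ^ 2)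
            ((hmeas c).add (hmeas d)), lintegral_add_left (hmeas c)]
      _ ≤ 2 * (C * I + D * I) := by
          gcongr
          · exact (lintegral_mono_set Set.inter_subset_left).trans hc
          · exact (lintegral_mono_set Set.inter_subset_right).trans hd
      _ = _ := by ring
  have key' : ‖d - c‖ₑ ^ 2 ≤ (2 * (C + D) / (volume (U ∩ V)).toNNReal : ℝ≥0) * I := by
    rw [ENNReal.coe_div (by simp [ENNReal.toNNReal_eq_zero_iff, hm, hm']),
      ENNReal.coe_toNNReal hm', ENNReal.mul_comm_div, ← mul_div_assoc]
    push_cast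
    rw [ENNReal.le_div_iff_mul_le (Or.inl hm) (Or.inl hm')]
    exact key
  calc ∫⁻ y in U ∪ V, ‖φ y - c‖ₑ ^ 2
      ≤ (∫⁻ y in U, ‖φ y - c‖ₑ ^ 2) + ∫⁻ y in V, ‖φ y - c‖ₑ ^ 2 := lintegral_union_le _ _ _
    _ ≤ C * I + ∫⁻ y in V, 2 * (‖φ y - d‖ₑ ^ 2 + ‖d - c‖ₑ ^ 2) := by
        gcongr with y
        have := enorm_add_sq_le (φ y - d) (d - c)
        rwa [sub_add_sub_cancel] at this
    _ = C * I + 2 * ((∫⁻ y in V, ‖φ y - d‖ₑ ^ 2) + ‖d - c‖ₑ ^ 2 * volume V) := by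
        rw [lintegral_const_mul 2 (f := fun y ↦ ‖φ y - d‖ₑ ^ 2 + ‖d - c‖ₑ ^ 2)
          ((hmeas d).add measurable_const), lintegral_add_left (hmeas d)]
        simp
    _ ≤ C * I + 2 * (D * I + (2 * (C + D) / (volume (U ∩ V)).toNNReal : ℝ≥0) * I * volume V) := by
        gcongr
    _ = _ := by
        push_cast
        rw [ENNReal.coe_toNNReal hf]
        ring

/-- On `U`, `φ` differs from its shift by `h` only by a gradient term, and the shift is controlled
on `V`. This carries the inequality from balls inside `Ω` to neighbourhoods of boundary points. -/
theorem PoincareOn.translate {Ω U V : Set Plane} (hV : PoincareOn Ω V) (hU : MeasurableSet U)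
    (hVm : MeasurableSet V)
    (hΩ : MeasurableSet Ω) {h : Plane} (hUV : ∀ y ∈ U, y + h ∈ V)
    (hh : ∀ y ∈ U, ∀ t ∈ Set.Ioc (0 : ℝ) 1, y + t • h ∈ Ω) : PoincareOn Ω U := by
  obtain ⟨D, hD⟩ := hV
  refine ⟨2 * (‖h‖₊ ^ 2 + D), fun φ hφ ↦ ?_⟩
  obtain ⟨d, hd⟩ := hD φ hφ
  refine ⟨d, ?_⟩
  set I := ∫⁻ y in Ω, ‖gradient φ y‖ₑ ^ 2
  have hφc := hφ.continuous
  have m1 : Measurable fun y ↦ ‖φ (y + h) - φ y‖ₑ ^ 2 :=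
    (Continuous.enorm (by fun_prop)).measurable.pow_const 2
  have m2 : Measurable fun y ↦ ‖φ (y + h) - d‖ₑ ^ 2 :=
    (Continuous.enorm (by fun_prop)).measurable.pow_const 2
  calc ∫⁻ y in U, ‖φ y - d‖ₑ ^ 2
      ≤ ∫⁻ y in U, 2 * (‖φ (y + h) - φ y‖ₑ ^ 2 + ‖φ (y + h) - d‖ₑ ^ 2) := by
        refine lintegral_mono fun y ↦ ?_
        have := enorm_add_sq_le (-(φ (y + h) - φ y)) (φ (y + h) - d)
        rwa [enorm_neg, show -(φ (y + h) - φ y) + (φ (y + h) - d) = φ y - d by ring] at this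
    _ = 2 * ((∫⁻ y in U, ‖φ (y + h) - φ y‖ₑ ^ 2) + ∫⁻ y in U, ‖φ (y + h) - d‖ₑ ^ 2) := by
        rw [lintegral_const_mul 2 (f := fun y ↦ ‖φ (y + h) - φ y‖ₑ ^ 2 + ‖φ (y + h) - d‖ₑ ^ 2)
          (m1.add m2), lintegral_add_left m1]
    _ ≤ 2 * (‖h‖ₑ ^ 2 * I + D * I) := by
        gcongr
        · exact lintegral_sub_sq_le hφ hU hΩ hh
        · refine le_trans ?_ hd
          exact setLIntegral_comp_add_le hU hVm (fun y ↦ ‖φ y - d‖ₑ ^ 2) hUV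
    _ = _ := by
        push_cast
        rw [enorm_eq_nnnorm]
        ring

theorem enorm_integral_sq_le {α : Type*} [MeasurableSpace α] {μ : Measure α}
    [IsProbabilityMeasure μ] {E : Type*} [NormedAddCommGroup E] [NormedSpace ℝ E] {f : α → E}
    (hf : AEStronglyMeasurable f μ) : ‖∫ x, f x ∂μ‖ₑ ^ 2 ≤ ∫⁻ x, ‖f x‖ₑ ^ 2 ∂μ :=
  (pow_le_pow_left' (enorm_integral_le_lintegral_enorm _) 2).trans (sq_lintegral_le hf.enorm)

/-- With the mean value as constant, Jensen's inequality reduces the claim to the double integral of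
`|φ y - φ z|²`. Substituting `z = y + k` turns it into difference quotients, and convexity keeps the
segments from `y` to `y + k` inside the ball. -/
theorem poincareOn_ball {Ω : Set Plane} (hΩ : MeasurableSet Ω) {x : Plane} {r : ℝ} (hr : 0 < r)
    (h : Metric.ball x r ⊆ Ω) : PoincareOn Ω (Metric.ball x r) := by
  set B := Metric.ball x r with hB
  have hBm : MeasurableSet B := Metric.isOpen_ball.measurableSet
  have hB0 : volume B ≠ 0 := (Metric.measure_ball_pos _ _ hr).ne'
  have hB1 : volume B ≠ ⊤ := measure_ball_lt_top.ne
  set A := Metric.ball (0 : Plane) (2 * r) with hA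
  have hA1 : volume A ≠ ⊤ := measure_ball_lt_top.ne
  set μ : Measure Plane := (volume B)⁻¹ • volume.restrict B with hμ
  have hμp : IsProbabilityMeasure μ := ⟨by simp [hμ, ENNReal.inv_mul_cancel hB0 hB1]⟩
  refine ⟨((volume B)⁻¹ * (volume A * ENNReal.ofReal (2 * r) ^ 2)).toNNReal, fun φ hφ ↦
    ⟨∫ z, φ z ∂μ, ?_⟩⟩
  have hφc := hφ.continuous
  have hint : Integrable φ μ := by
    refine Integrable.smul_measure ?_ (by simp [hB0])
    exact (hφc.continuousOn.integrableOn_compact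
      (isCompact_closedBall x r)).mono_set Metric.ball_subset_closedBall
  have m0 : Measurable fun p : Plane × Plane ↦ ‖φ p.1 - φ p.2‖ₑ ^ 2 :=
    (Continuous.enorm (by fun_prop)).measurable.pow_const 2
  have m1 : Measurable fun p : Plane × Plane ↦ ‖φ p.1 - φ (p.1 + p.2)‖ₑ ^ 2 :=
    (Continuous.enorm (by fun_prop)).measurable.pow_const 2
  set I := ∫⁻ y in Ω, ‖gradient φ y‖ₑ ^ 2
  calc ∫⁻ y in B, ‖φ y - ∫ z, φ z ∂μ‖ₑ ^ 2
      ≤ ∫⁻ y in B, ∫⁻ z, ‖φ y - φ z‖ₑ ^ 2 ∂μ := by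
        refine lintegral_mono fun y ↦ ?_
        have e : φ y - ∫ z, φ z ∂μ = ∫ z, (φ y - φ z) ∂μ := by
          rw [integral_sub (integrable_const _) hint]; simp
        rw [e]
        exact enorm_integral_sq_le (by fun_prop)
    _ = (volume B)⁻¹ * ∫⁻ y in B, ∫⁻ z in B, ‖φ y - φ z‖ₑ ^ 2 := by
        simp only [hμ, lintegral_smul_measure, smul_eq_mul]
        rw [lintegral_const_mul]
        exact m0.lintegral_prod_right'
    -- Two points of `B` differ by less than `2 * r`, so `k` need only range over `A`.
    _ ≤ (volume B)⁻¹ * ∫⁻ y in B, ∫⁻ k in A, B.indicator (fun z ↦ ‖φ y - φ z‖ₑ ^ 2) (y + k) := by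
        refine mul_le_mul_right ?_ _
        refine setLIntegral_mono' hBm fun y hy ↦ ?_
        rw [← lintegral_indicator hBm, ← lintegral_indicator Metric.isOpen_ball.measurableSet,
          ← lintegral_add_left_eq_self _ y]
        refine lintegral_mono fun k ↦ ?_
        by_cases hk : y + k ∈ B
        · have : k ∈ A := by
            rw [hA, mem_ball_zero_iff]
            have h1 := mem_ball_iff_norm.1 hk
            have h2 := mem_ball_iff_norm.1 hy
            calc ‖k‖ = ‖(y + k - x) - (y - x)‖ := by congr 1; abel
              _ ≤ ‖y + k - x‖ + ‖y - x‖ := norm_sub_le _ _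
              _ < 2 * r := by linarith
          rw [Set.indicator_of_mem this]
        · simp [hk]
    _ = (volume B)⁻¹ * ∫⁻ k in A, ∫⁻ y in B, B.indicator (fun z ↦ ‖φ y - φ z‖ₑ ^ 2) (y + k) := by
        rw [lintegral_lintegral_swap]
        have e : (Function.uncurry fun y k ↦ B.indicator (fun z ↦ ‖φ y - φ z‖ₑ ^ 2) (y + k)) =
          ((fun p : Plane × Plane ↦ p.1 + p.2) ⁻¹' B).indicator
            (fun p : Plane × Plane ↦ ‖φ p.1 - φ (p.1 + p.2)‖ₑ ^ 2) := by
          ext p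
          rfl
        rw [e]
        exact (m1.indicator (hBm.preimage measurable_add)).aemeasurable
    _ ≤ (volume B)⁻¹ * ∫⁻ k in A, ENNReal.ofReal (2 * r) ^ 2 * I := by
        refine mul_le_mul_right ?_ _
        refine setLIntegral_mono' Metric.isOpen_ball.measurableSet fun k hk ↦ ?_
        have hUm : MeasurableSet ((fun y ↦ y + k) ⁻¹' B) := hBm.preimage (measurable_add_const k)
        calc ∫⁻ y in B, B.indicator (fun z ↦ ‖φ y - φ z‖ₑ ^ 2) (y + k)
            = ∫⁻ y in B ∩ (fun y ↦ y + k) ⁻¹' B, ‖φ (y + k) - φ y‖ₑ ^ 2 := by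
              rw [Set.inter_comm, ← setLIntegral_indicator hUm]
              refine lintegral_congr fun y ↦ ?_
              by_cases hyk : y + k ∈ B
              · rw [Set.indicator_of_mem hyk,
                  Set.indicator_of_mem (s := (fun y ↦ y + k) ⁻¹' B) hyk, ← enorm_neg, neg_sub]
              · rw [Set.indicator_of_notMem hyk,
                  Set.indicator_of_notMem (s := (fun y ↦ y + k) ⁻¹' B) hyk]
          _ ≤ ‖k‖ₑ ^ 2 * I := by
              refine lintegral_sub_sq_le hφ (hBm.inter hUm) hΩ fun y hy t ht ↦ h ?_
              have := (convex_ball x r) hy.1 hy.2 (sub_nonneg.2 ht.2) ht.1.le (by ring)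
              convert this using 1
              simp only [sub_smul, smul_add, one_smul]
              abel
          _ ≤ _ := by
              gcongr
              rw [← ofReal_norm]
              exact ENNReal.ofReal_le_ofReal (mem_ball_zero_iff.1 hk).le
    _ = _ := by
        rw [ENNReal.coe_toNNReal]
        · simp only [lintegral_const, Measure.restrict_apply_univ]
          ring
        · exact ENNReal.mul_ne_top (by simp [hB0])
            (ENNReal.mul_ne_top hA1 (ENNReal.pow_ne_top ENNReal.ofReal_ne_top))

end VirtualElement

/-! ### Inward cones and the Poincaré inequality on the whole domain -/

namespace VirtualElement

/-- The uniform interior cone property of an open set: near each point of the closure there is a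
direction in which the set can be translated into itself, with room to spare. -/
def HasInwardCones (Ω : Set Plane) : Prop :=
  ∀ x ∈ closure Ω, ∃ e : Plane, ∃ c > 0, ∃ ρ > 0, ∃ T > 0, ∀ y ∈ Ω, dist y x < ρ →
    ∀ t : ℝ, 0 < t → t < T → Metric.ball (y + t • e) (c * t) ⊆ Ω

/-- At an interior point no shift is needed, so `e = 0` works. At a boundary point take the vertical
direction of the graph coordinates. -/
theorem HasLipschitzBoundary.hasInwardCones {K : Set Plane} (h : HasLipschitzBoundary K) : HasInwardCones (interior K) := by
  intro x hx
  by_cases hxi : x ∈ interior K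
  · obtain ⟨r, hr, hB⟩ := Metric.isOpen_iff.1 isOpen_interior x hxi
    refine ⟨0, 1, one_pos, r / 2, by positivity, r / 2, by positivity,
      fun y _ hyx t ht htr z hz ↦ hB ?_⟩
    rw [smul_zero, add_zero, one_mul, Metric.mem_ball] at hz
    rw [Metric.mem_ball]
    linarith [dist_triangle z y x]
  · obtain ⟨r, hr, R, L, γ, hγ, hB⟩ := h x ⟨closure_mono interior_subset hx, hxi⟩
    have hL : (0 : ℝ) < L + 1 := by positivity
    set e : Plane := R.symm (EuclideanSpace.single 1 1) with he
    have hRe : R e = EuclideanSpace.single 1 1 := by simp [he]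
    have hne : ‖e‖ = 1 := by simp [he]
    -- A perturbation `w` of the vertical shift `t` costs at most `‖w‖` in height, and the graph
    -- rises by at most `L * ‖w‖`. So `(L + 1) * ‖w‖ < t` keeps the point above the graph.
    refine ⟨e, 1 / (L + 1), by positivity, r / 2, by positivity, r / 4, by positivity,
      fun y hy hyx t ht htr z hz ↦ ?_⟩
    have hc1 : 1 / ((L : ℝ) + 1) ≤ 1 := by
      rw [div_le_one hL]; simp
    rw [Metric.mem_ball, dist_eq_norm] at hz
    set w := z - (y + t • e) with hw
    have hzw : z = y + t • e + w := by rw [hw]; abel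
    have hwt : ‖w‖ < t := hz.trans_le (by nlinarith)
    have hzB : z ∈ Metric.ball x r := by
      rw [Metric.mem_ball, dist_eq_norm, hzw]
      rw [dist_eq_norm] at hyx
      calc ‖y + t • e + w - x‖ = ‖(y - x) + t • e + w‖ := by congr 1; abel
        _ ≤ ‖y - x‖ + ‖t • e‖ + ‖w‖ := norm_add₃_le
        _ < r := by rw [norm_smul, hne, Real.norm_of_nonneg ht.le]; linarith
    have hyB : y ∈ Metric.ball x r := Metric.ball_subset_ball (by linarith) hyx
    rw [hB z hzB]
    have hy' := (hB y hyB).1 hy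
    have e0 : R z 0 = R y 0 + R w 0 := by
      rw [hzw, map_add, map_add, map_smul, hRe]; simp
    have e1 : R z 1 = R y 1 + t + R w 1 := by
      rw [hzw, map_add, map_add, map_smul, hRe]; simp
    have n0 : |R w 0| ≤ ‖w‖ := by
      have := PiLp.norm_apply_le (R w) 0
      rwa [R.norm_map] at this
    have n1 : |R w 1| ≤ ‖w‖ := by
      have := PiLp.norm_apply_le (R w) 1
      rwa [R.norm_map] at this
    have g := hγ.dist_le_mul (R z 0) (R y 0)
    rw [Real.dist_eq, Real.dist_eq, e0, add_sub_cancel_left] at g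
    rw [← e0] at g
    have hLw : ‖w‖ * (L + 1) < t := by
      rw [one_div, inv_mul_eq_div, lt_div_iff₀ hL] at hz
      exact hz
    have g1 := (abs_le.1 g).2
    have g2 := (abs_le.1 n1).1
    have g3 : (L : ℝ) * |R w 0| ≤ L * ‖w‖ := by gcongr
    rw [e1]
    linarith

/-- Chains of overlapping balls spread the inequality from one ball to all points of the connected
set. Near the boundary a cone translation moves a whole neighbourhood into an interior ball, and
compactness of the closure leaves finitely many pieces to join. -/
theorem HasInwardCones.poincareOn {Ω : Set Plane} (h : HasInwardCones Ω) (ho : IsOpen Ω)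
    (hc : IsConnected Ω) (hb : IsCompact (closure Ω)) : PoincareOn Ω Ω := by
  have hm := ho.measurableSet
  have hfin : volume Ω ≠ ⊤ :=
    ((measure_mono subset_closure).trans_lt hb.measure_lt_top).ne
  obtain ⟨x₀, hx₀⟩ := hc.nonempty
  obtain ⟨r₀, hr₀, hB₀⟩ := Metric.isOpen_iff.1 ho x₀ hx₀
  set B₀ := Metric.ball x₀ r₀
  have chain : ∀ {W : Set Plane} {y x : Plane} {r : ℝ}, 0 < r → Metric.ball y r ⊆ Ω →
      x ∈ Metric.ball y r → (∃ s > 0, Metric.ball x s ⊆ W) → PoincareOn Ω W →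
      PoincareOn Ω (W ∪ Metric.ball y r) := by
    rintro W y x r hr hyr hx ⟨s, hs, hsW⟩ hW
    refine hW.union (poincareOn_ball hm hr hyr) ?_ measure_ball_lt_top.ne
    refine ((Metric.isOpen_ball.inter (Metric.isOpen_ball (x := x) (ε := s))).measure_pos volume
      ⟨x, hx, Metric.mem_ball_self hs⟩).ne' ∘ fun h0 ↦ measure_mono_null ?_ h0
    exact fun z hz ↦ ⟨hsW hz.2, hz.1⟩
  -- The points that can be joined to `B₀`. This set is open and relatively closed in `Ω`, hence
  -- contains `Ω`.
  let S : Set Plane := {x | ∃ s > 0, PoincareOn Ω (B₀ ∪ Metric.ball x s)}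
  have step : ∀ y r, 0 < r → Metric.ball y r ⊆ Ω → (∃ x ∈ S, x ∈ Metric.ball y r) →
      PoincareOn Ω (B₀ ∪ Metric.ball y r) := by
    rintro y r hr hyr ⟨x, ⟨s, hs, hW⟩, hx⟩
    refine (chain hr hyr hx ⟨s, hs, Set.subset_union_right⟩ hW).mono ?_
    exact Set.union_subset_union_left _ Set.subset_union_left
  have hS : Ω ⊆ S := by
    refine hc.isPreconnected.subset_of_closure_inter_subset ?_ ?_ ?_
    · refine Metric.isOpen_iff.2 fun x ⟨s, hs, hW⟩ ↦ ⟨s, hs, fun z hz ↦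
        ⟨s - dist z x, sub_pos.2 hz, hW.mono ?_⟩⟩
      refine Set.union_subset_union_right _ (Metric.ball_subset_ball' ?_)
      linarith
    · refine ⟨x₀, hx₀, r₀, hr₀, ?_⟩
      rw [Set.union_self]
      exact poincareOn_ball hm hr₀ hB₀
    · rintro y ⟨hyS, hyΩ⟩
      obtain ⟨r, hr, hyr⟩ := Metric.isOpen_iff.1 ho y hyΩ
      obtain ⟨x, hx, hxy⟩ := Metric.mem_closure_iff.1 hyS r hr
      exact ⟨r, hr, step y r hr hyr ⟨x, hx, by rwa [Metric.mem_ball, dist_comm]⟩⟩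
  -- Keeping `B₀` in every piece guarantees that any two pieces overlap in positive measure.
  have main : PoincareOn Ω (B₀ ∪ (closure Ω ∩ Ω)) := by
    refine hb.induction_on (p := fun s ↦ PoincareOn Ω (B₀ ∪ (s ∩ Ω))) ?_ ?_ ?_ ?_
    · rw [Set.empty_inter, Set.union_empty]
      exact poincareOn_ball hm hr₀ hB₀
    · exact fun s t hst ht ↦
        ht.mono (Set.union_subset_union_right _ (Set.inter_subset_inter_left _ hst))
    · intro s t hs ht
      refine (hs.union ht ?_ ?_).mono ?_
      · refine (Metric.measure_ball_pos volume x₀ hr₀).ne' ∘ measure_mono_null ?_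
        exact Set.subset_inter Set.subset_union_left Set.subset_union_left
      · refine ((measure_mono (Set.union_subset hB₀ Set.inter_subset_right)).trans_lt
          hfin.lt_top).ne
      · rintro z (hz | ⟨hz | hz, hzΩ⟩)
        · exact .inl (.inl hz)
        · exact .inl (.inr ⟨hz, hzΩ⟩)
        · exact .inr (.inr ⟨hz, hzΩ⟩)
    · intro x hx
      obtain ⟨e, c, hc0, ρ, hρ, T, hT, hcone⟩ := h x hx
      set t := T / 2 with htdef
      have ht : 0 < t := by positivity
      -- Points of the `δ`-ball about `x` have distance less than `c * t` from `y`, so the shift by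
      -- `t • e` sends them into the ball given by the cone at `y`.
      set δ := min ρ (c * t / 2) with hδ
      have hδ0 : 0 < δ := by positivity
      obtain ⟨y, hyΩ, hyx⟩ := Metric.mem_closure_iff.1 hx δ hδ0
      rw [dist_comm] at hyx
      have hBy := hcone y hyΩ (hyx.trans_le (min_le_left _ _)) t ht (by linarith)
      refine ⟨Metric.ball x δ, mem_nhdsWithin_of_mem_nhds (Metric.ball_mem_nhds x hδ0), ?_⟩
      have hV := step (y + t • e) (c * t) (by positivity) hBy
        ⟨y + t • e, hS (hBy (Metric.mem_ball_self (by positivity))),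
          Metric.mem_ball_self (by positivity)⟩
      have hU : PoincareOn Ω (Metric.ball x δ ∩ Ω) := by
        refine hV.translate (Metric.isOpen_ball.inter ho).measurableSet
          (Metric.isOpen_ball.union Metric.isOpen_ball).measurableSet hm (h := t • e) ?_ ?_
        · rintro z ⟨hz, -⟩
          right
          rw [Metric.mem_ball, dist_add_right]
          have h1 : dist z x < c * t / 2 := (Metric.mem_ball.1 hz).trans_le (min_le_right _ _)
          have h2 : dist y x < c * t / 2 := hyx.trans_le (min_le_right _ _)
          linarith [dist_triangle_right z y x]
        · rintro z ⟨hz, hzΩ⟩ r ⟨hr0, hr1⟩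
          rw [smul_smul]
          exact hcone z hzΩ ((Metric.mem_ball.1 hz).trans_le (min_le_left _ _)) (r * t)
            (by positivity) (by nlinarith) (Metric.mem_ball_self (by positivity))
      obtain ⟨s, hs, hW⟩ := hS hyΩ
      refine (hW.union hU ?_ ((measure_mono Set.inter_subset_right).trans_lt hfin.lt_top).ne).mono
        (Set.union_subset_union_left _ Set.subset_union_left)
      refine ((Metric.isOpen_ball.inter (Metric.isOpen_ball.inter ho)).measure_pos volume
        ⟨y, Metric.mem_ball_self hs, hyx, hyΩ⟩).ne' ∘ measure_mono_null ?_
      exact Set.inter_subset_inter_left _ Set.subset_union_right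
  refine main.mono fun z hz ↦ .inr ⟨subset_closure hz, hz⟩

end VirtualElement

namespace VirtualElement

/-! ### Parallelograms and segments -/

/-- The affine parametrization of the plane with origin `x` and axes `a`, `b`. -/
def param (x a b : Plane) (p : ℝ × ℝ) : Plane := x + p.1 • a + p.2 • b

/-- By uniqueness of Haar measure the image of Lebesgue measure is a multiple of it. The factor does
not depend on the origin `x`, and its value is never needed. -/
theorem exists_map_param {a b : Plane} (h : LinearIndependent ℝ ![a, b]) :
    ∃ k : ℝ≥0∞, k ≠ 0 ∧ k ≠ ⊤ ∧ ∀ x, MeasurableEmbedding (param x a b) ∧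
      Measure.map (param x a b) volume = k • volume := by
  let f : ℝ × ℝ →ₗ[ℝ] Plane :=
    (LinearMap.fst ℝ ℝ ℝ).smulRight a + (LinearMap.snd ℝ ℝ ℝ).smulRight b
  have hf : Function.Injective f := by
    rw [← LinearMap.ker_eq_bot, LinearMap.ker_eq_bot']
    rintro ⟨s, t⟩ hst
    obtain ⟨h1, h2⟩ := LinearIndependent.pair_iff.1 h s t hst
    rw [h1, h2]; rfl
  let g := (LinearEquiv.ofInjectiveOfFinrankEq f hf (by simp)).toContinuousLinearEquiv
  have hg : ∀ p, g p = p.1 • a + p.2 • b := fun p ↦ rfl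
  have h1 : (Measure.map g volume).IsAddHaarMeasure := g.isAddHaarMeasure_map volume
  obtain ⟨k, hk0, hk1, hk⟩ : ∃ k : ℝ≥0∞, k ≠ 0 ∧ k ≠ ⊤ ∧
      Measure.map g volume = k • (volume : Measure Plane) := by
    refine ⟨_, ?_, ENNReal.coe_ne_top, Measure.isAddLeftInvariant_eq_smul _ _⟩
    exact ENNReal.coe_ne_zero.2 (Measure.addHaarScalarFactor_pos_of_isAddHaarMeasure _ _).ne'
  refine ⟨k, hk0, hk1, fun x ↦ ?_⟩
  have e : param x a b = (MeasurableEquiv.addLeft x) ∘ g := by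
    ext1 p
    simp [param, hg, add_assoc]
  constructor
  · rw [e]
    exact (MeasurableEquiv.addLeft x).measurableEmbedding.comp
      g.toHomeomorph.toMeasurableEquiv.measurableEmbedding
  · rw [e, ← Measure.map_map (MeasurableEquiv.measurable _) g.continuous.measurable, hk,
      Measure.map_smul]
    congr 1
    exact map_add_left_eq_self volume x

/-- The trace inequality on one side of a parallelogram: the value on the side is the value at depth
`t` minus an increment bounded by the gradient. Average over `t`, then change variables to area. -/
theorem lintegral_edge_sq_le {Ω : Set Plane} (hΩ : MeasurableSet Ω) {p τ h : Plane}
    (hi : LinearIndependent ℝ ![τ, h]) {S : Set ℝ} (hS : MeasurableSet S)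
    (hSΩ : ∀ s ∈ S, ∀ t ∈ Set.Ioc (0 : ℝ) 1, p + s • τ + t • h ∈ Ω) :
    ∃ C : ℝ≥0, ∀ φ : Plane → ℝ, ContDiff ℝ ∞ φ → ∫⁻ s in S, ‖φ (p + s • τ)‖ₑ ^ 2 ≤
      C * ((∫⁻ y in Ω, ‖φ y‖ₑ ^ 2) + ∫⁻ y in Ω, ‖gradient φ y‖ₑ ^ 2) := by
  obtain ⟨k, -, hk, hmap⟩ := exists_map_param hi
  obtain ⟨hemb, hmap⟩ := hmap p
  have key : ∀ F : Plane → ℝ≥0∞, Measurable F →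
      ∫⁻ s in S, ∫⁻ t in Set.Ioc (0 : ℝ) 1, F (p + s • τ + t • h) ≤ k * ∫⁻ y in Ω, F y := by
    intro F hF
    have m : Measurable fun z : ℝ × ℝ ↦ F (p + z.1 • τ + z.2 • h) :=
      hF.comp (by fun_prop)
    calc ∫⁻ s in S, ∫⁻ t in Set.Ioc (0 : ℝ) 1, F (p + s • τ + t • h)
        = ∫⁻ z in S ×ˢ Set.Ioc (0 : ℝ) 1, F (param p τ h z) := by
          rw [Measure.volume_eq_prod, ← Measure.prod_restrict, 
            lintegral_prod (fun z ↦ F (param p τ h z)) m.aemeasurable]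
          rfl
      _ ≤ ∫⁻ z, Ω.indicator F (param p τ h z) := by
          rw [← lintegral_indicator (hS.prod measurableSet_Ioc)]
          refine lintegral_mono fun z ↦ ?_
          by_cases hz : z ∈ S ×ˢ Set.Ioc (0 : ℝ) 1
          · rw [Set.indicator_of_mem hz, Set.indicator_of_mem (show param p τ h z ∈ Ω from
              hSΩ _ hz.1 _ hz.2)]
          · simp [hz]
      _ = k * ∫⁻ y in Ω, F y := by
          rw [← hemb.lintegral_map (Ω.indicator F), hmap, lintegral_smul_measure,
            lintegral_indicator hΩ, smul_eq_mul]
  refine ⟨(2 * (1 + ‖h‖ₑ ^ 2) * k).toNNReal, fun φ hφ ↦ ?_⟩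
  have hφc := hφ.continuous
  have hgc := continuous_gradient hφ
  have m1 : Measurable fun y ↦ ‖φ y‖ₑ ^ 2 := hφc.enorm.measurable.pow_const 2
  have m2 : Measurable fun y ↦ ‖gradient φ y‖ₑ ^ 2 := hgc.enorm.measurable.pow_const 2
  have m1' : Measurable fun z : ℝ × ℝ ↦ ‖φ (p + z.1 • τ + z.2 • h)‖ₑ ^ 2 :=
    m1.comp (by fun_prop)
  have m2' : Measurable fun z : ℝ × ℝ ↦ ‖gradient φ (p + z.1 • τ + z.2 • h)‖ₑ ^ 2 :=
    m2.comp (by fun_prop)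
  set A := ∫⁻ y in Ω, ‖φ y‖ₑ ^ 2
  set I := ∫⁻ y in Ω, ‖gradient φ y‖ₑ ^ 2
  calc ∫⁻ s in S, ‖φ (p + s • τ)‖ₑ ^ 2
      ≤ ∫⁻ s in S, 2 * ((∫⁻ t in Set.Ioc (0 : ℝ) 1, ‖φ (p + s • τ + t • h)‖ₑ ^ 2) +
          ‖h‖ₑ ^ 2 * ∫⁻ r in Set.Ioc (0 : ℝ) 1, ‖gradient φ (p + s • τ + r • h)‖ₑ ^ 2) := by
        refine lintegral_mono fun s ↦ ?_
        -- Terms independent of `t` are written as integrals over an interval of length one, so that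
        -- the estimate can be made under the integral.
        have e : ‖φ (p + s • τ)‖ₑ ^ 2 =
          ∫⁻ t in Set.Ioc (0 : ℝ) 1, ‖φ (p + s • τ)‖ₑ ^ 2 := by simp
        have e' : ∀ c : ℝ≥0∞, c = ∫⁻ t in Set.Ioc (0 : ℝ) 1, c := by simp
        rw [e, e' (‖h‖ₑ ^ 2 * _), ← lintegral_add_right _ measurable_const,
          ← lintegral_const_mul' 2 _ (by simp)]
        refine setLIntegral_mono' measurableSet_Ioc fun t ht ↦ ?_
        have h1 := enorm_sub_sq_le hφ (p + s • τ) h ht.1.le ht.2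
        have h2 := enorm_add_sq_le (φ (p + s • τ + t • h))
          (-(φ (p + s • τ + t • h) - φ (p + s • τ)))
        rw [enorm_neg, ← sub_eq_add_neg, sub_sub_cancel] at h2
        refine h2.trans ?_
        gcongr
    _ = 2 * ((∫⁻ s in S, ∫⁻ t in Set.Ioc (0 : ℝ) 1, ‖φ (p + s • τ + t • h)‖ₑ ^ 2) +
          ‖h‖ₑ ^ 2 * ∫⁻ s in S, ∫⁻ r in Set.Ioc (0 : ℝ) 1,
            ‖gradient φ (p + s • τ + r • h)‖ₑ ^ 2) := by
        rw [lintegral_const_mul' 2 _ (by simp), lintegral_add_left m1'.lintegral_prod_right',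
          lintegral_const_mul _ m2'.lintegral_prod_right']
    _ ≤ 2 * (k * A + ‖h‖ₑ ^ 2 * (k * I)) := by
        gcongr
        · exact key _ m1
        · exact key _ m2
    _ ≤ _ := by
        rw [ENNReal.coe_toNNReal (ENNReal.mul_ne_top (ENNReal.mul_ne_top (by simp)
          (by simp)) hk)]
        calc 2 * (k * A + ‖h‖ₑ ^ 2 * (k * I)) ≤ 2 * (k * A + ‖h‖ₑ ^ 2 * (k * I)) +
              2 * (k * I + ‖h‖ₑ ^ 2 * (k * A)) := le_self_add
          _ = _ := by ring

theorem hausdorffMeasure_restrict_segment (p q : Plane) :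
    (μH[1] : Measure Plane).restrict (segment ℝ p q) =
      ENNReal.ofReal (dist p q) • Measure.map (fun s : ℝ ↦ p + s • (q - p))
        (volume.restrict (Set.Icc 0 1)) := by
  have e : (fun s : ℝ ↦ p + s • (q - p)) = AffineMap.lineMap p q := by
    ext1 s
    rw [AffineMap.lineMap_apply, vsub_eq_sub, vadd_eq_add, add_comm]
  have hc : Continuous fun s : ℝ ↦ p + s • (q - p) := by fun_prop
  ext A hA
  rw [Measure.restrict_apply hA, Measure.smul_apply, Measure.map_apply hc.measurable hA,
    Measure.restrict_apply (hA.preimage hc.measurable), e, smul_eq_mul]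
  rw [segment_eq_image_lineMap, Set.inter_comm, ← Set.image_inter_preimage,
    hausdorffMeasure_lineMap_image, hausdorffMeasure_real, Set.inter_comm]
  rw [ENNReal.smul_def, smul_eq_mul, nndist_dist, ENNReal.ofReal]

theorem lintegral_segment {p q : Plane} {f : Plane → ℝ≥0∞} (hf : Measurable f) :
    ∫⁻ x in segment ℝ p q, f x ∂μH[1] =
      ENNReal.ofReal (dist p q) * ∫⁻ s in Set.Icc (0 : ℝ) 1, f (p + s • (q - p)) := by
  rw [hausdorffMeasure_restrict_segment p q, lintegral_smul_measure,
    lintegral_map hf (by fun_prop), smul_eq_mul]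

theorem integral_segment {p q : Plane} {f : Plane → ℝ} (hf : Continuous f) :
    ∫ x in segment ℝ p q, f x ∂μH[1] =
      dist p q * ∫ s in Set.Icc (0 : ℝ) 1, f (p + s • (q - p)) := by
  rw [hausdorffMeasure_restrict_segment p q, integral_smul_measure,
    integral_map (by fun_prop) hf.aestronglyMeasurable, ENNReal.toReal_ofReal dist_nonneg,
    smul_eq_mul]

theorem isClosed_segment (p q : Plane) : IsClosed (segment ℝ p q) := by
  rw [segment_eq_image_lineMap]
  exact (isCompact_Icc.image AffineMap.lineMap_continuous).isClosed

/-- The trace inequality on a segment in the closure of an open set with inward cones. -/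
theorem HasInwardCones.lintegral_segment_sq_le {Ω : Set Plane} (h : HasInwardCones Ω)
    (ho : IsOpen Ω) {p q : Plane} (hpq : p ≠ q) (hcl : segment ℝ p q ⊆ closure Ω)
    (hd : Disjoint (segment ℝ p q) Ω) :
    ∃ C : ℝ≥0, ∀ φ : Plane → ℝ, ContDiff ℝ ∞ φ →
      ∫⁻ x in segment ℝ p q, ‖φ x‖ₑ ^ 2 ∂μH[1] ≤
        C * ((∫⁻ y in Ω, ‖φ y‖ₑ ^ 2) + ∫⁻ y in Ω, ‖gradient φ y‖ₑ ^ 2) := by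
  have hmem : ∀ s ∈ Set.Icc (0 : ℝ) 1, p + s • (q - p) ∈ segment ℝ p q := by
    intro s hs
    rw [segment_eq_image']
    exact ⟨s, hs, rfl⟩
  -- Compactness of the parameter interval reduces the claim to a neighbourhood of each parameter,
  -- where one shift direction serves all points.
  have loc : ∃ C : ℝ≥0, ∀ φ : Plane → ℝ, ContDiff ℝ ∞ φ →
      ∫⁻ s in Set.Icc (0 : ℝ) 1, ‖φ (p + s • (q - p))‖ₑ ^ 2 ≤
        C * ((∫⁻ y in Ω, ‖φ y‖ₑ ^ 2) + ∫⁻ y in Ω, ‖gradient φ y‖ₑ ^ 2) := by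
    refine isCompact_Icc.induction_on (s := Set.Icc (0 : ℝ) 1)
      (p := fun S ↦ ∃ C : ℝ≥0, ∀ φ : Plane → ℝ, ContDiff ℝ ∞ φ →
        ∫⁻ s in S, ‖φ (p + s • (q - p))‖ₑ ^ 2 ≤
        C * ((∫⁻ y in Ω, ‖φ y‖ₑ ^ 2) + ∫⁻ y in Ω, ‖gradient φ y‖ₑ ^ 2)) ?_ ?_ ?_ ?_
    · exact ⟨0, by simp⟩
    · rintro S S' hSS' ⟨C, hC⟩
      exact ⟨C, fun φ hφ ↦ (lintegral_mono_set hSS').trans (hC φ hφ)⟩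
    · rintro S S' ⟨C, hC⟩ ⟨C', hC'⟩
      refine ⟨C + C', fun φ hφ ↦ (lintegral_union_le _ _ _).trans ?_⟩
      rw [ENNReal.coe_add, add_mul]
      exact add_le_add (hC φ hφ) (hC' φ hφ)
    · intro s₀ hs₀
      obtain ⟨e, c, hc, ρ, hρ, T, hT, hcone⟩ := h _ (hcl (hmem s₀ hs₀))
      -- The room in the cone absorbs the passage from points of `Ω` to points of its closure.
      have cone' : ∀ z ∈ closure Ω, dist z (p + s₀ • (q - p)) < ρ → ∀ t : ℝ, 0 < t → t < T →
          z + t • e ∈ Ω := by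
        intro z hz hzx t ht htT
        obtain ⟨y, hy, hyz⟩ := Metric.mem_closure_iff.1 hz
          (min (c * t) (ρ - dist z (p + s₀ • (q - p)))) (lt_min (by positivity) (by linarith))
        refine hcone y hy ?_ t ht htT ?_
        · have := hyz.trans_le (min_le_right _ _)
          rw [dist_comm] at this
          linarith [dist_triangle y z (p + s₀ • (q - p))]
        · rw [Metric.mem_ball, dist_add_right]
          exact hyz.trans_le (min_le_left _ _)
      have hcont : Continuous fun s : ℝ ↦ p + s • (q - p) := by fun_prop
      set S : Set ℝ := Set.Icc 0 1 ∩ (fun s : ℝ ↦ p + s • (q - p)) ⁻¹' Metric.ball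
        (p + s₀ • (q - p)) ρ with hS
      have hSm : MeasurableSet S :=
        measurableSet_Icc.inter (Metric.isOpen_ball.preimage hcont).measurableSet
      refine ⟨S, inter_mem self_mem_nhdsWithin (mem_nhdsWithin_of_mem_nhds
        (hcont.continuousAt.preimage_mem_nhds (Metric.ball_mem_nhds _ hρ))), ?_⟩
      have hcone2 : ∀ s ∈ S, ∀ t ∈ Set.Ioc (0 : ℝ) 1,
          p + s • (q - p) + t • ((T / 2) • e) ∈ Ω := by
        rintro s ⟨hs, hsx⟩ t ⟨ht, ht1⟩
        rw [smul_smul]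
        exact cone' _ (hcl (hmem s hs)) hsx _ (by positivity) (by nlinarith)
      refine lintegral_edge_sq_le ho.measurableSet ?_ hSm hcone2
      have hqp : q - p ≠ 0 := sub_ne_zero.2 hpq.symm
      rw [LinearIndependent.pair_iff' hqp]
      intro a ha
      -- some point of the segment near `s₀` would be moved into `Ω` along the segment
      obtain ⟨s, hsS, t, ht, hst⟩ : ∃ s ∈ S, ∃ t ∈ Set.Ioc (0 : ℝ) 1,
          s + t * a ∈ Set.Icc (0 : ℝ) 1 := by
        obtain ⟨ε, hε, hball⟩ : ∃ ε > 0, ∀ s ∈ Set.Icc (0 : ℝ) 1, |s - s₀| < ε → s ∈ S := by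
          obtain ⟨ε, hε, hb⟩ := Metric.isOpen_iff.1 (Metric.isOpen_ball.preimage hcont) s₀
            (Metric.mem_ball_self hρ)
          exact ⟨ε, hε, fun s hs hss ↦ ⟨hs, hb hss⟩⟩
        -- If the shift were parallel to the segment, a small shift from a parameter strictly inside
        -- would stay on the segment, which misses `Ω`. Strictness is needed because the sign of `a`
        -- is unknown.
        obtain ⟨s, hs, hss⟩ : ∃ s ∈ Set.Ioo (0 : ℝ) 1, |s - s₀| < ε := by
          have : s₀ ∈ closure (Set.Ioo (0 : ℝ) 1) := by rwa [closure_Ioo (by norm_num)]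
          obtain ⟨s, hs, hss⟩ := Metric.mem_closure_iff.1 this ε hε
          exact ⟨s, hs, by rwa [abs_sub_comm]⟩
        refine ⟨s, hball s ⟨hs.1.le, hs.2.le⟩ hss, ?_⟩
        have hlim : Tendsto (fun t : ℝ ↦ s + t * a) (𝓝[>] 0) (𝓝 s) := by
          have : Tendsto (fun t : ℝ ↦ s + t * a) (𝓝 0) (𝓝 (s + 0 * a)) :=
            (Continuous.tendsto (by fun_prop) _)
          rw [zero_mul, add_zero] at this
          exact this.mono_left nhdsWithin_le_nhds
        obtain ⟨t, ht1, ht2⟩ := ((hlim.eventually (Icc_mem_nhds hs.1 hs.2)).and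
          (Ioc_mem_nhdsGT (zero_lt_one' ℝ))).exists
        exact ⟨t, ht2, ht1⟩
      refine hd.le_bot ⟨hmem _ hst, ?_⟩
      have := hcone2 s hsS t ht
      rwa [← ha, smul_smul, add_assoc, ← add_smul] at this
  obtain ⟨C, hC⟩ := loc
  refine ⟨(ENNReal.ofReal (dist p q)).toNNReal * C, fun φ hφ ↦ ?_⟩
  rw [lintegral_segment (hφ.continuous.enorm.measurable.pow_const 2), ENNReal.coe_mul,
    ENNReal.coe_toNNReal ENNReal.ofReal_ne_top, mul_assoc]
  gcongr
  exact hC φ hφ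

end VirtualElement

namespace VirtualElement

/-! ### The geometry of the boundary -/

theorem _root_.IsPreconnected.subset_or_disjoint_of_disjoint_frontier {X : Type*}
    [TopologicalSpace X] {A U : Set X} (hA : IsPreconnected A) (hU : IsOpen U)
    (h : Disjoint A (frontier U)) : A ⊆ U ∨ Disjoint A U := by
  by_cases hne : (A ∩ U).Nonempty
  · refine .inl (hA.subset_left_of_subset_union hU isClosed_closure.isOpen_compl
      (Set.disjoint_compl_right_iff_subset.2 subset_closure) (fun x hx ↦ ?_) hne)
    by_cases hxc : x ∈ closure U
    · by_contra hcon
      exact h.le_bot ⟨hx, hxc, fun h' ↦ hcon (.inl (interior_subset h'))⟩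
    · exact .inr hxc
  · exact .inr (Set.disjoint_iff_inter_eq_empty.2 (Set.not_nonempty_iff_eq_empty.1 hne))

/-- The closed ray with origin `x` and direction `v`. -/
def ray (x v : Plane) : Set Plane := {y | ∃ s : ℝ, 0 ≤ s ∧ y = x + s • v}

/-- The slit ball is star-shaped about a point on the radius opposite to the slit. -/
theorem isPreconnected_ball_diff_ray (x : Plane) {v : Plane} (hv : v ≠ 0) {r : ℝ} (hr : 0 < r) :
    IsPreconnected (Metric.ball x r \ ray x v) := by
  have hv' : 0 < ‖v‖ := norm_pos_iff.2 hv
  -- Puts the centre of the star at distance `r / 2` from `x`.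
  set c := r / 2 / ‖v‖ with hc
  have hc0 : 0 < c := by positivity
  have hmem : ∀ s : ℝ, x - c • v = x + s • v → s < 0 := by
    intro s hs
    have h1 : (s + c) • v = 0 := by
      rw [sub_eq_add_neg, add_right_inj] at hs
      rw [add_smul, ← hs, neg_add_cancel]
    rcases smul_eq_zero.1 h1 with h | h
    · linarith
    · exact absurd h hv
  have hstar : StarConvex ℝ (x - c • v) (Metric.ball x r \ ray x v) := by
    rintro q ⟨hq, hqr⟩ a b ha hb hab
    refine ⟨convex_ball x r ?_ hq ha hb hab, ?_⟩
    · rw [mem_ball_iff_norm, sub_sub_cancel_left, norm_neg, norm_smul, Real.norm_of_nonneg hc0.le,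
        hc, div_mul_cancel₀ _ hv'.ne']
      linarith
    · rintro ⟨s, hs, he⟩
      rcases hb.eq_or_lt with rfl | hb
      · rw [add_zero] at hab
        rw [hab, one_smul, zero_smul, add_zero] at he
        linarith [hmem s he]
      · refine hqr ⟨(s + a * c) / b, by positivity, ?_⟩
        have h1 : b • q = b • x + (s + a * c) • v := by
          have h2 : b • q = x + s • v - a • (x - c • v) := by rw [← he]; abel
          rw [h2, show b = 1 - a by linarith]
          module
        rw [div_eq_inv_mul, mul_smul, ← smul_right_inj hb.ne', h1, smul_add, smul_smul,
          smul_smul, mul_inv_cancel₀ hb.ne', one_mul]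
  refine (hstar.isPathConnected ⟨?_, ?_⟩).isConnected.isPreconnected
  · rw [mem_ball_iff_norm, sub_sub_cancel_left, norm_neg, norm_smul, Real.norm_of_nonneg hc0.le,
      hc, div_mul_cancel₀ _ hv'.ne']
    linarith
  · rintro ⟨s, hs, he⟩
    linarith [hmem s he]

/-- If the boundary of `K` consists of two rays near a boundary point `x` of its interior, then
there are boundary points of the interior on the second ray. -/
theorem exists_mem_closure_of_rays {K : Set Plane} {x v w : Plane} (hx : x ∈ closure (interior K))
    (hv : v ≠ 0) (hw : w ≠ 0) (hvw : ∀ s : ℝ, 0 < s → x + s • w ∉ ray x v) {r : ℝ} (hr : 0 < r)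
    (hK : Metric.ball x r ∩ frontier K ⊆ ray x v ∪ ray x w)
    (hrv : Metric.ball x r ∩ ray x v ⊆ frontier K) {ε : ℝ} (hε : 0 < ε) :
    ∃ s ∈ Set.Ioc 0 ε, x + s • w ∈ closure (interior K) := by
  -- If the closure of the interior misses the second ray near `x`, the frontier of the interior
  -- misses the ball slit along the first ray. That set is connected, so it lies in the interior,
  -- although it contains points of the second ray, or it is disjoint from the interior, and then
  -- `x` is not in its closure.
  by_contra! hcon
  have hw' : 0 < ‖w‖ := norm_pos_iff.2 hw
  set δ := min r (ε * ‖w‖) with hδ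
  have hδ0 : 0 < δ := by positivity
  have hfr : frontier (interior K) ⊆ frontier K := frontier_interior_subset
  have hwδ : ∀ s : ℝ, 0 ≤ s → x + s • w ∈ Metric.ball x δ → s < ε := by
    intro s hs hsδ
    rw [mem_ball_iff_norm, add_sub_cancel_left, norm_smul, Real.norm_of_nonneg hs] at hsδ
    exact lt_of_mul_lt_mul_right (hsδ.trans_le (min_le_right _ _)) hw'.le
  have hdisj : Disjoint (Metric.ball x δ \ ray x v) (frontier (interior K)) := by
    rw [Set.disjoint_left]
    rintro y ⟨hy, hyv⟩ hyf
    rcases hK ⟨Metric.ball_subset_ball (min_le_left _ _) hy, hfr hyf⟩ with h | ⟨s, hs, rfl⟩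
    · exact hyv h
    · rcases hs.eq_or_lt with rfl | hs'
      · exact hyv ⟨0, le_rfl, by simp⟩
      · exact hcon s ⟨hs', (hwδ s hs hy).le⟩ hyf.1
  have hempty : Disjoint (Metric.ball x δ \ ray x v) (interior K) := by
    refine ((isPreconnected_ball_diff_ray x hv hδ0).subset_or_disjoint_of_disjoint_frontier
      isOpen_interior hdisj).resolve_left fun hsub ↦ ?_
    have hs0 : 0 < δ / 2 / ‖w‖ := by positivity
    have hmem : x + (δ / 2 / ‖w‖) • w ∈ Metric.ball x δ := by
      rw [mem_ball_iff_norm, add_sub_cancel_left, norm_smul, Real.norm_of_nonneg hs0.le,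
        div_mul_cancel₀ _ hw'.ne']
      linarith
    exact hcon _ ⟨hs0, (hwδ _ hs0.le hmem).le⟩ (subset_closure (hsub ⟨hmem, hvw _ hs0⟩))
  obtain ⟨y, hy, hyx⟩ := Metric.mem_closure_iff.1 hx δ hδ0
  rw [dist_comm] at hyx
  by_cases hyv : y ∈ ray x v
  · exact (hrv ⟨hyx.trans_le (min_le_left _ _), hyv⟩).2 hy
  · exact hempty.le_bot ⟨⟨hyx, hyv⟩, hy⟩

/-! ### The boundary polygon and the closure of the interior -/

namespace PolygonalDomain

variable {m : ℕ} (P : PolygonalDomain m)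

/-- The initial node of the `i`-th edge. -/
def node (i : Fin m) : Plane := P.polygon.vertices i

/-- The direction vector of the `i`-th edge. -/
def dir (i : Fin m) : Plane := P.node (finRotate m i) - P.node i

/-- The point of the `i`-th edge with parameter `s ∈ [0, 1]`. -/
def point (i : Fin m) (s : ℝ) : Plane := P.node i + s • P.dir i

theorem edge_eq_segment (i : Fin m) :
    P.edge i = segment ℝ (P.node i) (P.node (finRotate m i)) :=
  affineSegment_eq_segment ..

theorem mem_edge_iff {i : Fin m} {x : Plane} :
    x ∈ P.edge i ↔ ∃ s ∈ Set.Icc (0 : ℝ) 1, P.point i s = x := by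
  rw [edge_eq_segment, segment_eq_image']
  rfl

theorem point_mem_edge (i : Fin m) {s : ℝ} (hs : s ∈ Set.Icc (0 : ℝ) 1) :
    P.point i s ∈ P.edge i :=
  P.mem_edge_iff.2 ⟨s, hs, rfl⟩

theorem point_zero (i : Fin m) : P.point i 0 = P.node i := by simp [point]

theorem point_one (i : Fin m) : P.point i 1 = P.node (finRotate m i) := by simp [point, dir]

theorem continuous_point (i : Fin m) : Continuous (P.point i) := by unfold point; fun_prop

theorem finRotate_ne (P : PolygonalDomain m) (i : Fin m) : finRotate m i ≠ i := by
  have := P.three_le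
  obtain ⟨n, rfl⟩ : ∃ n, m = n + 2 := ⟨m - 2, by omega⟩
  rw [finRotate_apply]
  simp

theorem node_ne (i : Fin m) : P.node i ≠ P.node (finRotate m i) :=
  fun h ↦ P.finRotate_ne i (P.vertices_injective h).symm

theorem dir_ne_zero (i : Fin m) : P.dir i ≠ 0 := sub_ne_zero.2 (P.node_ne i).symm

theorem point_injective (i : Fin m) : Function.Injective (P.point i) := by
  intro s t h
  exact smul_left_injective ℝ (P.dir_ne_zero i) (add_left_cancel h)

theorem eq_or_eq_of_node_mem {i j : Fin m} (h : P.node (finRotate m i) ∈ P.edge j) :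
    j = i ∨ j = finRotate m i := by
  by_contra! hij
  have hi : P.node (finRotate m i) ∈ P.edge i := by
    rw [← point_one]
    exact P.point_mem_edge i (by simp)
  by_cases hji : i = finRotate m j
  · have h1 : P.node (finRotate m i) ∈ P.polygon.edgeSet ℝ j ∩ P.polygon.edgeSet ℝ
      (finRotate m j) := ⟨h, hji ▸ hi⟩
    rw [P.edge_inter_edge j, ← hji] at h1
    exact P.finRotate_ne i (P.vertices_injective h1)
  · exact (P.edge_disjoint i j hij.1.symm hij.2 hji).le_bot ⟨hi, h⟩

theorem eq_of_point_mem {i j : Fin m} {s : ℝ} (hs : s ∈ Set.Ioo (0 : ℝ) 1)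
    (h : P.point i s ∈ P.edge j) : j = i := by
  by_contra hji
  have hi : P.point i s ∈ P.edge i := P.point_mem_edge i ⟨hs.1.le, hs.2.le⟩
  by_cases h1 : j = finRotate m i
  · have h2 : P.point i s ∈ P.polygon.edgeSet ℝ i ∩ P.polygon.edgeSet ℝ (finRotate m i) :=
      ⟨hi, h1 ▸ h⟩
    rw [P.edge_inter_edge i] at h2
    exact hs.2.ne (P.point_injective i (h2.trans (P.point_one i).symm))
  · by_cases h2 : i = finRotate m j
    · have h3 : P.point i s ∈ P.polygon.edgeSet ℝ j ∩ P.polygon.edgeSet ℝ (finRotate m j) :=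
        ⟨h, h2 ▸ hi⟩
      rw [P.edge_inter_edge j, ← h2] at h3
      exact hs.1.ne' (P.point_injective i (h3.trans (P.point_zero i).symm))
    · exact (P.edge_disjoint i j (Ne.symm hji) h1 h2).le_bot ⟨hi, h⟩

theorem frontier_eq_iUnion : frontier P.carrier = ⋃ i, P.edge i := P.frontier_eq

theorem edge_subset_frontier (i : Fin m) : P.edge i ⊆ frontier P.carrier :=
  P.frontier_eq_iUnion ▸ Set.subset_iUnion P.edge i

theorem isClosed_edge (i : Fin m) : IsClosed (P.edge i) :=
  P.edge_eq_segment i ▸ isClosed_segment _ _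

theorem exists_ball_inter_frontier_subset (x : Plane) (F : Set (Fin m))
    (h : ∀ j, x ∈ P.edge j → j ∈ F) :
    ∃ r > 0, Metric.ball x r ∩ frontier P.carrier ⊆ ⋃ j ∈ F, P.edge j := by
  have hcl : IsClosed (⋃ j ∈ Fᶜ, P.edge j) :=
    (Set.toFinite _).isClosed_biUnion fun j _ ↦ P.isClosed_edge j
  have hx : x ∈ (⋃ j ∈ Fᶜ, P.edge j)ᶜ := by
    simp only [Set.mem_compl_iff, Set.mem_iUnion, not_exists]
    exact fun j hj hxj ↦ hj (h j hxj)
  obtain ⟨r, hr, hB⟩ := Metric.isOpen_iff.1 hcl.isOpen_compl x hx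
  refine ⟨r, hr, fun y ⟨hy, hyf⟩ ↦ ?_⟩
  rw [P.frontier_eq_iUnion, Set.mem_iUnion] at hyf
  obtain ⟨j, hj⟩ := hyf
  refine Set.mem_biUnion ?_ hj
  by_contra hjF
  exact hB hy (Set.mem_biUnion hjF hj)

theorem edge_subset_ray_node (i : Fin m) : P.edge i ⊆ ray (P.node i) (P.dir i) := by
  intro y hy
  obtain ⟨s, hs, rfl⟩ := P.mem_edge_iff.1 hy
  exact ⟨s, hs.1, rfl⟩

theorem edge_subset_ray_node' (i : Fin m) :
    P.edge i ⊆ ray (P.node (finRotate m i)) (-P.dir i) := by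
  intro y hy
  obtain ⟨s, hs, rfl⟩ := P.mem_edge_iff.1 hy
  refine ⟨1 - s, sub_nonneg.2 hs.2, ?_⟩
  rw [← P.point_one, point, point]
  module

/-- Near a point of an edge the boundary consists of two rays: the two halves of the edge, or the
previous edge and this one at a node. So membership in the closure of the interior moves forward a
little. -/
theorem exists_point_mem_closure (i : Fin m) {s : ℝ} (hs : s ∈ Set.Ico (0 : ℝ) 1)
    (hcl : P.point i s ∈ closure (interior P.carrier)) {ε : ℝ} (hε : 0 < ε) :
    ∃ t ∈ Set.Ioc 0 ε, P.point i (s + t) ∈ closure (interior P.carrier) := by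
  have hp : ∀ t, P.point i s + t • P.dir i = P.point i (s + t) := fun t ↦ by
    simp only [point]; module
  have hd : 0 < ‖P.dir i‖ := norm_pos_iff.2 (P.dir_ne_zero i)
  simp only [← hp]
  rcases hs.1.eq_or_lt with rfl | hs0
  · obtain ⟨j, rfl⟩ := (finRotate m).surjective i
    rw [point_zero] at hcl ⊢
    obtain ⟨r, hr, hr1⟩ := P.exists_ball_inter_frontier_subset (P.node (finRotate m j))
      {j, finRotate m j} fun k hk ↦ P.eq_or_eq_of_node_mem hk
    have hdj : 0 < ‖P.dir j‖ := norm_pos_iff.2 (P.dir_ne_zero j)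
    have hmem : ∀ u ∈ Set.Icc (0 : ℝ) 1, P.node (finRotate m j) + u • -P.dir j ∈ P.edge j := by
      intro u hu
      refine P.mem_edge_iff.2 ⟨1 - u, ⟨by linarith [hu.2], by linarith [hu.1]⟩, ?_⟩
      rw [← P.point_one, point, point]
      module
    refine exists_mem_closure_of_rays hcl (neg_ne_zero.2 (P.dir_ne_zero j)) (P.dir_ne_zero _) ?_
      (r := min r ‖P.dir j‖) (by positivity) ?_ ?_ hε
    · rintro t ht ⟨u, hu, he⟩
      rw [add_right_inj] at he
      have h1 : min 1 t ≤ 1 := min_le_left _ _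
      have h0 : 0 < min 1 t := by positivity
      -- If the two rays met beyond the node, dividing both parameters by `t + u` would bring the
      -- meeting point onto both edges, which share only the node.
      have hpos : 0 < t + u := by linarith
      have ha : P.point (finRotate m j) (t / (t + u)) ∈ P.edge (finRotate m j) :=
        P.point_mem_edge _ ⟨by positivity, by rw [div_le_one hpos]; linarith⟩
      have hb : P.node (finRotate m j) + (u / (t + u)) • -P.dir j ∈ P.edge j :=
        hmem _ ⟨by positivity, by rw [div_le_one hpos]; linarith⟩
      have hab : P.point (finRotate m j) (t / (t + u)) =
          P.node (finRotate m j) + (u / (t + u)) • -P.dir j := by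
        rw [point, div_eq_inv_mul, div_eq_inv_mul, mul_smul, he, mul_smul]
      have : P.point (finRotate m j) (t / (t + u)) ∈
          P.polygon.edgeSet ℝ j ∩ P.polygon.edgeSet ℝ (finRotate m j) := ⟨hab ▸ hb, ha⟩
      rw [P.edge_inter_edge j] at this
      have h2 := P.point_injective _ (this.trans (P.point_zero _).symm)
      rw [div_eq_zero_iff] at h2
      rcases h2 with h2 | h2 <;> linarith
    · rintro y ⟨hy, hyf⟩
      have := hr1 ⟨Metric.ball_subset_ball (min_le_left _ _) hy, hyf⟩
      simp only [Set.mem_insert_iff, Set.mem_singleton_iff, Set.iUnion_iUnion_eq_or_left,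
        Set.iUnion_iUnion_eq_left] at this
      exact this.imp (fun h ↦ P.edge_subset_ray_node' j h) fun h ↦ P.edge_subset_ray_node _ h
    · rintro y ⟨hy, u, hu, rfl⟩
      refine P.edge_subset_frontier j (hmem u ⟨hu, ?_⟩)
      rw [mem_ball_iff_norm, add_sub_cancel_left, norm_smul, Real.norm_of_nonneg hu, norm_neg]
        at hy
      nlinarith [hy.trans_le (min_le_right _ _)]
  · obtain ⟨r, hr, hr1⟩ := P.exists_ball_inter_frontier_subset (P.point i s)
      {i} fun k hk ↦ P.eq_of_point_mem ⟨hs0, hs.2⟩ hk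
    refine exists_mem_closure_of_rays hcl (neg_ne_zero.2 (P.dir_ne_zero i)) (P.dir_ne_zero _) ?_
      (r := min r (s * ‖P.dir i‖)) (by positivity) ?_ ?_ hε
    · rintro t ht ⟨u, hu, he⟩
      rw [add_right_inj, smul_neg, ← neg_smul] at he
      have := smul_left_injective ℝ (P.dir_ne_zero i) he
      linarith
    · rintro y ⟨hy, hyf⟩
      have := hr1 ⟨Metric.ball_subset_ball (min_le_left _ _) hy, hyf⟩
      simp only [Set.mem_singleton_iff, Set.iUnion_iUnion_eq_left] at this
      obtain ⟨t, ht, rfl⟩ := P.mem_edge_iff.1 this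
      rcases le_total t s with h | h
      · exact .inl ⟨s - t, sub_nonneg.2 h, by simp only [point]; module⟩
      · exact .inr ⟨t - s, sub_nonneg.2 h, by simp only [point]; module⟩
    · rintro y ⟨hy, u, hu, rfl⟩
      rw [mem_ball_iff_norm, add_sub_cancel_left, norm_smul, Real.norm_of_nonneg hu, norm_neg]
        at hy
      have hus : u < s := lt_of_mul_lt_mul_right (hy.trans_le (min_le_right _ _)) hd.le
      rw [smul_neg, ← neg_smul, hp]
      exact P.edge_subset_frontier i (P.point_mem_edge i ⟨by linarith, by linarith [hs.2]⟩)

/-- Continuous induction: the set of good parameters is closed and can always be extended to the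
right. -/
theorem Icc_subset_closure (i : Fin m) {s : ℝ} (hs : s ∈ Set.Icc (0 : ℝ) 1)
    (hcl : P.point i s ∈ closure (interior P.carrier)) :
    Set.Icc s 1 ⊆ P.point i ⁻¹' closure (interior P.carrier) := by
  refine IsClosed.Icc_subset_of_forall_exists_gt
    ((isClosed_closure.preimage (P.continuous_point i)).inter isClosed_Icc) hcl ?_
  rintro x ⟨hx, hsx, hx1⟩ y hxy
  obtain ⟨t, ht, htc⟩ := P.exists_point_mem_closure i ⟨hs.1.trans hsx, hx1⟩ hx
    (sub_pos.2 hxy)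
  exact ⟨x + t, htc, by linarith [ht.1], by linarith [ht.2]⟩

/-- The graph condition speaks of the interior only, so by itself it does not exclude boundary
points away from the interior. Here some boundary point is a limit of interior points, and this
property travels along the edges around the whole polygon. -/
theorem frontier_subset_closure_interior : frontier P.carrier ⊆ closure (interior P.carrier) := by
  have hrot : ∀ i, P.node i ∈ closure (interior P.carrier) →
      P.node (finRotate m i) ∈ closure (interior P.carrier) := by
    intro i hi
    rw [← point_one]
    exact P.Icc_subset_closure i (s := 0) (by simp) (by rwa [point_zero]) (by simp)
  obtain ⟨i₀, hi₀⟩ : ∃ i, P.node i ∈ closure (interior P.carrier) := by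
    have hne : (frontier (interior P.carrier)).Nonempty := by
      rw [nonempty_frontier_iff]
      refine ⟨P.isConnected_interior.nonempty, fun h ↦ ?_⟩
      exact (NormedSpace.noncompactSpace ℝ Plane).noncompact_univ (by
        have : P.carrier = Set.univ := Set.univ_subset_iff.1 (h ▸ interior_subset)
        exact this ▸ P.isCompact)
    obtain ⟨x, hx⟩ := hne
    have hxf := frontier_interior_subset hx
    rw [P.frontier_eq_iUnion, Set.mem_iUnion] at hxf
    obtain ⟨i, hi⟩ := hxf
    obtain ⟨s, hs, rfl⟩ := P.mem_edge_iff.1 hi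
    refine ⟨finRotate m i, ?_⟩
    rw [← point_one]
    exact P.Icc_subset_closure i hs hx.1 ⟨hs.2, le_rfl⟩
  have hall : ∀ i, P.node i ∈ closure (interior P.carrier) := by
    intro i
    -- The rotation is a single cycle, so every node is reached from `i₀`.
    have hcyc : (finRotate m).IsCycle := isCycle_finRotate_of_le (by have := P.three_le; omega)
    obtain ⟨n, rfl⟩ := hcyc.exists_pow_eq (P.finRotate_ne i₀) (P.finRotate_ne i)
    induction n with
    | zero => exact hi₀
    | succ n ih => rw [pow_succ', Equiv.Perm.mul_apply]; exact hrot _ ih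
  rw [P.frontier_eq_iUnion]
  refine Set.iUnion_subset fun i x hx ↦ ?_
  obtain ⟨s, hs, rfl⟩ := P.mem_edge_iff.1 hx
  exact P.Icc_subset_closure i (s := 0) (by simp) (by rw [point_zero]; exact hall i) hs

end PolygonalDomain
end VirtualElement

namespace VirtualElement

/-! ### The interior lies locally on one side of an edge -/

/-- The rotation of a vector by a right angle. -/
def rot (d : Plane) : Plane := !₂[-(d 1), d 0]

theorem inner_rot_self (d : Plane) : inner ℝ (rot d) d = 0 := by
  simp [rot, PiLp.inner_apply, Fin.sum_univ_two]
  ring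

theorem rot_ne_zero {d : Plane} (hd : d ≠ 0) : rot d ≠ 0 := by
  intro h
  refine hd ?_
  have h0 := congrArg (fun v : Plane ↦ v 0) h
  have h1 := congrArg (fun v : Plane ↦ v 1) h
  simp [rot] at h0 h1
  ext i
  fin_cases i
  · simpa using h1
  · simpa using h0

theorem exists_smul_of_inner_rot_eq_zero {d y : Plane} (hd : d ≠ 0)
    (h : inner ℝ (rot d) y = 0) : ∃ u : ℝ, y = u • d := by
  simp only [rot, PiLp.inner_apply, Fin.sum_univ_two, Matrix.cons_val_zero, Matrix.cons_val_one,
    RCLike.inner_apply, conj_trivial] at h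
  by_cases h0 : d 0 = 0
  · have h1 : d 1 ≠ 0 := by
      intro h1
      refine hd ?_
      ext i
      fin_cases i
      · simpa using h0
      · simpa using h1
    refine ⟨y 1 / d 1, ?_⟩
    rw [h0] at h
    ext i
    fin_cases i
    · simp [h0]
      rcases mul_eq_zero.1 (by linarith : y 0 * d 1 = 0) with h2 | h2
      · exact h2
      · exact absurd h2 h1
    · simp [h1]
  · refine ⟨y 0 / d 0, ?_⟩
    ext i
    fin_cases i
    · simp [h0]
    · simp
      field_simp
      linarith

theorem linearIndependent_of_inner_eq_zero {a b : Plane} (ha : a ≠ 0) (hb : b ≠ 0)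
    (h : inner ℝ b a = 0) : LinearIndependent ℝ ![a, b] := by
  rw [LinearIndependent.pair_iff' ha]
  rintro c rfl
  rw [inner_smul_left] at h
  rcases mul_eq_zero.1 h with h | h
  · rw [conj_trivial] at h
    exact hb (by rw [h, zero_smul])
  · exact ha (inner_self_eq_zero.1 h)

namespace PolygonalDomain

variable {m : ℕ} (P : PolygonalDomain m)

theorem point_sub_point (i : Fin m) (s t : ℝ) :
    P.point i s - P.point i t = (s - t) • P.dir i := by
  simp only [point]; module

theorem exists_ball_point (i : Fin m) {s : ℝ} (hs : s ∈ Set.Ioo (0 : ℝ) 1) :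
    ∃ r > 0, Metric.ball (P.point i s) r ∩ frontier P.carrier ⊆ P.edge i ∧
      ∀ u, P.point i u ∈ Metric.ball (P.point i s) r → u ∈ Set.Ioo (0 : ℝ) 1 := by
  obtain ⟨r, hr, hr1⟩ := P.exists_ball_inter_frontier_subset (P.point i s)
    {i} fun k hk ↦ P.eq_of_point_mem hs hk
  have hd : 0 < ‖P.dir i‖ := norm_pos_iff.2 (P.dir_ne_zero i)
  have hs0 := hs.1
  have hs1 := sub_pos.2 hs.2
  refine ⟨min r (min s (1 - s) * ‖P.dir i‖), by positivity, fun y hy ↦ ?_, fun u hu ↦ ?_⟩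
  · simpa using hr1 ⟨Metric.ball_subset_ball (min_le_left _ _) hy.1, hy.2⟩
  · rw [mem_ball_iff_norm, point_sub_point, norm_smul] at hu
    have h1 := lt_of_mul_lt_mul_right (hu.trans_le (min_le_right _ _)) hd.le
    rw [Real.norm_eq_abs, abs_lt] at h1
    have h2 := min_le_left s (1 - s)
    have h3 := min_le_right s (1 - s)
    constructor <;> linarith

/-- Near the point with parameter `s` of the `i`-th edge, the interior lies on the side given by
the vector `b`. -/
def OnSide (i : Fin m) (b : Plane) (s : ℝ) : Prop :=
  ∃ r > 0, ∀ y ∈ Metric.ball (P.point i s) r,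
    y ∈ interior P.carrier ↔ 0 < inner ℝ b (y - P.point i s)

/-- The line of the edge cuts a small ball into two half discs that avoid the frontier, so each is
contained in the interior or disjoint from it. If both were contained, the point would be interior;
if neither, it would not be a limit of interior points. Hence exactly one is. -/
theorem onSide_rot_or (i : Fin m) {s : ℝ} (hs : s ∈ Set.Ioo (0 : ℝ) 1) :
    P.OnSide i (rot (P.dir i)) s ∨ P.OnSide i (-rot (P.dir i)) s := by
  obtain ⟨r, hr, hre, hru⟩ := P.exists_ball_point i hs
  set x := P.point i s with hx
  set ν := rot (P.dir i) with hν
  have hxf : x ∈ frontier P.carrier := P.edge_subset_frontier i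
    (P.point_mem_edge i ⟨hs.1.le, hs.2.le⟩)
  have hedge : ∀ y ∈ P.edge i, inner ℝ ν (y - x) = 0 := by
    intro y hy
    obtain ⟨u, -, rfl⟩ := P.mem_edge_iff.1 hy
    rw [hx, point_sub_point, inner_smul_right, inner_rot_self, mul_zero]
  have hline : ∀ y ∈ Metric.ball x r, inner ℝ ν (y - x) = 0 → y ∈ frontier P.carrier := by
    intro y hy h0
    obtain ⟨u, hu⟩ := exists_smul_of_inner_rot_eq_zero (P.dir_ne_zero i) h0
    have hy' : y = P.point i (s + u) := by
      rw [← sub_add_cancel y x, hu, hx, point, point]; module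
    have := hru (s + u) (hy' ▸ hy)
    exact hy' ▸ P.edge_subset_frontier i (P.point_mem_edge i ⟨this.1.le, this.2.le⟩)
  have hside : ∀ b : Plane, (∀ y ∈ P.edge i, inner ℝ b (y - x) = 0) →
      (Metric.ball x r ∩ {y | 0 < inner ℝ b (y - x)} ⊆ interior P.carrier ∨
        Disjoint (Metric.ball x r ∩ {y | 0 < inner ℝ b (y - x)}) (interior P.carrier)) := by
    intro b hb
    refine IsPreconnected.subset_or_disjoint_of_disjoint_frontier (Convex.isPreconnected ?_)
      isOpen_interior ?_
    · refine (convex_ball x r).inter ?_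
      have : {y : Plane | 0 < inner ℝ b (y - x)} = {y | inner ℝ b x < innerSL ℝ b y} := by
        ext y
        simp [inner_sub_right]
      rw [this]
      exact convex_halfSpace_gt (innerSL ℝ b).toLinearMap.isLinear _
    · rw [Set.disjoint_left]
      rintro y ⟨hy, hyb⟩ hyf
      exact hyb.ne' (hb y (hre ⟨hy, frontier_interior_subset hyf⟩))
  rcases hside ν hedge with h1 | h1 <;>
  rcases hside (-ν) (fun y hy ↦ by rw [inner_neg_left, hedge y hy, neg_zero]) with h2 | h2
  · exfalso
    refine hxf.2 (mem_interior.2 ⟨Metric.ball x r, fun y hy ↦ ?_, Metric.isOpen_ball,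
      Metric.mem_ball_self hr⟩)
    rcases lt_trichotomy (inner ℝ ν (y - x)) 0 with h | h | h
    · exact interior_subset (h2 ⟨hy, by simpa [inner_neg_left] using h⟩)
    · exact P.isCompact.isClosed.frontier_subset (hline y hy h)
    · exact interior_subset (h1 ⟨hy, h⟩)
  · refine .inl ⟨r, hr, fun y hy ↦ ⟨fun hyi ↦ ?_, fun h ↦ h1 ⟨hy, h⟩⟩⟩
    rcases lt_trichotomy (inner ℝ ν (y - x)) 0 with h | h | h
    · exact absurd hyi (Set.disjoint_left.1 h2 ⟨hy, by simpa [inner_neg_left] using h⟩)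
    · exact absurd hyi (hline y hy h).2
    · exact h
  · refine .inr ⟨r, hr, fun y hy ↦ ⟨fun hyi ↦ ?_, fun h ↦ h2 ⟨hy, h⟩⟩⟩
    rcases lt_trichotomy (inner ℝ ν (y - x)) 0 with h | h | h
    · simpa [inner_neg_left] using h
    · exact absurd hyi (hline y hy h).2
    · exact absurd hyi (Set.disjoint_left.1 h1 ⟨hy, h⟩)
  · exfalso
    obtain ⟨y, hyi, hyx⟩ := Metric.mem_closure_iff.1 (P.frontier_subset_closure_interior hxf) r hr
    rw [dist_comm] at hyx
    rcases lt_trichotomy (inner ℝ ν (y - x)) 0 with h | h | h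
    · exact Set.disjoint_left.1 h2 ⟨hyx, by simpa [inner_neg_left] using h⟩ hyi
    · exact (hline y hyx h).2 hyi
    · exact Set.disjoint_left.1 h1 ⟨hyx, h⟩ hyi

theorem isOpen_onSide (i : Fin m) {b : Plane} (hb : inner ℝ b (P.dir i) = 0) :
    IsOpen {s | P.OnSide i b s} := by
  refine isOpen_iff_mem_nhds.2 fun s ⟨r, hr, h⟩ ↦ ?_
  filter_upwards [(P.continuous_point i).continuousAt.preimage_mem_nhds
    (Metric.ball_mem_nhds (P.point i s) hr)] with t ht
  refine ⟨r - dist (P.point i t) (P.point i s), sub_pos.2 ht, fun y hy ↦ ?_⟩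
  rw [h y (Metric.ball_subset_ball' (by linarith) hy),
    ← sub_add_sub_cancel y (P.point i t) (P.point i s), inner_add_right, point_sub_point,
    inner_smul_right, hb, mul_zero, add_zero]

/-- The side cannot change along the open edge: the two alternatives are open and disjoint, and the
parameter interval is connected. -/
theorem exists_inward (i : Fin m) : ∃ b : Plane, b ≠ 0 ∧ inner ℝ b (P.dir i) = 0 ∧
    ∀ s ∈ Set.Ioo (0 : ℝ) 1, P.OnSide i b s := by
  have hν := rot_ne_zero (P.dir_ne_zero i)
  have h0 : inner ℝ (rot (P.dir i)) (P.dir i) = 0 := inner_rot_self _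
  have h0' : inner ℝ (-rot (P.dir i)) (P.dir i) = 0 := by rw [inner_neg_left, h0, neg_zero]
  have hdisj : Disjoint {s | P.OnSide i (rot (P.dir i)) s}
      {s | P.OnSide i (-rot (P.dir i)) s} := by
    rw [Set.disjoint_left]
    rintro s ⟨r, hr, h⟩ ⟨r', hr', h'⟩
    have hp : 0 < ‖rot (P.dir i)‖ := norm_pos_iff.2 hν
    set c := min r r' / 2 / ‖rot (P.dir i)‖ with hc
    have hc0 : 0 < c := by positivity
    have hmem : P.point i s + c • rot (P.dir i) ∈ Metric.ball (P.point i s) (min r r') := by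
      rw [mem_ball_iff_norm, add_sub_cancel_left, norm_smul, Real.norm_of_nonneg hc0.le, hc,
        div_mul_cancel₀ _ hp.ne']
      have : 0 < min r r' := by positivity
      linarith
    have h1 := h _ (Metric.ball_subset_ball (min_le_left _ _) hmem)
    have h2 := h' _ (Metric.ball_subset_ball (min_le_right _ _) hmem)
    rw [h1, add_sub_cancel_left, inner_neg_left, inner_smul_right, real_inner_self_eq_norm_sq]
      at h2
    have h3 : 0 < c * ‖rot (P.dir i)‖ ^ 2 := by positivity
    linarith [h2.1 h3]
  by_cases hne : (Set.Ioo (0 : ℝ) 1 ∩ {s | P.OnSide i (rot (P.dir i)) s}).Nonempty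
  · exact ⟨_, hν, h0, isPreconnected_Ioo.subset_left_of_subset_union (P.isOpen_onSide i h0)
      (P.isOpen_onSide i h0') hdisj (fun s hs ↦ P.onSide_rot_or i hs) hne⟩
  · refine ⟨_, neg_ne_zero.2 hν, h0', fun s hs ↦ (P.onSide_rot_or i hs).resolve_left fun h ↦ ?_⟩
    exact hne ⟨s, hs, h⟩

end PolygonalDomain
end VirtualElement

namespace VirtualElement

/-! ### Gauss' theorem -/

theorem hasCompactSupport_comp_line {φ : Plane → ℝ} (hc : HasCompactSupport φ) (c : Plane)
    {a : Plane} (ha : a ≠ 0) : HasCompactSupport fun s : ℝ ↦ φ (c + s • a) :=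
  hc.comp_isClosedEmbedding (g := fun s : ℝ ↦ c + s • a)
    ((Homeomorph.addLeft c).isClosedEmbedding.comp (isClosedEmbedding_smul_left ha))

theorem contDiff_comp_line {φ : Plane → ℝ} (hφ : ContDiff ℝ ∞ φ) (c a : Plane) :
    ContDiff ℝ ∞ fun s : ℝ ↦ φ (c + s • a) :=
  hφ.comp (contDiff_const.add (contDiff_id.smul contDiff_const))

theorem integral_gradient_line {φ : Plane → ℝ} (hφ : ContDiff ℝ ∞ φ) (hc : HasCompactSupport φ)
    (c : Plane) {a : Plane} (ha : a ≠ 0) :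
    ∫ s : ℝ, inner ℝ (gradient φ (c + s • a)) a = 0 := by
  have h1 := hasCompactSupport_comp_line hc c ha
  have h2 := hasCompactSupport_comp_line (hasCompactSupport_gradient hc |>.norm) c ha
  have hg : Continuous fun s : ℝ ↦ gradient φ (c + s • a) :=
    (continuous_gradient hφ).comp (by fun_prop)
  refine integral_eq_zero_of_hasDerivAt_of_integrable
    (fun s ↦ hasDerivAt_comp_line hφ c a s) ?_
    ((contDiff_comp_line hφ c a).continuous.integrable_of_hasCompactSupport h1)
  refine (hg.inner continuous_const).integrable_of_hasCompactSupport (h2.mono ?_)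
  intro s hs h0
  refine hs ?_
  simp only [norm_eq_zero] at h0
  simp [h0]

theorem integral_gradient_halfLine {φ : Plane → ℝ} (hφ : ContDiff ℝ ∞ φ)
    (hc : HasCompactSupport φ) (c : Plane) {a : Plane} (ha : a ≠ 0) :
    ∫ s in Set.Ioi (0 : ℝ), inner ℝ (gradient φ (c + s • a)) a = -φ c := by
  have h1 := HasCompactSupport.integral_Ioi_deriv_eq
    ((contDiff_comp_line hφ c a).of_le (by exact_mod_cast le_top))
    (hasCompactSupport_comp_line hc c ha) 0
  simp only [zero_smul, add_zero] at h1
  rw [← h1]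
  exact integral_congr_ae (.of_forall fun s ↦ (hasDerivAt_comp_line hφ c a s).deriv.symm)

theorem integrable_inner_gradient {φ : Plane → ℝ} (hφ : ContDiff ℝ ∞ φ)
    (hc : HasCompactSupport φ) (e : Plane) :
    Integrable fun y ↦ inner ℝ (gradient φ y) e := by
  refine ((continuous_gradient hφ).inner continuous_const).integrable_of_hasCompactSupport
    ((hasCompactSupport_gradient hc).mono ?_)
  intro s hs h0
  exact hs (by simp [h0])

theorem exists_eq_param {a b : Plane} (h : LinearIndependent ℝ ![a, b]) (x y : Plane) :
    ∃ p, param x a b p = y := by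
  have hspan := h.span_eq_top_of_card_eq_finrank (by simp)
  have hy : y - x ∈ Submodule.span ℝ (Set.range ![a, b]) := hspan ▸ Submodule.mem_top
  rw [Matrix.range_cons, Matrix.range_cons, Matrix.range_empty, Set.union_empty,
    Set.singleton_union, Submodule.mem_span_pair] at hy
  obtain ⟨s, t, hst⟩ := hy
  refine ⟨(s, t), ?_⟩
  rw [param, add_assoc]
  simp [hst]

/-- Gauss' theorem in a half plane, up to a factor that does not depend on the function. -/
theorem exists_integral_halfPlane {a b : Plane} (h : LinearIndependent ℝ ![a, b]) :
    ∃ k : ℝ, 0 < k ∧ ∀ (x : Plane) (φ : Plane → ℝ), ContDiff ℝ ∞ φ → HasCompactSupport φ →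
      (∫ y, inner ℝ (gradient φ y) a = 0) ∧
      ∀ α β : ℝ, ∫ y in param x a b '' (Set.univ ×ˢ Set.Ioi 0),
        inner ℝ (gradient φ y) (α • a + β • b) = -(k * β * ∫ s : ℝ, φ (x + s • a)) := by
  obtain ⟨k, hk0, hk1, hk⟩ := exists_map_param h
  have hk' : 0 < k.toReal := ENNReal.toReal_pos hk0 hk1
  have ha : a ≠ 0 := h.ne_zero 0
  have hb : b ≠ 0 := h.ne_zero 1
  refine ⟨k.toReal⁻¹, inv_pos.2 hk', fun x φ hφ hc ↦ ?_⟩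
  obtain ⟨hemb, hmap⟩ := hk x
  have hvol : (volume : Measure Plane) = k⁻¹ • Measure.map (param x a b) volume := by
    rw [hmap, smul_smul, ENNReal.inv_mul_cancel hk0 hk1, one_smul]
  have hint : ∀ e, Integrable (fun z ↦ inner ℝ (gradient φ (param x a b z)) e)
      (volume : Measure (ℝ × ℝ)) := by
    intro e
    rw [← Function.comp_def (fun y ↦ inner ℝ (gradient φ y) e) (param x a b),
      ← hemb.integrable_map_iff, hmap]
    exact (integrable_inner_gradient hφ hc e).smul_measure hk1
  have hset : ∀ (S : Set ℝ), ∀ e,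
      ∫ y in param x a b '' (Set.univ ×ˢ S), inner ℝ (gradient φ y) e =
        k.toReal⁻¹ * ∫ z in Set.univ ×ˢ S, inner ℝ (gradient φ (param x a b z)) e := by
    intro S e
    rw [hvol, Measure.restrict_smul, integral_smul_measure, hemb.restrict_map,
      hemb.integral_map, Set.preimage_image_eq _ hemb.injective, ENNReal.toReal_inv, smul_eq_mul]
  have hprod : ∀ S : Set ℝ, (volume : Measure (ℝ × ℝ)).restrict (Set.univ ×ˢ S) =
      (volume : Measure ℝ).prod (volume.restrict S) := by
    intro S
    rw [Measure.volume_eq_prod, ← Measure.prod_restrict, Measure.restrict_univ]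
  -- A derivative along `a` integrates to zero on every line parallel to `a`.
  have hA : ∀ S : Set ℝ, MeasurableSet S →
      ∫ z in Set.univ ×ˢ S, inner ℝ (gradient φ (param x a b z)) a = 0 := by
    intro S hS
    have hi := (hint a).integrableOn (s := Set.univ ×ˢ S)
    rw [IntegrableOn, hprod] at hi
    rw [hprod, integral_prod_symm _ hi]
    refine integral_eq_zero_of_ae (.of_forall fun t ↦ ?_)
    have := integral_gradient_line hφ hc (x + t • b) ha
    simp only [Pi.zero_apply, param]
    rw [← this]
    refine integral_congr_ae (.of_forall fun s ↦ ?_)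
    simp only [add_right_comm]
  -- A derivative along `b` integrates on each half line to minus the value at its origin.
  have hB : ∫ z in Set.univ ×ˢ Set.Ioi (0 : ℝ), inner ℝ (gradient φ (param x a b z)) b =
      - ∫ s : ℝ, φ (x + s • a) := by
    have hi := (hint b).integrableOn (s := Set.univ ×ˢ Set.Ioi (0 : ℝ))
    rw [IntegrableOn, hprod] at hi
    rw [hprod, integral_prod _ hi, ← integral_neg]
    exact integral_congr_ae (.of_forall fun s ↦ integral_gradient_halfLine hφ hc (x + s • a) hb)
  constructor
  · have h1 := hset Set.univ a
    rw [hA _ MeasurableSet.univ, mul_zero] at h1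
    have hsurj : param x a b '' (Set.univ ×ˢ Set.univ) = Set.univ := by
      rw [Set.univ_prod_univ, Set.image_univ, Set.range_eq_univ]
      exact exists_eq_param h x
    rwa [hsurj, Measure.restrict_univ] at h1
  · intro α β
    rw [hset]
    simp only [inner_add_right, inner_smul_right]
    rw [integral_add ((hint a).integrableOn.const_mul α) ((hint b).integrableOn.const_mul β),
      integral_const_mul, integral_const_mul, hA _ measurableSet_Ioi, hB]
    ring

theorem integral_inner_gradient_eq_zero {φ : Plane → ℝ} (hφ : ContDiff ℝ ∞ φ)
    (hc : HasCompactSupport φ) (e : Plane) : ∫ y, inner ℝ (gradient φ y) e = 0 := by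
  by_cases he : e = 0
  · simp [he]
  obtain ⟨k, -, hk⟩ := exists_integral_halfPlane
    (linearIndependent_of_inner_eq_zero he (rot_ne_zero he) (inner_rot_self e))
  exact (hk 0 φ hφ hc).1

/-- Replaces a partition of unity. Since `ψ + ψ' - ψ * ψ' = 1 - (1 - ψ) * (1 - ψ')`, this
combination is `1` wherever one of the factors' functions is, and compactness does the rest. For a
class of multipliers for which an assertion holds, only closure under this operation must be
checked. -/
theorem exists_eq_one_of_locally {I : Set (Plane → ℝ)} (h0 : (0 : Plane → ℝ) ∈ I)
    (hI : ∀ ψ ∈ I, ∀ ψ' ∈ I, ψ + ψ' - ψ * ψ' ∈ I) {S : Set Plane} (hS : IsCompact S)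
    (h : ∀ x ∈ S, ∃ ψ ∈ I, ψ =ᶠ[𝓝 x] 1) : ∃ ψ ∈ I, ∀ x ∈ S, ψ =ᶠ[𝓝 x] 1 := by
  refine hS.induction_on (p := fun s ↦ ∃ ψ ∈ I, ∀ x ∈ s, ψ =ᶠ[𝓝 x] 1) ⟨0, h0, by simp⟩ ?_ ?_ ?_
  · rintro s t hst ⟨ψ, hψ, ht⟩
    exact ⟨ψ, hψ, fun x hx ↦ ht x (hst hx)⟩
  · rintro s t ⟨ψ, hψ, hs⟩ ⟨ψ', hψ', ht⟩
    refine ⟨_, hI ψ hψ ψ' hψ', fun x hx ↦ ?_⟩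
    rcases hx with hx | hx
    · filter_upwards [hs x hx] with y hy
      simp [hy]
    · filter_upwards [ht x hx] with y hy
      simp [hy]
  · intro x hx
    obtain ⟨ψ, hψ, hx⟩ := h x hx
    exact ⟨{y | ψ =ᶠ[𝓝 y] 1}, mem_nhdsWithin_of_mem_nhds (eventually_eventually_nhds.2 hx), ψ, hψ,
      fun y hy ↦ hy⟩

theorem contDiff_mul {φ ψ : Plane → ℝ} (h : ContDiff ℝ ∞ φ) (h' : ContDiff ℝ ∞ ψ) :
    ContDiff ℝ ∞ (φ * ψ) :=
  h.mul h'

theorem gradient_mul_of_contDiff {φ ψ : Plane → ℝ} (h : ContDiff ℝ ∞ φ) (h' : ContDiff ℝ ∞ ψ)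
    (x : Plane) : gradient (φ * ψ) x = φ x • gradient ψ x + ψ x • gradient φ x := by
  rw [gradient, fderiv_mul (h.differentiable (by simp) x) (h'.differentiable (by simp) x), map_add,
    map_smulₛₗ, map_smulₛₗ]
  rfl

/-- A smooth function that is `1` near `x` and vanishes outside the ball of radius `r`. -/
theorem exists_bump (x : Plane) {r : ℝ} (hr : 0 < r) : ∃ ψ : Plane → ℝ, ContDiff ℝ ∞ ψ ∧
    HasCompactSupport ψ ∧ ψ =ᶠ[𝓝 x] 1 ∧ tsupport ψ ⊆ Metric.ball x r ∧
    (∀ y, 0 ≤ ψ y) := by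
  let f : ContDiffBump x := ⟨r / 4, r / 2, by positivity, by linarith⟩
  refine ⟨f, f.contDiff, f.hasCompactSupport, f.eventuallyEq_one, ?_, fun y ↦ f.nonneg⟩
  rw [f.tsupport_eq]
  exact Metric.closedBall_subset_ball (by change r / 2 < r; linarith)

end VirtualElement

/-! ### Gauss' theorem on the polygon away from the nodes -/

namespace VirtualElement

theorem gradient_eq_zero_of_notMem_tsupport {φ : Plane → ℝ} {x : Plane} (hx : x ∉ tsupport φ) :
    gradient φ x = 0 := by
  rw [gradient, fderiv_of_notMem_tsupport ℝ hx, map_zero]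

theorem gradient_congr_of_eventuallyEq {φ ψ : Plane → ℝ} {x : Plane} (h : φ =ᶠ[𝓝 x] ψ) :
    gradient φ x = gradient ψ x := by
  rw [gradient, gradient, h.fderiv_eq]

namespace PolygonalDomain

variable {m : ℕ} (P : PolygonalDomain m)

theorem integral_edge (i : Fin m) {f : Plane → ℝ} (hf : Continuous f) :
    ∫ x in P.edge i, f x ∂μH[1] = ‖P.dir i‖ * ∫ s in Set.Icc (0 : ℝ) 1, f (P.point i s) := by
  rw [edge_eq_segment, integral_segment hf, dist_comm, dist_eq_norm]
  rfl

/-- Near an inner edge point the interior agrees with a half plane, where Gauss' theorem is known.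
One vector serves the whole edge; its length is never used. -/
theorem exists_normal (i : Fin m) : ∃ n : Plane, ∀ s ∈ Set.Ioo (0 : ℝ) 1, ∃ r > 0,
    ∀ φ : Plane → ℝ, ContDiff ℝ ∞ φ → tsupport φ ⊆ Metric.ball (P.point i s) r → ∀ e : Plane,
      ∫ x in interior P.carrier, inner ℝ (gradient φ x) e =
        inner ℝ n e * ∫ x in P.edge i, φ x ∂μH[1] := by
  obtain ⟨b, hb, hba, hside⟩ := P.exists_inward i
  have ha := P.dir_ne_zero i
  have hli := linearIndependent_of_inner_eq_zero ha hb hba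
  obtain ⟨k, hk, hgauss⟩ := exists_integral_halfPlane hli
  have hb' : 0 < ‖b‖ := norm_pos_iff.2 hb
  have ha' : 0 < ‖P.dir i‖ := norm_pos_iff.2 ha
  -- The factor `‖b‖ ^ 2` comes from reading the `b`-component of `e` off its inner product with
  -- `b`, and `‖P.dir i‖` from arc length against the edge parameter. The sign turns the inward `b`
  -- outward.
  refine ⟨-(k / (‖b‖ ^ 2 * ‖P.dir i‖)) • b, fun s hs ↦ ?_⟩
  obtain ⟨r, hr, hr1⟩ := hside s hs
  obtain ⟨r', hr', -, hr2⟩ := P.exists_ball_point i hs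
  refine ⟨min r r', by positivity, fun φ hφ hsupp e ↦ ?_⟩
  have hc : HasCompactSupport φ := HasCompactSupport.of_support_subset_isCompact
    (isCompact_closedBall (P.point i s) (min r r'))
    ((subset_tsupport φ).trans (hsupp.trans Metric.ball_subset_closedBall))
  obtain ⟨⟨α, β⟩, he⟩ := exists_eq_param hli 0 e
  simp only [param, zero_add] at he
  have hβ : inner ℝ b e = β * ‖b‖ ^ 2 := by
    rw [← he, inner_add_right, inner_smul_right, inner_smul_right, hba,
      real_inner_self_eq_norm_sq]
    ring
  obtain ⟨k', -, -, hemb⟩ := exists_map_param hli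
  have hemb := (hemb (P.node i)).1
  set H := param (P.node i) (P.dir i) b '' (Set.univ ×ˢ Set.Ioi 0) with hH
  have hHm : MeasurableSet H :=
    hemb.measurableSet_image.2 (MeasurableSet.univ.prod measurableSet_Ioi)
  -- Inside the ball the half plane and the interior coincide, and the test function vanishes
  -- elsewhere.
  have hHi : ∀ y ∈ Metric.ball (P.point i s) r, y ∈ H ↔ y ∈ interior P.carrier := by
    intro y hy
    obtain ⟨⟨u, t⟩, hut⟩ := exists_eq_param hli (P.node i) y
    have h1 : y - P.point i s = (u - s) • P.dir i + t • b := by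
      rw [← hut, param, point]; module
    rw [hr1 y hy, h1, inner_add_right, inner_smul_right, inner_smul_right, hba,
      real_inner_self_eq_norm_sq, mul_zero, zero_add, ← hut, hH, hemb.injective.mem_set_image]
    simp only [Set.mem_prod, Set.mem_univ, true_and, Set.mem_Ioi]
    exact (mul_pos_iff_of_pos_right (by positivity)).symm
  have hsub : ∀ {y}, y ∉ Metric.ball (P.point i s) (min r r') → y ∉ tsupport φ :=
    fun hy hy' ↦ hy (hsupp hy')
  have e1 : ∫ x in interior P.carrier, inner ℝ (gradient φ x) e =
      ∫ x in H, inner ℝ (gradient φ x) e := by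
    rw [← integral_indicator isOpen_interior.measurableSet, ← integral_indicator hHm]
    congr 1
    ext1 y
    by_cases hy : y ∈ Metric.ball (P.point i s) (min r r')
    · have hiff := hHi y (Metric.ball_subset_ball (min_le_left _ _) hy)
      by_cases h : y ∈ H
      · rw [Set.indicator_of_mem h, Set.indicator_of_mem (hiff.1 h)]
      · rw [Set.indicator_of_notMem h, Set.indicator_of_notMem (mt hiff.2 h)]
    · simp [Set.indicator, gradient_eq_zero_of_notMem_tsupport (hsub hy)]
  have e2 : ∫ t : ℝ, φ (P.node i + t • P.dir i) =
      ∫ t in Set.Icc (0 : ℝ) 1, φ (P.point i t) := by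
    rw [← integral_indicator measurableSet_Icc]
    congr 1
    ext1 t
    by_cases ht : t ∈ Set.Icc (0 : ℝ) 1
    · rw [Set.indicator_of_mem ht]; rfl
    · rw [Set.indicator_of_notMem ht]
      refine image_eq_zero_of_notMem_tsupport (hsub fun h ↦ ht ?_)
      have := hr2 t (Metric.ball_subset_ball (min_le_right _ _) h)
      exact ⟨this.1.le, this.2.le⟩
  rw [e1, integral_edge _ _ hφ.continuous, ← e2, inner_smul_left, hβ, ← he,
    (hgauss (P.node i) φ hφ hc).2 α β, conj_trivial]
  field_simp

theorem integral_gradient_eq_zero {φ : Plane → ℝ} (hφ : ContDiff ℝ ∞ φ)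
    (hc : HasCompactSupport φ) (hs : tsupport φ ⊆ interior P.carrier) (e : Plane) :
    ∫ x in interior P.carrier, inner ℝ (gradient φ x) e = 0 := by
  rw [setIntegral_eq_integral_of_forall_compl_eq_zero,
    integral_inner_gradient_eq_zero hφ hc]
  intro x hx
  rw [gradient_eq_zero_of_notMem_tsupport fun h ↦ hx (hs h), inner_zero_left]

theorem integrable_edge (i : Fin m) {f : Plane → ℝ} (hf : Continuous f) :
    IntegrableOn f (P.edge i) μH[1] :=
  ((P.memLp_arc hf).integrable (by norm_num)).mono_measure
    (Measure.restrict_mono (P.edge_subset_frontier i) le_rfl)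

theorem integrableOn_inner_gradient {φ : Plane → ℝ} (hφ : ContDiff ℝ ∞ φ) (e : Plane) :
    IntegrableOn (fun x ↦ inner ℝ (gradient φ x) e) (interior P.carrier) :=
  (P.memLp_dom ((continuous_gradient hφ).inner continuous_const)).integrable (by norm_num)

/-- The defect in Gauss' theorem with normal vectors `n`. -/
def defect (n : Fin m → Plane) (e : Plane) (φ : Plane → ℝ) : ℝ :=
  (∫ x in interior P.carrier, inner ℝ (gradient φ x) e) -
    ∑ i, inner ℝ (n i) e * ∫ x in P.edge i, φ x ∂μH[1]

variable {P} in
theorem defect_add (n : Fin m → Plane) (e : Plane) {φ ψ : Plane → ℝ} (hφ : ContDiff ℝ ∞ φ)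
    (hψ : ContDiff ℝ ∞ ψ) : P.defect n e (φ + ψ) = P.defect n e φ + P.defect n e ψ := by
  have h1 : ∀ i, ∫ x in P.edge i, (φ x + ψ x) ∂μH[1] =
      (∫ x in P.edge i, φ x ∂μH[1]) + ∫ x in P.edge i, ψ x ∂μH[1] := fun i ↦
    integral_add (P.integrable_edge i hφ.continuous) (P.integrable_edge i hψ.continuous)
  have h2 := integral_add (P.integrableOn_inner_gradient hφ e)
    (P.integrableOn_inner_gradient hψ e)
  simp only [defect, h1, mul_add, Finset.sum_add_distrib,
    gradient_add_of_contDiff hφ hψ, Pi.add_apply, inner_add_left, h2]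
  ring

variable {P} in
theorem defect_congr (n : Fin m → Plane) (e : Plane) {φ ψ : Plane → ℝ}
    (h : Set.EqOn φ ψ P.carrier) : P.defect n e φ = P.defect n e ψ := by
  unfold defect
  congr 1
  · refine setIntegral_congr_fun isOpen_interior.measurableSet fun x hx ↦ ?_
    have : φ =ᶠ[𝓝 x] ψ := by
      filter_upwards [mem_interior_iff_mem_nhds.1 hx] with y hy using h hy
    simp only [gradient_congr_of_eventuallyEq this]
  · refine Finset.sum_congr rfl fun i _ ↦ ?_
    congr 1
    exact setIntegral_congr_fun (P.isClosed_edge i).measurableSet fun x hx ↦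
      h (P.isCompact.isClosed.frontier_subset (P.edge_subset_frontier i hx))

/-- The defect vanishes for functions supported near an interior point or near an inner edge point.
Such multipliers are glued to one that is `1` on the part of the support of `φ` in the polygon,
which contains no node. -/
theorem exists_defect_eq_zero_of_locally : ∃ n : Fin m → Plane, ∀ e : Plane, ∀ φ : Plane → ℝ,
    ContDiff ℝ ∞ φ → (∀ i, φ =ᶠ[𝓝 (P.node i)] 0) → P.defect n e φ = 0 := by
  choose n hn using P.exists_normal
  refine ⟨n, fun e φ hφ hφn ↦ ?_⟩
  -- Allowing an arbitrary smooth factor `χ` makes the class closed under the gluing operation.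
  let I : Set (Plane → ℝ) :=
    {ψ | ContDiff ℝ ∞ ψ ∧ ∀ χ : Plane → ℝ, ContDiff ℝ ∞ χ → P.defect n e (ψ * χ) = 0}
  have hI0 : (0 : Plane → ℝ) ∈ I := by
    refine ⟨contDiff_const, fun χ _ ↦ ?_⟩
    simp [defect, gradient_zero_fun]
  have hI : ∀ ψ ∈ I, ∀ ψ' ∈ I, ψ + ψ' - ψ * ψ' ∈ I := by
    rintro ψ ⟨h1, h2⟩ ψ' ⟨h1', h2'⟩
    refine ⟨(h1.add h1').sub (contDiff_mul h1 h1'), fun χ hχ ↦ ?_⟩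
    have : (ψ + ψ' - ψ * ψ') * χ = ψ * χ + ψ' * ((1 - ψ) * χ) := by ring
    have h3 : ContDiff ℝ ∞ ((1 - ψ) * χ) := contDiff_mul (contDiff_const.sub h1) hχ
    rw [this, defect_add n e (contDiff_mul h1 hχ) (contDiff_mul h1' h3), h2 χ hχ, h2' _ h3, add_zero]
  obtain ⟨ψ, ⟨-, hψ⟩, hψ1⟩ := exists_eq_one_of_locally hI0 hI
    (P.isCompact.inter_right (isClosed_tsupport φ)) (by
    rintro x ⟨hxK, hxφ⟩
    by_cases hxi : x ∈ interior P.carrier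
    · obtain ⟨r, hr, hB⟩ := Metric.isOpen_iff.1 isOpen_interior x hxi
      obtain ⟨ψ, hψ, hψc, hψ1, hψs, -⟩ := exists_bump x hr
      refine ⟨ψ, ⟨hψ, fun χ hχ ↦ ?_⟩, hψ1⟩
      have hs : tsupport (ψ * χ) ⊆ interior P.carrier :=
        (tsupport_mul_subset_left.trans hψs).trans hB
      rw [defect, P.integral_gradient_eq_zero (contDiff_mul hψ hχ) hψc.mul_right hs, zero_sub, neg_eq_zero]
      refine Finset.sum_eq_zero fun i _ ↦ ?_
      rw [setIntegral_eq_zero_of_forall_eq_zero, mul_zero]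
      exact fun y hy ↦ image_eq_zero_of_notMem_tsupport
        fun h ↦ (P.edge_subset_frontier i hy).2 (hs h)
    · have hxf : x ∈ frontier P.carrier := ⟨subset_closure hxK, hxi⟩
      rw [P.frontier_eq_iUnion, Set.mem_iUnion] at hxf
      obtain ⟨i, hi⟩ := hxf
      obtain ⟨s, hs, rfl⟩ := P.mem_edge_iff.1 hi
      have hnode : ∀ j, P.node j ≠ P.point i s := by
        intro j hj
        exact (notMem_tsupport_iff_eventuallyEq.2 (hφn j)) (hj ▸ hxφ)
      have hs0 : s ∈ Set.Ioo (0 : ℝ) 1 := by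
        refine ⟨hs.1.lt_of_ne ?_, hs.2.lt_of_ne ?_⟩
        · rintro rfl
          exact hnode i (P.point_zero i).symm
        · rintro rfl
          exact hnode _ (P.point_one i).symm
      obtain ⟨r, hr, hr1⟩ := hn i s hs0
      obtain ⟨r', hr', hr2, hr3⟩ := P.exists_ball_point i hs0
      obtain ⟨ψ, hψ, hψc, hψ1, hψs, -⟩ := exists_bump (P.point i s) (lt_min hr hr')
      refine ⟨ψ, ⟨hψ, fun χ hχ ↦ ?_⟩, hψ1⟩
      have hsupp : tsupport (ψ * χ) ⊆ Metric.ball (P.point i s) (min r r') :=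
        tsupport_mul_subset_left.trans hψs
      rw [defect, hr1 _ (contDiff_mul hψ hχ) (hsupp.trans (Metric.ball_subset_ball (min_le_left _ _))),
        Finset.sum_eq_single i, sub_self]
      · intro j _ hji
        rw [setIntegral_eq_zero_of_forall_eq_zero, mul_zero]
        intro y hy
        refine image_eq_zero_of_notMem_tsupport fun h ↦ hji ?_
        have hyB := Metric.ball_subset_ball (min_le_right _ _) (hsupp h)
        obtain ⟨u, -, rfl⟩ := P.mem_edge_iff.1 (hr2 ⟨hyB, P.edge_subset_frontier j hy⟩)
        exact P.eq_of_point_mem (hr3 u hyB) hy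
      · simp)
  rw [← hψ φ hφ]
  refine defect_congr n e fun x hx ↦ ?_
  by_cases hxφ : x ∈ tsupport φ
  · simp [(hψ1 x ⟨hx, hxφ⟩).self_of_nhds]
  · simp [image_eq_zero_of_notMem_tsupport hxφ]

end PolygonalDomain
end VirtualElement

/-! ### Removing the nodes from Gauss' theorem -/

namespace VirtualElement

theorem inner_gradient (φ : Plane → ℝ) (x e : Plane) :
    inner ℝ (gradient φ x) e = fderiv ℝ φ x e := by
  rw [gradient, InnerProductSpace.toDual_symm_apply]

/-- A fixed cutoff function around the origin. -/
def unitBump : ContDiffBump (0 : Plane) := ⟨1, 2, one_pos, one_lt_two⟩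

/-- Cutoff functions that concentrate at the point `z`. -/
def cutoff (z : Plane) (k : ℕ) (y : Plane) : ℝ := unitBump (((k : ℝ) + 1) • (y - z))

theorem contDiff_cutoff (z : Plane) (k : ℕ) : ContDiff ℝ ∞ (cutoff z k) :=
  unitBump.contDiff.comp
    (g := unitBump) (f := fun y : Plane ↦ ((k : ℝ) + 1) • (y - z)) (by fun_prop)

theorem cutoff_nonneg (z : Plane) (k : ℕ) (y : Plane) : 0 ≤ cutoff z k y := unitBump.nonneg

theorem cutoff_le_one (z : Plane) (k : ℕ) (y : Plane) : cutoff z k y ≤ 1 := unitBump.le_one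

theorem cutoff_eventuallyEq_one (z : Plane) (k : ℕ) : cutoff z k =ᶠ[𝓝 z] 1 := by
  have h : Tendsto (fun y : Plane ↦ ((k : ℝ) + 1) • (y - z)) (𝓝 z) (𝓝 0) := by
    have : Continuous fun y : Plane ↦ ((k : ℝ) + 1) • (y - z) := by fun_prop
    simpa using this.tendsto z
  exact h.eventually unitBump.eventuallyEq_one

theorem cutoff_eq_zero {z y : Plane} {k : ℕ} (h : 2 / ((k : ℝ) + 1) ≤ dist y z) :
    cutoff z k y = 0 := by
  have hk : 0 < (k : ℝ) + 1 := by positivity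
  refine unitBump.zero_of_le_dist ?_
  rw [dist_zero_right, norm_smul, Real.norm_of_nonneg hk.le, ← dist_eq_norm]
  rw [div_le_iff₀ hk] at h
  change 2 ≤ _
  linarith

theorem tsupport_cutoff_subset (z : Plane) (k : ℕ) :
    tsupport (cutoff z k) ⊆ Metric.closedBall z (2 / ((k : ℝ) + 1)) := by
  refine closure_minimal (fun y hy ↦ ?_) Metric.isClosed_closedBall
  by_contra h
  exact hy (cutoff_eq_zero (not_le.1 h).le)

theorem gradient_cutoff (z : Plane) (k : ℕ) (y : Plane) :
    gradient (cutoff z k) y = ((k : ℝ) + 1) • gradient unitBump (((k : ℝ) + 1) • (y - z)) := by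
  have h1 : HasFDerivAt (fun y : Plane ↦ ((k : ℝ) + 1) • (y - z))
      (((k : ℝ) + 1) • ContinuousLinearMap.id ℝ Plane) y :=
    HasFDerivAt.fun_const_smul ((hasFDerivAt_id y).sub_const z) _
  have h2 := ((unitBump.contDiff (n := 1)).differentiable (by simp)
    (((k : ℝ) + 1) • (y - z))).hasFDerivAt.comp y h1
  rw [gradient, show fderiv ℝ (cutoff z k) y = _ from h2.fderiv, gradient,
    ContinuousLinearMap.comp_smul, ContinuousLinearMap.comp_id, map_smulₛₗ]
  rfl

namespace PolygonalDomain

variable {m : ℕ} (P : PolygonalDomain m)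

/-- The gradient of the cutoff grows like `k + 1`, while the area of its support shrinks like `(k +
1)⁻²`. So the integral is of order `1 / (k + 1)`. -/
theorem tendsto_integral_gradient_cutoff {φ : Plane → ℝ} (hφ : ContDiff ℝ ∞ φ) (z e : Plane) :
    Tendsto (fun k ↦ ∫ x in interior P.carrier, inner ℝ (gradient (φ * cutoff z k) x) e)
      atTop (𝓝 0) := by
  obtain ⟨A, hA⟩ := P.isCompact.exists_bound_of_continuousOn hφ.continuous.continuousOn
  obtain ⟨B, hB⟩ := P.isCompact.exists_bound_of_continuousOn (continuous_gradient hφ).continuousOn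
  obtain ⟨M, hM⟩ := (continuous_gradient (unitBump.contDiff)).bounded_above_of_compact_support
    (hasCompactSupport_gradient unitBump.hasCompactSupport)
  set V := (volume : Measure Plane).real (Metric.ball 0 1) with hV
  have hbound : ∀ k : ℕ, ‖∫ x in interior P.carrier, inner ℝ (gradient (φ * cutoff z k) x) e‖ ≤
      (|A| * (((k : ℝ) + 1) * |M|) + |B|) * ‖e‖ * ((2 / ((k : ℝ) + 1)) ^ 2 * V) := by
    intro k
    have hk : 0 < (k : ℝ) + 1 := by positivity
    set D := Metric.closedBall z (2 / ((k : ℝ) + 1)) with hD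
    have e1 : ∫ x in interior P.carrier, inner ℝ (gradient (φ * cutoff z k) x) e =
        ∫ x in interior P.carrier ∩ D, inner ℝ (gradient (φ * cutoff z k) x) e := by
      refine setIntegral_eq_of_subset_of_forall_sdiff_eq_zero (t := interior P.carrier)
        (f := fun x ↦ inner ℝ (gradient (φ * cutoff z k) x) e)
        (s := interior P.carrier ∩ D) isOpen_interior.measurableSet
        Set.inter_subset_left ?_
      rintro x ⟨hx, hxD⟩
      rw [gradient_eq_zero_of_notMem_tsupport, inner_zero_left]
      exact fun h ↦ hxD ⟨hx, tsupport_cutoff_subset z k (tsupport_mul_subset_right h)⟩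
    have hvol : volume (interior P.carrier ∩ D) ≤ volume D := measure_mono Set.inter_subset_right
    have hDfin : volume D < ⊤ := measure_closedBall_lt_top
    rw [e1]
    refine (norm_setIntegral_le_of_norm_le_const (hvol.trans_lt hDfin)
      (C := (|A| * (((k : ℝ) + 1) * |M|) + |B|) * ‖e‖) ?_).trans ?_
    · rintro x ⟨hx, -⟩
      refine (norm_inner_le_norm _ _).trans ?_
      gcongr
      rw [gradient_mul_of_contDiff hφ (contDiff_cutoff z k), gradient_cutoff]
      refine (norm_add_le _ _).trans ?_
      rw [norm_smul, norm_smul, norm_smul, Real.norm_of_nonneg hk.le]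
      have h1 := (hA x (interior_subset hx)).trans (le_abs_self A)
      have h2 := (hB x (interior_subset hx)).trans (le_abs_self B)
      have h3 := (hM (((k : ℝ) + 1) • (x - z))).trans (le_abs_self M)
      have h4 : ‖cutoff z k x‖ ≤ 1 := by
        rw [Real.norm_of_nonneg (cutoff_nonneg z k x)]
        exact cutoff_le_one z k x
      gcongr
      nlinarith [norm_nonneg (gradient φ x), abs_nonneg B]
    · gcongr
      rw [hV]
      have h5 := Measure.addHaar_real_closedBall (volume : Measure Plane) z
        (r := 2 / ((k : ℝ) + 1)) (by positivity)
      rw [finrank_euclideanSpace_fin] at h5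
      rw [← h5]
      exact measureReal_mono Set.inter_subset_right hDfin.ne
  refine squeeze_zero_norm (a := fun k : ℕ ↦
    4 * V * ‖e‖ * (|A| * |M| + |B|) * (1 / ((k : ℝ) + 1))) (fun k ↦ (hbound k).trans ?_) ?_
  · have hk : 0 < (k : ℝ) + 1 := by positivity
    have hk1 : 1 ≤ (k : ℝ) + 1 := by simp
    have hV0 : 0 ≤ V := measureReal_nonneg
    calc (|A| * (((k : ℝ) + 1) * |M|) + |B|) * ‖e‖ * ((2 / ((k : ℝ) + 1)) ^ 2 * V)
        ≤ (|A| * (((k : ℝ) + 1) * |M|) + ((k : ℝ) + 1) * |B|) * ‖e‖ *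
          ((2 / ((k : ℝ) + 1)) ^ 2 * V) := by
          gcongr
          exact le_mul_of_one_le_left (abs_nonneg B) hk1
      _ = _ := by field_simp; ring
  · simpa using (tendsto_one_div_add_atTop_nhds_zero_nat (𝕜 := ℝ)).const_mul
      (4 * V * ‖e‖ * (|A| * |M| + |B|))

/-- Dominated convergence: the cutoffs tend to zero except at `z`, and single points have no arc
length. -/
theorem tendsto_integral_edge_cutoff {φ : Plane → ℝ} (hφ : ContDiff ℝ ∞ φ) (z : Plane)
    (i : Fin m) :
    Tendsto (fun k ↦ ∫ x in P.edge i, (φ * cutoff z k) x ∂μH[1]) atTop (𝓝 0) := by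
  have h := tendsto_integral_of_dominated_convergence (μ := (μH[1]).restrict (P.edge i))
    (F := fun k ↦ φ * cutoff z k) (f := fun _ ↦ 0) (fun x ↦ ‖φ x‖)
    (fun k ↦ (contDiff_mul hφ (contDiff_cutoff z k)).continuous.aestronglyMeasurable)
    (P.integrable_edge i hφ.continuous).norm (fun k ↦ .of_forall fun x ↦ ?_) ?_
  · simpa using h
  · rw [Pi.mul_apply, norm_mul, Real.norm_of_nonneg (cutoff_nonneg z k x)]
    exact mul_le_of_le_one_right (norm_nonneg _) (cutoff_le_one z k x)
  · have hne : ∀ᵐ x ∂(μH[1] : Measure Plane).restrict (P.edge i), x ≠ z := by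
      have := Measure.nullSingletonClass_hausdorff Plane (one_pos)
      exact ae_restrict_of_ae (Measure.ae_ne _ z)
    filter_upwards [hne] with x hx
    have h0 : Tendsto (fun k : ℕ ↦ 2 * (1 / ((k : ℝ) + 1))) atTop (𝓝 0) := by
      simpa using (tendsto_one_div_add_atTop_nhds_zero_nat (𝕜 := ℝ)).const_mul 2
    refine tendsto_const_nhds.congr' ?_
    filter_upwards [h0.eventually_lt_const (dist_pos.2 hx)] with k hk
    rw [Pi.mul_apply, cutoff_eq_zero (by rw [mul_one_div] at hk; exact hk.le), mul_zero]

/-- Induction on the set of nodes near which `φ` may be nonzero. Multiplying by one minus a cutoff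
removes a node, and the defect of the discarded part tends to zero. -/
theorem exists_gauss : ∃ n : Fin m → Plane, ∀ e : Plane, ∀ φ : Plane → ℝ, ContDiff ℝ ∞ φ →
    ∫ x in interior P.carrier, inner ℝ (gradient φ x) e =
      ∑ i, inner ℝ (n i) e * ∫ x in P.edge i, φ x ∂μH[1] := by
  obtain ⟨n, hn⟩ := P.exists_defect_eq_zero_of_locally
  refine ⟨n, fun e φ hφ ↦ ?_⟩
  have key : ∀ F : Finset (Fin m), ∀ φ : Plane → ℝ, ContDiff ℝ ∞ φ →
      (∀ i ∉ F, φ =ᶠ[𝓝 (P.node i)] 0) → P.defect n e φ = 0 := by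
    intro F
    induction F using Finset.induction_on with
    | empty => exact fun φ hφ h ↦ hn e φ hφ fun i ↦ h i (Finset.notMem_empty i)
    | insert j F _ ih =>
      intro φ hφ h
      -- By the induction hypothesis the whole defect sits in the cutoff part for every `k`, while
      -- that part tends to zero.
      have h1 : ∀ k, P.defect n e (φ * cutoff (P.node j) k) = P.defect n e φ := by
        intro k
        have hc := contDiff_cutoff (P.node j) k
        have hsm : ContDiff ℝ ∞ (1 - cutoff (P.node j) k) := contDiff_const.sub hc
        have hz := ih (φ * (1 - cutoff (P.node j) k)) (contDiff_mul hφ hsm) fun i hi ↦ ?_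
        · have := defect_add (P := P) n e (contDiff_mul hφ hc) (contDiff_mul hφ hsm)
          rw [hz, add_zero, ← mul_add, add_sub_cancel, mul_one] at this
          exact this.symm
        · by_cases hij : i = j
          · subst hij
            filter_upwards [cutoff_eventuallyEq_one (P.node i) k] with y hy
            simp [hy]
          · filter_upwards [h i (by simp [hij, hi])] with y hy
            simp [hy]
      have h2 : Tendsto (fun k ↦ P.defect n e (φ * cutoff (P.node j) k)) atTop (𝓝 0) := by
        have := (P.tendsto_integral_gradient_cutoff hφ (P.node j) e).sub
          (tendsto_finsetSum Finset.univ fun i _ ↦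
            (P.tendsto_integral_edge_cutoff hφ (P.node j) i).const_mul (inner ℝ (n i) e))
        simpa [defect] using this
      simp only [h1] at h2
      exact tendsto_nhds_unique tendsto_const_nhds h2
  exact sub_eq_zero.1 (key Finset.univ φ hφ fun i hi ↦ absurd (Finset.mem_univ i) hi)

end PolygonalDomain
end VirtualElement

namespace VirtualElement

/-! ### Mollification -/

theorem eLpNorm_two_sq {α E : Type*} [MeasurableSpace α] [NormedAddCommGroup E] (μ : Measure α)
    (f : α → E) : eLpNorm f 2 μ ^ 2 = ∫⁻ x, ‖f x‖ₑ ^ 2 ∂μ := by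
  have h := eLpNorm_nnreal_pow_eq_lintegral (p := 2) (f := f) (μ := μ) (by norm_num)
  rw [show ((2 : ℝ≥0) : ℝ) = (2 : ℕ) by norm_num] at h
  simp only [ENNReal.rpow_natCast] at h
  exact_mod_cast h

theorem tendsto_eLpNorm_translate {E : Type*} [NormedAddCommGroup E] {W : Plane → E} (hW : MemLp W 2 volume) :
    Tendsto (fun h : Plane ↦ eLpNorm (fun y ↦ W (y - h) - W y) 2 volume) (𝓝 0) (𝓝 0) := by
  let g : C(Plane, C(Plane, Plane)) :=
    (ContinuousMap.mk (fun p : Plane × Plane ↦ p.2 - p.1) (by fun_prop)).curry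
  have hg : ∀ h, MeasurePreserving (g h) (volume : Measure Plane) volume := fun h ↦
    measurePreserving_sub_right volume h
  have h1 := (tendsto_const_nhds (x := hW.toLp W) (f := 𝓝 (0 : Plane))).compMeasurePreservingLp
    (g.continuous.tendsto 0) hg (hg 0) (by simp)
  have h2 : Tendsto (fun h ↦ edist (Lp.compMeasurePreserving (g h) (hg h) (hW.toLp W))
      (Lp.compMeasurePreserving (g 0) (hg 0) (hW.toLp W))) (𝓝 0) (𝓝 0) := by
    have := h1.edist (tendsto_const_nhds (x := Lp.compMeasurePreserving (g 0) (hg 0) (hW.toLp W)))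
    rwa [edist_self] at this
  refine h2.congr fun h ↦ ?_
  rw [Lp.toLp_compMeasurePreserving, Lp.toLp_compMeasurePreserving, Lp.edist_toLp_toLp]
  congr 1
  ext1 y
  simp [g]

/-- The convolution of a kernel `η` with `W`. -/
def mollify {E : Type*} [NormedAddCommGroup E] [NormedSpace ℝ E]
    (η : Plane → ℝ) (W : Plane → E) (y : Plane) : E := ∫ h, η h • W (y - h)

/-- The convolution averages translates, so Jensen and Tonelli bound the error by the `L²` modulus
of continuity of translations. The kernel need not be centred: `δ` works for every probability
density supported close to the origin. -/
theorem eLpNorm_mollify_sub_le {E : Type*} [NormedAddCommGroup E] [NormedSpace ℝ E]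
    [CompleteSpace E] {W : Plane → E} (hW : MemLp W 2 volume) {ε : ℝ≥0∞}
    (hε : 0 < ε) : ∃ δ > 0, ∀ η : Plane → ℝ, Continuous η → (∀ h, 0 ≤ η h) → ∫ h, η h = 1 →
      tsupport η ⊆ Metric.closedBall 0 δ → eLpNorm (mollify η W - W) 2 volume ≤ ε := by
  obtain ⟨δ, hδ, hball⟩ := Metric.eventually_nhds_iff_ball.1
    ((tendsto_eLpNorm_translate hW).eventually (ge_mem_nhds hε))
  refine ⟨δ / 2, by positivity, fun η hη h0 h1 hs ↦ ?_⟩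
  have hcs : HasCompactSupport η := HasCompactSupport.of_support_subset_isCompact
    (isCompact_closedBall 0 (δ / 2)) ((subset_tsupport η).trans hs)
  set κ : Measure Plane := volume.withDensity fun h ↦ ENNReal.ofReal (η h) with hκ
  have hm : Measurable fun h ↦ ENNReal.ofReal (η h) := hη.measurable.ennreal_ofReal
  have hint : Integrable η := hη.integrable_of_hasCompactSupport hcs
  have hκp : IsProbabilityMeasure κ := ⟨by
    rw [hκ, withDensity_apply _ MeasurableSet.univ, Measure.restrict_univ,
      ← ofReal_integral_eq_lintegral_ofReal hint (.of_forall h0), h1, ENNReal.ofReal_one]⟩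
  have hκi : ∀ f : Plane → E, ∫ h, f h ∂κ = ∫ h, η h • f h := by
    intro f
    rw [hκ, integral_withDensity_eq_integral_toReal_smul hm (by simp)]
    simp only [ENNReal.toReal_ofReal (h0 _)]
  have hκae : ∀ᵐ h ∂κ, h ∈ Metric.ball (0 : Plane) δ := by
    rw [hκ, ae_withDensity_iff hm]
    refine .of_forall fun h hh ↦ ?_
    have : h ∈ tsupport η := subset_tsupport η fun h' ↦ hh (by rw [h', ENNReal.ofReal_zero])
    exact Metric.closedBall_subset_ball (by linarith) (hs this)
  -- A strongly measurable representative provides the joint measurability needed for Tonelli.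
  set W' := hW.1.mk W with hW'
  have hWW : W =ᵐ[volume] W' := hW.1.ae_eq_mk
  have hWm : StronglyMeasurable W' := hW.1.stronglyMeasurable_mk
  have hW2 : MemLp W' 2 volume := (memLp_congr_ae hWW).1 hW
  have htrans : ∀ y : Plane, (fun h ↦ W (y - h)) =ᵐ[volume] fun h ↦ W' (y - h) := fun y ↦
    (Measure.measurePreserving_sub_left volume y).quasiMeasurePreserving.ae_eq_comp hWW
  have hmol : mollify η W = mollify η W' := by
    ext1 y
    refine integral_congr_ae ?_
    filter_upwards [htrans y] with h hh
    simp only [hh]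
  have hpt : ∀ y, ‖mollify η W' y - W' y‖ₑ ^ 2 ≤ ∫⁻ h, ‖W' (y - h) - W' y‖ₑ ^ 2 ∂κ := by
    intro y
    have hiy : Integrable (fun h ↦ W' (y - h)) κ := by
      rw [hκ, integrable_withDensity_iff_integrable_smul' hm (by simp)]
      simp only [ENNReal.toReal_ofReal (h0 _)]
      have hl : LocallyIntegrable (fun h ↦ W' (y - h)) volume :=
        (hW2.comp_measurePreserving (Measure.measurePreserving_sub_left volume y)).locallyIntegrable
          (by norm_num)
      exact hl.integrable_smul_left_of_hasCompactSupport hη hcs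
    have e : mollify η W' y - W' y = ∫ h, (W' (y - h) - W' y) ∂κ := by
      rw [integral_sub hiy (integrable_const _), hκi]
      simp [mollify]
    rw [e]
    exact enorm_integral_sq_le (hiy.1.sub aestronglyMeasurable_const)
  have hmeas : AEMeasurable (Function.uncurry fun y h : Plane ↦ ‖W' (y - h) - W' y‖ₑ ^ 2)
      ((volume : Measure Plane).prod κ) := by
    refine Measurable.aemeasurable ?_
    exact ((hWm.comp_measurable (measurable_fst.sub measurable_snd)).sub
      (hWm.comp_measurable measurable_fst)).enorm.pow_const 2
  have hsq : eLpNorm (mollify η W - W) 2 volume ^ 2 ≤ ε ^ 2 := by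
    calc eLpNorm (mollify η W - W) 2 volume ^ 2
        = ∫⁻ y, ‖mollify η W' y - W' y‖ₑ ^ 2 := by
          rw [eLpNorm_two_sq, hmol]
          refine lintegral_congr_ae ?_
          filter_upwards [hWW] with y hy
          rw [Pi.sub_apply, hy]
      _ ≤ ∫⁻ y, ∫⁻ h, ‖W' (y - h) - W' y‖ₑ ^ 2 ∂κ := lintegral_mono hpt
      _ = ∫⁻ h, ∫⁻ y, ‖W' (y - h) - W' y‖ₑ ^ 2 ∂volume ∂κ := lintegral_lintegral_swap hmeas
      _ ≤ ∫⁻ h, ε ^ 2 ∂κ := by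
          refine lintegral_mono_ae ?_
          filter_upwards [hκae] with h hh
          have h3 := hball h hh
          rw [← eLpNorm_two_sq]
          refine pow_le_pow_left' (le_of_eq_of_le (eLpNorm_congr_ae ?_) h3) 2
          filter_upwards [hWW, (measurePreserving_sub_right volume
            h).quasiMeasurePreserving.ae_eq_comp hWW] with y hy hy'
          simp only [Function.comp] at hy'
          rw [hy, hy']
      _ = ε ^ 2 := by simp
  exact (ENNReal.pow_le_pow_left_iff two_ne_zero).1 hsq

theorem contDiff_mollify {η w : Plane → ℝ} (hη : ContDiff ℝ ∞ η) (hc : HasCompactSupport η)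
    (hw : LocallyIntegrable w) : ContDiff ℝ ∞ (mollify η w) :=
  hc.contDiff_convolution_left (ContinuousLinearMap.lsmul ℝ ℝ) hη hw

/-- The weak gradient identity is required only for the one test function `z ↦ η (y - z)`, so it can
be applied at those `y` where this function is supported in the domain. -/
theorem gradient_mollify {η w : Plane → ℝ} {W : Plane → Plane} (hη : ContDiff ℝ ∞ η)
    (hc : HasCompactSupport η) (hw : LocallyIntegrable w) {y : Plane}
    (h : ∫ z, w z • gradient (fun z ↦ η (y - z)) z = - ∫ z, η (y - z) • W z) :
    gradient (mollify η w) y = mollify η W y := by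
  have hcy : HasCompactSupport fun z ↦ η (y - z) :=
    hc.comp_homeomorph (Homeomorph.subLeft y)
  have hηy : ContDiff ℝ ∞ fun z ↦ η (y - z) := hη.comp (contDiff_const.sub contDiff_id)
  have h1 := hc.hasFDerivAt_convolution_left (ContinuousLinearMap.lsmul ℝ ℝ)
    (hη.of_le (by exact_mod_cast le_top)) hw y
  have hgr : ∀ z, gradient (fun z ↦ η (y - z)) z = - gradient η (y - z) := by
    intro z
    have h2 : HasFDerivAt (fun z ↦ y - z) (-ContinuousLinearMap.id ℝ Plane) z :=
      (hasFDerivAt_id z).const_sub y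
    have h3 := ((hη.differentiable (by simp)) (y - z)).hasFDerivAt.comp z h2
    rw [gradient, show fderiv ℝ (fun z ↦ η (y - z)) z = _ from h3.fderiv, gradient,
      ContinuousLinearMap.comp_neg, ContinuousLinearMap.comp_id, map_neg]
  have e1 : mollify η W y = ∫ z, η (y - z) • W z := by
    rw [mollify, ← integral_sub_left_eq_self _ volume y]
    simp only [sub_sub_cancel]
  have e2 : ∫ z, w z • gradient (fun z ↦ η (y - z)) z = -∫ h, w (y - h) • gradient η h := by
    rw [← integral_sub_left_eq_self _ volume y, ← integral_neg]
    simp only [hgr, sub_sub_cancel, smul_neg]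
  rw [e2, neg_inj] at h
  rw [e1, ← h]
  refine ext_inner_right ℝ fun e ↦ ?_
  rw [inner_gradient, show fderiv ℝ (mollify η w) y = _ from h1.fderiv, convolution_def]
  have i1 : Integrable fun t ↦ ((ContinuousLinearMap.lsmul ℝ ℝ).precompL Plane)
      (fderiv ℝ η t) (w (y - t)) :=
    (hc.fderiv (𝕜 := ℝ)).convolutionExists_left _ (hη.continuous_fderiv (by simp)) hw y
  have i2 : Integrable fun t ↦ w (y - t) • gradient η t :=
    (hasCompactSupport_gradient hc).convolutionExists_left
      (ContinuousLinearMap.lsmul ℝ ℝ).flip (continuous_gradient hη) hw y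
  rw [ContinuousLinearMap.integral_apply i1, real_inner_comm, ← innerSL_apply_apply ℝ,
    ← (innerSL ℝ e).integral_comp_comm i2]
  refine integral_congr_ae (.of_forall fun t ↦ ?_)
  simp only [innerSL_apply_apply, inner_smul_right]
  simp [ContinuousLinearMap.precompL_apply, mul_comm]

end VirtualElement

namespace VirtualElement

/-! ### Density of smooth functions -/

/-- Extension by zero spoils the weak gradient across the boundary. A kernel centred at `-(t • e)`
makes the convolution at `y ∈ Ω` see only a ball around `y + t • e`, which the cone property keeps
inside `Ω`. -/
theorem exists_contDiff_eLpNorm_sub_le {Ω : Set Plane} (hΩ : MeasurableSet Ω) {w : Plane → ℝ}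
    {W : Plane → Plane} (hw : MemLp w 2 volume) (hW : MemLp W 2 volume)
    (hweak : ∀ θ : Plane → ℝ, ContDiff ℝ ∞ θ → HasCompactSupport θ → tsupport θ ⊆ Ω →
      ∫ z, w z • gradient θ z = - ∫ z, θ z • W z)
    {x e : Plane} {c ρ T : ℝ} (hc : 0 < c) (hρ : 0 < ρ) (hT : 0 < T)
    (hcone : ∀ y ∈ Ω, dist y x < ρ → ∀ t : ℝ, 0 < t → t < T →
      Metric.ball (y + t • e) (c * t) ⊆ Ω)
    (hsupp : ∀ z, ρ / 2 ≤ dist z x → w z = 0 ∧ W z = 0) {ε : ℝ≥0∞} (hε : 0 < ε) :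
    ∃ φ : Plane → ℝ, ContDiff ℝ ∞ φ ∧ eLpNorm (φ - w) 2 (volume.restrict Ω) ≤ ε ∧
      eLpNorm (gradient φ - W) 2 (volume.restrict Ω) ≤ ε := by
  obtain ⟨δ₁, hδ₁, h₁⟩ := eLpNorm_mollify_sub_le hw hε
  obtain ⟨δ₂, hδ₂, h₂⟩ := eLpNorm_mollify_sub_le hW hε
  set d := min (min δ₁ δ₂) (ρ / 2) with hd
  have hd0 : 0 < d := by positivity
  have hec : 0 < ‖e‖ + c := by positivity
  obtain ⟨t, ht0, htT, htd⟩ : ∃ t, 0 < t ∧ t < T ∧ t * (‖e‖ + c) < d := by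
    refine ⟨min (T / 2) (d / (2 * (‖e‖ + c))), by positivity,
      (min_le_left _ _).trans_lt (by linarith), ?_⟩
    calc min (T / 2) (d / (2 * (‖e‖ + c))) * (‖e‖ + c)
        ≤ d / (2 * (‖e‖ + c)) * (‖e‖ + c) := by gcongr; exact min_le_right _ _
      _ = d / 2 := by field_simp
      _ < d := by linarith
  let f : ContDiffBump (-(t • e)) := ⟨c * t / 4, c * t / 2, by positivity, by
    have : 0 < c * t := by positivity
    linarith⟩
  set η := f.normed volume with hη
  have hηc : HasCompactSupport η := f.hasCompactSupport_normed
  have hηs : ContDiff ℝ ∞ η := f.contDiff_normed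
  have hts : tsupport η = Metric.closedBall (-(t • e)) (c * t / 2) := f.tsupport_normed_eq
  have hct : 0 < c * t := by positivity
  have hte : ‖t • e‖ = t * ‖e‖ := by rw [norm_smul, Real.norm_of_nonneg ht0.le]
  have hsub : ∀ δ, d ≤ δ → tsupport η ⊆ Metric.closedBall 0 δ := by
    intro δ hδ z hz
    rw [hts, mem_closedBall_iff_norm, sub_neg_eq_add] at hz
    rw [mem_closedBall_zero_iff]
    calc ‖z‖ = ‖(z + t • e) - t • e‖ := by rw [add_sub_cancel_right]
      _ ≤ ‖z + t • e‖ + ‖t • e‖ := norm_sub_le _ _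
      _ ≤ δ := by rw [hte]; linarith
  have k₁ := h₁ η hηs.continuous f.nonneg_normed f.integral_normed
    (hsub _ ((min_le_left _ _).trans (min_le_left _ _)))
  have k₂ := h₂ η hηs.continuous f.nonneg_normed f.integral_normed
    (hsub _ ((min_le_left _ _).trans (min_le_right _ _)))
  have hwl : LocallyIntegrable w := hw.locallyIntegrable (by norm_num)
  refine ⟨mollify η w, contDiff_mollify hηs hηc hwl,
    (eLpNorm_mono_measure _ Measure.restrict_le_self).trans k₁, ?_⟩
  have hgr : ∀ y ∈ Ω, gradient (mollify η w) y = mollify η W y := by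
    intro y hy
    refine gradient_mollify hηs hηc hwl ?_
    have hθc : HasCompactSupport fun z ↦ η (y - z) := hηc.comp_homeomorph (Homeomorph.subLeft y)
    have hθs : ContDiff ℝ ∞ fun z ↦ η (y - z) := hηs.comp (contDiff_const.sub contDiff_id)
    have hθt : tsupport (fun z ↦ η (y - z)) ⊆ Metric.closedBall (y + t • e) (c * t / 2) := by
      refine closure_minimal (fun z hz ↦ ?_) Metric.isClosed_closedBall
      have : y - z ∈ tsupport η := subset_tsupport _ hz
      rw [hts, mem_closedBall_iff_norm, sub_neg_eq_add] at this
      rwa [mem_closedBall_iff_norm, ← norm_neg,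
        show -(z - (y + t • e)) = y - z + t • e by abel]
    by_cases hyx : dist y x < ρ
    · refine hweak _ hθs hθc (hθt.trans ?_)
      exact (Metric.closedBall_subset_ball (by linarith)).trans (hcone y hy hyx t ht0 htT)
    -- For `y` far from `x` the shifted kernel is still at distance at least `ρ / 2` from `x`, where
    -- `w` and `W` vanish, so both sides are zero.
    · have hz : ∀ z, (w z = 0 ∧ W z = 0) ∨ z ∉ tsupport fun z ↦ η (y - z) := by
        intro z
        by_cases hzt : z ∈ tsupport fun z ↦ η (y - z)
        · refine .inl (hsupp z ?_)
          have h3 := mem_closedBall_iff_norm.1 (hθt hzt)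
          have h4 : dist y z ≤ t * (‖e‖ + c) := by
            rw [dist_eq_norm]
            calc ‖y - z‖ = ‖-(z - (y + t • e)) - t • e‖ := by congr 1; abel
              _ ≤ ‖z - (y + t • e)‖ + ‖t • e‖ := by
                rw [← norm_neg (z - (y + t • e))]
                exact norm_sub_le _ _
              _ ≤ t * (‖e‖ + c) := by rw [hte]; linarith
          have h5 := min_le_right (min δ₁ δ₂) (ρ / 2)
          have h6 := dist_triangle y z x
          linarith
        · exact .inr hzt
      rw [integral_eq_zero_of_ae, integral_eq_zero_of_ae, neg_zero]
      · refine .of_forall fun z ↦ ?_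
        rcases hz z with h | h
        · simp [h.2]
        · simp [image_eq_zero_of_notMem_tsupport h]
      · refine .of_forall fun z ↦ ?_
        rcases hz z with h | h
        · simp [h.1]
        · simp [gradient_eq_zero_of_notMem_tsupport h]
  refine le_trans (le_of_eq_of_le (eLpNorm_congr_ae ?_)
    (eLpNorm_mono_measure _ Measure.restrict_le_self)) k₂
  filter_upwards [ae_restrict_mem hΩ] with y hy
  rw [Pi.sub_apply, Pi.sub_apply, hgr y hy]

/-- The function `u` and the vector field `G` can be approximated in `L²(Ω)` by a smooth function
and its gradient. -/
def Approximable (Ω : TopologicalSpace.Opens Plane) (u : Plane → ℝ) (G : Plane → Plane) : Prop :=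
  ∀ ε : ℝ≥0∞, 0 < ε → ∃ φ : Plane → ℝ, ContDiff ℝ ∞ φ ∧ eLpNorm (φ - u) 2 (vol Ω) ≤ ε ∧
    eLpNorm (gradient φ - G) 2 (vol Ω) ≤ ε

theorem Approximable.congr {Ω : TopologicalSpace.Opens Plane} {u v : Plane → ℝ}
    {G H : Plane → Plane} (h : Approximable Ω u G) (huv : u =ᵐ[vol Ω] v) (hGH : G =ᵐ[vol Ω] H) :
    Approximable Ω v H := by
  intro ε hε
  obtain ⟨φ, hφ, h1, h2⟩ := h ε hε
  refine ⟨φ, hφ, le_of_eq_of_le (eLpNorm_congr_ae ?_) h1,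
    le_of_eq_of_le (eLpNorm_congr_ae ?_) h2⟩
  · filter_upwards [huv] with x hx
    simp [hx]
  · filter_upwards [hGH] with x hx
    simp [hx]

theorem Approximable.add {Ω : TopologicalSpace.Opens Plane} {u v : Plane → ℝ}
    {G H : Plane → Plane} (hu : Approximable Ω u G) (hv : Approximable Ω v H)
    (mu : AEStronglyMeasurable u (vol Ω)) (mv : AEStronglyMeasurable v (vol Ω))
    (mG : AEStronglyMeasurable G (vol Ω)) (mH : AEStronglyMeasurable H (vol Ω)) :
    Approximable Ω (u + v) (G + H) := by
  intro ε hε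
  obtain ⟨φ, hφ, h1, h2⟩ := hu (ε / 2) (ENNReal.half_pos hε.ne')
  obtain ⟨ψ, hψ, h3, h4⟩ := hv (ε / 2) (ENNReal.half_pos hε.ne')
  refine ⟨φ + ψ, hφ.add hψ, ?_, ?_⟩
  · rw [add_sub_add_comm, ← ENNReal.add_halves ε]
    exact (eLpNorm_add_le (hφ.continuous.aestronglyMeasurable.sub mu)
      (hψ.continuous.aestronglyMeasurable.sub mv) (by norm_num)).trans (add_le_add h1 h3)
  · rw [gradient_add_of_contDiff hφ hψ, add_sub_add_comm, ← ENNReal.add_halves ε]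
    exact (eLpNorm_add_le ((continuous_gradient hφ).aestronglyMeasurable.sub mG)
      ((continuous_gradient hψ).aestronglyMeasurable.sub mH) (by norm_num)).trans
      (add_le_add h2 h4)

/-- The gradient of the product of `χ` with a function `u` with weak gradient `G`. -/
def mulGrad (χ : Plane → ℝ) (u : Plane → ℝ) (G : Plane → Plane) : Plane → Plane :=
  fun x ↦ χ x • G x + u x • gradient χ x

theorem aestronglyMeasurable_mulGrad {μ : Measure Plane} {χ u : Plane → ℝ} {G : Plane → Plane}
    (hχ : ContDiff ℝ ∞ χ) (mu : AEStronglyMeasurable u μ) (mG : AEStronglyMeasurable G μ) :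
    AEStronglyMeasurable (mulGrad χ u G) μ :=
  (hχ.continuous.aestronglyMeasurable.smul mG).add
    (mu.smul (continuous_gradient hχ).aestronglyMeasurable)

theorem Approximable.mul {Ω : TopologicalSpace.Opens Plane} (hΩ : IsCompact (closure (Ω : Set Plane)))
    {u : Plane → ℝ} {G : Plane → Plane} (h : Approximable Ω u G)
    (mu : AEStronglyMeasurable u (vol Ω)) (mG : AEStronglyMeasurable G (vol Ω))
    {χ : Plane → ℝ} (hχ : ContDiff ℝ ∞ χ) : Approximable Ω (χ * u) (mulGrad χ u G) := by
  obtain ⟨A, hA⟩ := hΩ.exists_bound_of_continuousOn hχ.continuous.continuousOn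
  obtain ⟨B, hB⟩ := hΩ.exists_bound_of_continuousOn (continuous_gradient hχ).continuousOn
  intro ε hε
  set D := ENNReal.ofReal (|A|) + ENNReal.ofReal (|B|) + 1 with hD
  have hD0 : D ≠ 0 := by simp [hD]
  have hD1 : D ≠ ⊤ := by simp [hD]
  have hmem : ∀ᵐ x ∂(vol Ω), x ∈ closure (Ω : Set Plane) := by
    filter_upwards [ae_restrict_mem Ω.isOpen.measurableSet] with x hx using subset_closure hx
  obtain ⟨φ, hφ, h1, h2⟩ := h (ε / D) (ENNReal.div_pos hε.ne' hD1)
  have e1 : eLpNorm (χ • (φ - u)) 2 (vol Ω) ≤ ENNReal.ofReal (|A|) * (ε / D) := by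
    refine (eLpNorm_le_mul_eLpNorm_of_ae_le_mul ?_ 2).trans (mul_le_mul_right h1 _)
    filter_upwards [hmem] with x hx
    rw [Pi.smul_apply', norm_smul]
    gcongr
    exact (hA x hx).trans (le_abs_self A)
  have e2 : eLpNorm (χ • (gradient φ - G)) 2 (vol Ω) ≤ ENNReal.ofReal (|A|) * (ε / D) := by
    refine (eLpNorm_le_mul_eLpNorm_of_ae_le_mul ?_ 2).trans (mul_le_mul_right h2 _)
    filter_upwards [hmem] with x hx
    rw [Pi.smul_apply', norm_smul]
    gcongr
    exact (hA x hx).trans (le_abs_self A)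
  have e3 : eLpNorm ((φ - u) • gradient χ) 2 (vol Ω) ≤ ENNReal.ofReal (|B|) * (ε / D) := by
    refine (eLpNorm_le_mul_eLpNorm_of_ae_le_mul ?_ 2).trans (mul_le_mul_right h1 _)
    filter_upwards [hmem] with x hx
    rw [Pi.smul_apply', norm_smul, mul_comm]
    gcongr
    exact (hB x hx).trans (le_abs_self B)
  have hDε : D * (ε / D) = ε := ENNReal.mul_div_cancel hD0 hD1
  refine ⟨χ * φ, contDiff_mul hχ hφ, ?_, ?_⟩
  · rw [← mul_sub]
    refine e1.trans ?_
    calc ENNReal.ofReal |A| * (ε / D) ≤ D * (ε / D) := by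
          gcongr
          rw [hD, add_assoc]
          exact le_self_add
      _ = ε := hDε
  · have e : gradient (χ * φ) - mulGrad χ u G =
        χ • (gradient φ - G) + (φ - u) • gradient χ := by
      ext1 x
      rw [Pi.sub_apply, gradient_mul_of_contDiff hχ hφ]
      simp only [mulGrad, Pi.add_apply, Pi.smul_apply', Pi.sub_apply]
      module
    rw [e]
    refine (eLpNorm_add_le ?_ ?_ (by norm_num)).trans ((add_le_add e2 e3).trans ?_)
    · exact hχ.continuous.aestronglyMeasurable.smul
        ((continuous_gradient hφ).aestronglyMeasurable.sub mG)
    · exact (hφ.continuous.aestronglyMeasurable.sub mu).smul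
        (continuous_gradient hχ).aestronglyMeasurable
    · calc ENNReal.ofReal |A| * (ε / D) + ENNReal.ofReal |B| * (ε / D) ≤ D * (ε / D) := by
            rw [← add_mul]
            gcongr
            exact le_self_add
        _ = ε := hDε

theorem IsWeakGradient.mul {Ω : TopologicalSpace.Opens Plane} {u : Lp ℝ 2 (vol Ω)}
    {G : Lp Plane 2 (vol Ω)} (h : IsWeakGradient Ω u G) {χ : Plane → ℝ} (hχ : ContDiff ℝ ∞ χ) :
    IsWeakGradient Ω (χ * u) (mulGrad χ u G) := by
  intro θ hθ hc hs
  have hχθ := contDiff_mul hχ hθ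
  have hcs : HasCompactSupport (χ * θ) := hc.mul_left
  have h1 := h (χ * θ) hχθ hcs (tsupport_mul_subset_right.trans hs)
  have i1 := integrable_smul_grad u hχθ hcs
  have i2 := integrable_test_smul G hχθ hcs
  have i3 : Integrable (fun x ↦ u x • (θ x • gradient χ x)) (vol Ω) :=
    memLp_one_iff_integrable.1 (MemLp.smul (p := 2) (q := 2) (r := 1)
      ((hθ.continuous.smul (continuous_gradient hχ)).memLp_of_hasCompactSupport
        (hc.smul_right)) (Lp.memLp u))
  have e1 : ∀ x, (χ * u) x • gradient θ x =
      u x • gradient (χ * θ) x - u x • (θ x • gradient χ x) := by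
    intro x
    rw [gradient_mul_of_contDiff hχ hθ, Pi.mul_apply]
    module
  have e2 : ∀ x, θ x • mulGrad χ u G x =
      (χ * θ) x • G x + u x • (θ x • gradient χ x) := by
    intro x
    rw [mulGrad, Pi.mul_apply]
    module
  simp only [e1, e2]
  rw [integral_sub i1 i3, integral_add i2 i3, h1]
  abel

/-- After multiplication by `ψ` the extensions by zero vanish outside the range of a single cone
condition, so the shifted mollification applies. -/
theorem IsWeakGradient.approximable_of_cone {Ω : TopologicalSpace.Opens Plane}
    {u : Lp ℝ 2 (vol Ω)} {G : Lp Plane 2 (vol Ω)} (h : IsWeakGradient Ω u G)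
    {x e : Plane} {c ρ T : ℝ} (hc : 0 < c) (hρ : 0 < ρ) (hT : 0 < T)
    (hcone : ∀ y ∈ (Ω : Set Plane), dist y x < ρ → ∀ t : ℝ, 0 < t → t < T →
      Metric.ball (y + t • e) (c * t) ⊆ Ω) {ψ : Plane → ℝ} (hψ : ContDiff ℝ ∞ ψ)
    (hψc : HasCompactSupport ψ) (hψs : tsupport ψ ⊆ Metric.ball x (ρ / 2)) :
    Approximable Ω (ψ * ⇑u) (mulGrad ψ u G) := by
  intro ε hε
  have mu : AEStronglyMeasurable u (vol Ω) := Lp.aestronglyMeasurable u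
  have mG : AEStronglyMeasurable G (vol Ω) := Lp.aestronglyMeasurable G
  have hΩm := Ω.isOpen.measurableSet
  set w := (Ω : Set Plane).indicator (ψ * ⇑u) with hw
  set W := (Ω : Set Plane).indicator (mulGrad ψ u G) with hW
  have hwL : MemLp w 2 volume := by
    rw [hw, memLp_indicator_iff_restrict hΩm]
    obtain ⟨A, hA⟩ := hψ.continuous.bounded_above_of_compact_support hψc
    exact (Lp.memLp u).of_le_mul (hψ.continuous.aestronglyMeasurable.mul mu) (c := A)
      (.of_forall fun x ↦ by
        rw [Pi.mul_apply, norm_mul]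
        gcongr
        exact hA x)
  have hWL : MemLp W 2 volume := by
    rw [hW, memLp_indicator_iff_restrict hΩm]
    obtain ⟨A, hA⟩ := hψ.continuous.bounded_above_of_compact_support hψc
    obtain ⟨B, hB⟩ := (continuous_gradient hψ).bounded_above_of_compact_support
      (hasCompactSupport_gradient hψc)
    refine MemLp.add (f := fun x ↦ ψ x • G x) (g := fun x ↦ u x • gradient ψ x) ?_ ?_
    · exact (Lp.memLp G).of_le_mul (hψ.continuous.aestronglyMeasurable.smul mG) (c := A)
        (.of_forall fun x ↦ by
          rw [norm_smul]
          gcongr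
          exact hA x)
    · exact (Lp.memLp u).of_le_mul (mu.smul (continuous_gradient hψ).aestronglyMeasurable)
        (c := B) (.of_forall fun x ↦ by
          rw [norm_smul, mul_comm]
          gcongr
          exact hB x)
  have hweak : ∀ θ : Plane → ℝ, ContDiff ℝ ∞ θ → HasCompactSupport θ → tsupport θ ⊆ Ω →
      ∫ z, w z • gradient θ z = - ∫ z, θ z • W z := by
    intro θ hθ hθc hθs
    have := h.mul hψ θ hθ hθc hθs
    rw [← integral_indicator hΩm, ← integral_indicator hΩm] at this
    have e1 : ∀ z, w z • gradient θ z =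
        (Ω : Set Plane).indicator (fun x ↦ (ψ * ⇑u) x • gradient θ x) z := by
      intro z
      by_cases hz : z ∈ (Ω : Set Plane) <;> simp [hw, hz]
    have e2 : ∀ z, θ z • W z =
        (Ω : Set Plane).indicator (fun x ↦ θ x • mulGrad ψ u G x) z := by
      intro z
      by_cases hz : z ∈ (Ω : Set Plane) <;> simp [hW, hz]
    simp only [e1, e2]
    exact this
  have hsupp : ∀ z, ρ / 2 ≤ dist z x → w z = 0 ∧ W z = 0 := by
    intro z hz
    have hzt : z ∉ tsupport ψ := fun h' ↦ not_lt.2 hz (hψs h')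
    have h3 := image_eq_zero_of_notMem_tsupport hzt
    have h4 := gradient_eq_zero_of_notMem_tsupport hzt
    constructor
    · by_cases hzΩ : z ∈ (Ω : Set Plane) <;> simp [hw, hzΩ, h3]
    · by_cases hzΩ : z ∈ (Ω : Set Plane) <;> simp [hW, hzΩ, h3, h4, mulGrad]
  obtain ⟨φ, hφ, h1, h2⟩ := exists_contDiff_eLpNorm_sub_le hΩm hwL hWL hweak hc hρ hT hcone
    hsupp hε
  refine ⟨φ, hφ, le_of_eq_of_le (eLpNorm_congr_ae ?_) h1,
    le_of_eq_of_le (eLpNorm_congr_ae ?_) h2⟩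
  · filter_upwards [ae_restrict_mem hΩm] with z hz
    rw [Pi.sub_apply, Pi.sub_apply, hw, Set.indicator_of_mem hz]
  · filter_upwards [ae_restrict_mem hΩm] with z hz
    rw [Pi.sub_apply, Pi.sub_apply, hW, Set.indicator_of_mem hz]

/-- Density of functions smooth up to the boundary: the multipliers `ψ` for which `ψ * u` is
approximable are closed under gluing, and bumps near each point of the closure belong to them. -/
theorem HasInwardCones.approximable {Ω : TopologicalSpace.Opens Plane}
    (hΩ : HasInwardCones (Ω : Set Plane)) (hcpt : IsCompact (closure (Ω : Set Plane)))
    {u : Lp ℝ 2 (vol Ω)} {G : Lp Plane 2 (vol Ω)} (h : IsWeakGradient Ω u G) :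
    Approximable Ω u G := by
  have mu : AEStronglyMeasurable u (vol Ω) := Lp.aestronglyMeasurable u
  have mG : AEStronglyMeasurable G (vol Ω) := Lp.aestronglyMeasurable G
  have hΩm := Ω.isOpen.measurableSet
  let I : Set (Plane → ℝ) := {ψ | ContDiff ℝ ∞ ψ ∧ Approximable Ω (ψ * ⇑u) (mulGrad ψ u G)}
  have hI0 : (0 : Plane → ℝ) ∈ I := by
    refine ⟨contDiff_const, fun ε _ ↦ ⟨0, contDiff_const, ?_, ?_⟩⟩
    · simp
    · have : gradient (0 : Plane → ℝ) - mulGrad 0 u G = 0 := by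
        ext1 x
        simp [mulGrad, gradient_zero_fun]
      simp [this]
  have hI : ∀ ψ ∈ I, ∀ ψ' ∈ I, ψ + ψ' - ψ * ψ' ∈ I := by
    rintro ψ ⟨h1, h2⟩ ψ' ⟨h1', h2'⟩
    have hχ : ContDiff ℝ ∞ (1 - ψ) := contDiff_const.sub h1
    have m1 : AEStronglyMeasurable (ψ * ⇑u) (vol Ω) := h1.continuous.aestronglyMeasurable.mul mu
    have m1' : AEStronglyMeasurable (ψ' * ⇑u) (vol Ω) :=
      h1'.continuous.aestronglyMeasurable.mul mu
    have m2 := aestronglyMeasurable_mulGrad h1 mu mG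
    have m2' := aestronglyMeasurable_mulGrad h1' mu mG
    -- The glued multiplier is written as `ψ + (1 - ψ) * ψ'`, a sum of approximable parts.
    have h3 := h2.add (h2'.mul hcpt m1' m2' hχ) m1
      (hχ.continuous.aestronglyMeasurable.mul m1') m2 (aestronglyMeasurable_mulGrad hχ m1' m2')
    refine ⟨(h1.add h1').sub (contDiff_mul h1 h1'), ?_⟩
    convert h3 using 1
    · ring
    · have hg1 : ∀ x, gradient (1 - ψ) x = -gradient ψ x := by
        intro x
        rw [gradient, gradient, ← map_neg, ← fderiv_const_sub (1 : ℝ)]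
        rfl
      have hg2 : ∀ x, gradient (ψ + ψ' - ψ * ψ') x =
          gradient ψ x + gradient ψ' x - (ψ x • gradient ψ' x + ψ' x • gradient ψ x) := by
        intro x
        rw [← gradient_mul_of_contDiff h1 h1']
        simp only [gradient, ← map_add, ← map_sub]
        rw [fderiv_sub, fderiv_add]
        · exact h1.differentiable (by simp) x
        · exact h1'.differentiable (by simp) x
        · exact (h1.add h1').differentiable (by simp) x
        · exact (contDiff_mul h1 h1').differentiable (by simp) x
      ext1 x
      simp only [mulGrad, hg1, hg2, Pi.add_apply, Pi.sub_apply, Pi.mul_apply, Pi.one_apply]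
      module
  obtain ⟨ψ, ⟨hψ, hψa⟩, hψ1⟩ := exists_eq_one_of_locally hI0 hI hcpt (by
    intro x hx
    obtain ⟨e, c, hc, ρ, hρ, T, hT, hcone⟩ := hΩ x hx
    obtain ⟨ψ, hψ, hψc, hψ1, hψs, -⟩ := exists_bump x (half_pos hρ)
    exact ⟨ψ, ⟨hψ, h.approximable_of_cone hc hρ hT hcone hψ hψc hψs⟩, hψ1⟩)
  refine hψa.congr ?_ ?_
  · filter_upwards [ae_restrict_mem hΩm] with x hx
    simp [(hψ1 x (subset_closure hx)).self_of_nhds]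
  · filter_upwards [ae_restrict_mem hΩm] with x hx
    have h5 : gradient ψ x = 0 := by
      rw [gradient_congr_of_eventuallyEq (hψ1 x (subset_closure hx)), gradient]
      simp
    simp [mulGrad, (hψ1 x (subset_closure hx)).self_of_nhds, h5]

end VirtualElement

namespace VirtualElement

/-! ### Smooth functions in `L²` -/

/-- The space of smooth functions on the plane. -/
def smooth : Submodule ℝ (Plane → ℝ) where
  carrier := {φ | ContDiff ℝ ∞ φ}
  zero_mem' := contDiff_const (𝕜 := ℝ) (n := ∞) (c := (0 : ℝ))
  add_mem' {φ ψ} h h' := ContDiff.add (𝕜 := ℝ) (n := ∞) (f := φ) (g := ψ) h h'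
  smul_mem' c φ h := ContDiff.const_smul (𝕜 := ℝ) (n := ∞) (f := φ) c h

theorem smooth.contDiff (φ : smooth) : ContDiff ℝ ∞ φ.1 := φ.2

/-- The constant function one. -/
def smooth.one : smooth := ⟨fun _ ↦ 1, contDiff_const (𝕜 := ℝ) (n := ∞) (c := (1 : ℝ))⟩

theorem gradient_const (c : ℝ) : gradient (fun _ : Plane ↦ c) = 0 := by
  ext1 x
  simp [gradient]

theorem tendsto_toLp_iff {E : Type*} [NormedAddCommGroup E] {μ : Measure Plane}
    {f : ℕ → Plane → E} (hf : ∀ k, MemLp (f k) 2 μ) (u : Lp E 2 μ) :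
    Tendsto (fun k ↦ (hf k).toLp (f k)) atTop (𝓝 u) ↔
      Tendsto (fun k ↦ eLpNorm (f k - ⇑u) 2 μ) atTop (𝓝 0) := by
  rw [tendsto_iff_edist_tendsto_0]
  refine iff_of_eq (congrArg (Tendsto · atTop (𝓝 0)) (funext fun k ↦ ?_))
  rw [Lp.edist_def]
  exact eLpNorm_congr_ae ((hf k).coeFn_toLp.sub .rfl)

namespace PolygonalDomain

variable {m : ℕ} (P : PolygonalDomain m)

/-- A smooth function as an element of `L²(P)`. -/
def valueL2 : smooth →ₗ[ℝ] Lp ℝ 2 (vol P.dom) where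
  toFun φ := (P.memLp_dom (smooth.contDiff φ).continuous).toLp φ.1
  map_add' _ _ := rfl
  map_smul' _ _ := rfl

/-- The gradient of a smooth function as an element of `L²(P; ℝ²)`. -/
def gradL2 : smooth →ₗ[ℝ] Lp Plane 2 (vol P.dom) where
  toFun φ := (P.memLp_dom (continuous_gradient (smooth.contDiff φ))).toLp (gradient φ.1)
  map_add' φ ψ := by
    rw [← MemLp.toLp_add, MemLp.toLp_eq_toLp_iff]
    exact .of_forall (congrFun (gradient_add_of_contDiff φ.2 ψ.2))
  map_smul' c φ := by
    rw [RingHom.id_apply, ← MemLp.toLp_const_smul, MemLp.toLp_eq_toLp_iff]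
    exact .of_forall (congrFun (gradient_smul_of_contDiff c φ.2))

/-- The restriction of a smooth function to the boundary as an element of `L²(∂P)`. -/
def arcL2 : smooth →ₗ[ℝ] Lp ℝ 2 (arc P.carrier) where
  toFun φ := (P.memLp_arc (smooth.contDiff φ).continuous).toLp φ.1
  map_add' _ _ := rfl
  map_smul' _ _ := rfl

theorem valueL2_ae (φ : smooth) : P.valueL2 φ =ᵐ[vol P.dom] φ.1 :=
  MemLp.coeFn_toLp (P.memLp_dom (smooth.contDiff φ).continuous)

theorem gradL2_ae (φ : smooth) : P.gradL2 φ =ᵐ[vol P.dom] gradient φ.1 :=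
  MemLp.coeFn_toLp (P.memLp_dom (continuous_gradient (smooth.contDiff φ)))

theorem arcL2_ae (φ : smooth) : P.arcL2 φ =ᵐ[arc P.carrier] φ.1 :=
  MemLp.coeFn_toLp (P.memLp_arc (smooth.contDiff φ).continuous)

theorem tendsto_valueL2_iff (φ : ℕ → smooth) (u : Lp ℝ 2 (vol P.dom)) :
    Tendsto (fun k ↦ P.valueL2 (φ k)) atTop (𝓝 u) ↔
      Tendsto (fun k ↦ eLpNorm ((φ k).1 - ⇑u) 2 (vol P.dom)) atTop (𝓝 0) :=
  tendsto_toLp_iff (fun k ↦ P.memLp_dom (smooth.contDiff (φ k)).continuous) u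

theorem tendsto_gradL2_iff (φ : ℕ → smooth) (G : Lp Plane 2 (vol P.dom)) :
    Tendsto (fun k ↦ P.gradL2 (φ k)) atTop (𝓝 G) ↔
      Tendsto (fun k ↦ eLpNorm (gradient (φ k).1 - ⇑G) 2 (vol P.dom)) atTop (𝓝 0) :=
  tendsto_toLp_iff (fun k ↦ P.memLp_dom (continuous_gradient (smooth.contDiff (φ k)))) G

theorem tendsto_arcL2_iff (φ : ℕ → smooth) (g : Lp ℝ 2 (arc P.carrier)) :
    Tendsto (fun k ↦ P.arcL2 (φ k)) atTop (𝓝 g) ↔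
      Tendsto (fun k ↦ eLpNorm ((φ k).1 - ⇑g) 2 (arc P.carrier)) atTop (𝓝 0) :=
  tendsto_toLp_iff (fun k ↦ P.memLp_arc (smooth.contDiff (φ k)).continuous) g

theorem enorm_valueL2_sq (φ : smooth) :
    ‖P.valueL2 φ‖ₑ ^ 2 = ∫⁻ x in interior P.carrier, ‖φ.1 x‖ₑ ^ 2 := by
  rw [← eLpNorm_two_sq]
  exact congrArg (· ^ 2) (Lp.enorm_toLp (P.memLp_dom (smooth.contDiff φ).continuous))

theorem enorm_gradL2_sq (φ : smooth) :
    ‖P.gradL2 φ‖ₑ ^ 2 = ∫⁻ x in interior P.carrier, ‖gradient φ.1 x‖ₑ ^ 2 := by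
  rw [← eLpNorm_two_sq]
  exact congrArg (· ^ 2) (Lp.enorm_toLp (P.memLp_dom (continuous_gradient (smooth.contDiff φ))))

theorem enorm_arcL2_sq (φ : smooth) :
    ‖P.arcL2 φ‖ₑ ^ 2 = ∫⁻ x in frontier P.carrier, ‖φ.1 x‖ₑ ^ 2 ∂μH[1] := by
  rw [← eLpNorm_two_sq]
  exact congrArg (· ^ 2) (Lp.enorm_toLp (P.memLp_arc (smooth.contDiff φ).continuous))


theorem gradL2_one : P.gradL2 smooth.one = 0 := by
  refine Lp.eq_zero_iff_ae_eq_zero.2 ?_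
  filter_upwards [P.gradL2_ae smooth.one] with x hx
  rw [hx]
  exact congrFun (gradient_const 1) x

theorem isCompact_closure_interior : IsCompact (closure (P.dom : Set Plane)) :=
  P.isCompact.of_isClosed_subset isClosed_closure
    (closure_minimal interior_subset P.isCompact.isClosed)

theorem hasTrace_iff (v : H1 P.dom) (g : Lp ℝ 2 (arc P.carrier)) :
    HasTrace P.carrier v g ↔ ∃ φ : ℕ → smooth, Tendsto (fun k ↦ P.valueL2 (φ k)) atTop (𝓝 v.1) ∧
      Tendsto (fun k ↦ P.gradL2 (φ k)) atTop (𝓝 (weakGrad _ v)) ∧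
      Tendsto (fun k ↦ P.arcL2 (φ k)) atTop (𝓝 g) := by
  constructor
  · rintro ⟨φ, hφ, h1, h2, h3⟩
    exact ⟨fun k ↦ ⟨φ k, hφ k⟩, (P.tendsto_valueL2_iff _ _).2 h1,
      (P.tendsto_gradL2_iff _ _).2 h2, (P.tendsto_arcL2_iff _ _).2 h3⟩
  · rintro ⟨φ, h1, h2, h3⟩
    exact ⟨fun k ↦ (φ k).1, fun k ↦ (φ k).2, (P.tendsto_valueL2_iff _ _).1 h1,
      (P.tendsto_gradL2_iff _ _).1 h2, (P.tendsto_arcL2_iff _ _).1 h3⟩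

theorem exists_tendsto (v : H1 P.dom) : ∃ φ : ℕ → smooth,
    Tendsto (fun k ↦ P.valueL2 (φ k)) atTop (𝓝 v.1) ∧
      Tendsto (fun k ↦ P.gradL2 (φ k)) atTop (𝓝 (weakGrad _ v)) := by
  have h := P.hasLipschitzBoundary.hasInwardCones.approximable (Ω := P.dom)
    P.isCompact_closure_interior (isWeakGradient_weakGrad v)
  choose φ hφ h1 h2 using fun k : ℕ ↦ h ((k : ℝ≥0∞)⁻¹) (by simp)
  refine ⟨fun k ↦ ⟨φ k, hφ k⟩, (P.tendsto_valueL2_iff _ _).2 ?_,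
    (P.tendsto_gradL2_iff _ _).2 ?_⟩
  · exact tendsto_of_tendsto_of_tendsto_of_le_of_le tendsto_const_nhds
      ENNReal.tendsto_inv_nat_nhds_zero (fun _ ↦ zero_le) h1
  · exact tendsto_of_tendsto_of_tendsto_of_le_of_le tendsto_const_nhds
      ENNReal.tendsto_inv_nat_nhds_zero (fun _ ↦ zero_le) h2

/-! ### The trace operator -/

/-- Sum of the trace inequalities over the edges, which lie in the closure of the interior and miss
the interior. -/
theorem exists_norm_arcL2_le : ∃ C : ℝ, ∀ φ, ‖P.arcL2 φ‖ ≤ C * (‖P.valueL2 φ‖ + ‖P.gradL2 φ‖) := by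
  have h : ∀ i, ∃ C : ℝ≥0, ∀ φ : Plane → ℝ, ContDiff ℝ ∞ φ →
      ∫⁻ x in P.edge i, ‖φ x‖ₑ ^ 2 ∂μH[1] ≤ C * ((∫⁻ y in interior P.carrier, ‖φ y‖ₑ ^ 2) +
        ∫⁻ y in interior P.carrier, ‖gradient φ y‖ₑ ^ 2) := by
    intro i
    rw [P.edge_eq_segment]
    refine P.hasLipschitzBoundary.hasInwardCones.lintegral_segment_sq_le isOpen_interior
      (P.node_ne i) ?_ ?_
    · rw [← P.edge_eq_segment]
      exact (P.edge_subset_frontier i).trans P.frontier_subset_closure_interior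
    · rw [← P.edge_eq_segment]
      refine Set.disjoint_left.2 fun x hx hx' ↦ ?_
      exact (P.edge_subset_frontier i hx).2 hx'
  choose C hC using h
  refine ⟨NNReal.sqrt (∑ i, C i), fun φ ↦ ?_⟩
  have key : ‖P.arcL2 φ‖ₑ ^ 2 ≤ (∑ i, C i : ℝ≥0) * (‖P.valueL2 φ‖ₑ ^ 2 + ‖P.gradL2 φ‖ₑ ^ 2) := by
    rw [enorm_arcL2_sq, enorm_valueL2_sq, enorm_gradL2_sq, P.frontier_eq_iUnion]
    refine (lintegral_iUnion_le _ _).trans ?_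
    rw [tsum_fintype, ENNReal.ofNNReal_finsetSum, Finset.sum_mul]
    exact Finset.sum_le_sum fun i _ ↦ hC i φ.1 φ.2
  have key' : ‖P.arcL2 φ‖₊ ^ 2 ≤ (∑ i, C i) * (‖P.valueL2 φ‖₊ ^ 2 + ‖P.gradL2 φ‖₊ ^ 2) := by
    simp only [enorm_eq_nnnorm] at key
    exact_mod_cast key
  have key2 : ‖P.arcL2 φ‖₊ ≤ NNReal.sqrt (∑ i, C i) * (‖P.valueL2 φ‖₊ + ‖P.gradL2 φ‖₊) := by
    refine (pow_le_pow_iff_left₀ (by positivity) (by positivity) two_ne_zero).1 (key'.trans ?_)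
    rw [mul_pow, NNReal.sq_sqrt]
    gcongr
    rw [add_sq]
    calc _ ≤ ‖P.valueL2 φ‖₊ ^ 2 + ‖P.gradL2 φ‖₊ ^ 2 + 2 * ‖P.valueL2 φ‖₊ * ‖P.gradL2 φ‖₊ :=
          le_self_add
      _ = _ := by ring
  exact NNReal.coe_le_coe.2 key2

theorem tendsto_arcL2_zero {φ : ℕ → smooth} (h1 : Tendsto (fun k ↦ P.valueL2 (φ k)) atTop (𝓝 0))
    (h2 : Tendsto (fun k ↦ P.gradL2 (φ k)) atTop (𝓝 0)) :
    Tendsto (fun k ↦ P.arcL2 (φ k)) atTop (𝓝 0) := by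
  obtain ⟨C, hC⟩ := P.exists_norm_arcL2_le
  refine squeeze_zero_norm (fun k ↦ hC (φ k)) ?_
  simpa using (h1.norm.add h2.norm).const_mul C

theorem hasTrace_unique {v : H1 P.dom} {g h : Lp ℝ 2 (arc P.carrier)}
    (hg : HasTrace P.carrier v g) (hh : HasTrace P.carrier v h) : g = h := by
  obtain ⟨φ, h1, h2, h3⟩ := (P.hasTrace_iff v g).1 hg
  obtain ⟨ψ, h1', h2', h3'⟩ := (P.hasTrace_iff v h).1 hh
  have := P.tendsto_arcL2_zero (φ := fun k ↦ φ k - ψ k)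
    (by simpa using h1.sub h1') (by simpa using h2.sub h2')
  simp only [map_sub] at this
  exact sub_eq_zero.1 (tendsto_nhds_unique (h3.sub h3') this)

/-- By the trace inequality the boundary values of an `H¹`-convergent sequence form a Cauchy
sequence. -/
theorem hasTrace_of_tendsto {v : H1 P.dom} {φ : ℕ → smooth}
    (h1 : Tendsto (fun k ↦ P.valueL2 (φ k)) atTop (𝓝 v.1))
    (h2 : Tendsto (fun k ↦ P.gradL2 (φ k)) atTop (𝓝 (weakGrad _ v))) :
    ∃ g, HasTrace P.carrier v g := by
  obtain ⟨C, hC⟩ := P.exists_norm_arcL2_le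
  have hC' : CauchySeq fun k ↦ P.arcL2 (φ k) := by
    rw [cauchySeq_iff_tendsto_dist_atTop_0]
    have d1 := cauchySeq_iff_tendsto_dist_atTop_0.1 h1.cauchySeq
    have d2 := cauchySeq_iff_tendsto_dist_atTop_0.1 h2.cauchySeq
    refine squeeze_zero (fun _ ↦ dist_nonneg) (fun k ↦ ?_)
      (by simpa using (d1.add d2).const_mul C)
    rw [dist_eq_norm, dist_eq_norm, dist_eq_norm, ← map_sub, ← map_sub, ← map_sub]
    exact hC _
  obtain ⟨g, hg⟩ := cauchySeq_tendsto_of_complete hC'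
  exact ⟨g, (P.hasTrace_iff v g).2 ⟨φ, h1, h2, hg⟩⟩

/-- By density an approximating sequence always exists, so the default value `0` in `boundaryTrace`
never occurs. -/
theorem hasTrace_boundaryTrace (v : H1 P.dom) :
    HasTrace P.carrier v (boundaryTrace P.carrier v) := by
  obtain ⟨φ, h1, h2⟩ := P.exists_tendsto v
  have h := P.hasTrace_of_tendsto h1 h2
  rw [boundaryTrace, dif_pos h]
  exact h.choose_spec

/-- The trace as a linear map. -/
def trace : H1 P.dom →ₗ[ℝ] Lp ℝ 2 (arc P.carrier) where
  toFun := boundaryTrace P.carrier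
  map_add' v w := P.hasTrace_unique (P.hasTrace_boundaryTrace _)
    ((P.hasTrace_boundaryTrace v).add (P.hasTrace_boundaryTrace w))
  map_smul' c v := P.hasTrace_unique (P.hasTrace_boundaryTrace _)
    ((P.hasTrace_boundaryTrace v).smul c)

theorem exists_tendsto_trace (v : H1 P.dom) : ∃ φ : ℕ → smooth,
    Tendsto (fun k ↦ P.valueL2 (φ k)) atTop (𝓝 v.1) ∧
      Tendsto (fun k ↦ P.gradL2 (φ k)) atTop (𝓝 (weakGrad _ v)) ∧
      Tendsto (fun k ↦ P.arcL2 (φ k)) atTop (𝓝 (P.trace v)) :=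
  (P.hasTrace_iff v _).1 (P.hasTrace_boundaryTrace v)

/-! ### The Poincaré inequality -/

theorem valueL2_one_ne_zero : P.valueL2 smooth.one ≠ 0 := by
  intro h
  have h1 : ∀ᵐ x ∂(vol P.dom), False := by
    filter_upwards [P.valueL2_ae smooth.one, Lp.eq_zero_iff_ae_eq_zero.1 h] with x hx hx'
    rw [hx] at hx'
    exact one_ne_zero (α := ℝ) hx'
  rw [eventually_false_iff_eq_bot, ae_eq_bot, Measure.restrict_eq_zero] at h1
  exact isOpen_interior.measure_ne_zero volume P.isConnected_interior.nonempty h1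

theorem exists_norm_valueL2_le : ∃ C : ℝ, ∀ φ, inner ℝ (P.valueL2 smooth.one) (P.valueL2 φ) = 0 →
    ‖P.valueL2 φ‖ ≤ C * ‖P.gradL2 φ‖ := by
  obtain ⟨C, hC⟩ := P.hasLipschitzBoundary.hasInwardCones.poincareOn isOpen_interior
    P.isConnected_interior P.isCompact_closure_interior
  refine ⟨NNReal.sqrt C, fun φ hφ ↦ ?_⟩
  obtain ⟨c, hc⟩ := hC φ.1 φ.2
  set ψ : smooth := φ - c • smooth.one with hψ
  have h1 : ‖P.valueL2 ψ‖₊ ^ 2 ≤ C * ‖P.gradL2 φ‖₊ ^ 2 := by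
    have e2 : ‖P.valueL2 ψ‖ₑ ^ 2 = ∫⁻ x in interior P.carrier, ‖φ.1 x - c‖ₑ ^ 2 := by
      have : (fun x ↦ φ.1 x - c) = ψ.1 := by
        ext1 x
        simp [hψ, smooth.one]
      rw [P.enorm_valueL2_sq, ← this]
    rw [← e2, ← P.enorm_gradL2_sq] at hc
    simp only [enorm_eq_nnnorm] at hc
    exact_mod_cast hc
  have h2 : ‖P.valueL2 ψ‖₊ ≤ NNReal.sqrt C * ‖P.gradL2 φ‖₊ := by
    refine (pow_le_pow_iff_left₀ (by positivity) (by positivity) two_ne_zero).1 (h1.trans ?_)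
    rw [mul_pow, NNReal.sq_sqrt]
  have h2' : ‖P.valueL2 ψ‖ ≤ NNReal.sqrt C * ‖P.gradL2 φ‖ := NNReal.coe_le_coe.2 h2
  refine le_trans ?_ h2'
  -- As `φ` is orthogonal to the constants, `‖φ‖² = ⟪φ, φ - c⟫` for any `c`, so the unknown constant
  -- of the Poincaré inequality is harmless.
  have h3 : ‖P.valueL2 φ‖ * ‖P.valueL2 φ‖ ≤ ‖P.valueL2 φ‖ * ‖P.valueL2 ψ‖ := by
    refine le_of_eq_of_le ?_ (real_inner_le_norm (P.valueL2 φ) (P.valueL2 ψ))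
    rw [hψ, map_sub, map_smul, inner_sub_right, inner_smul_right,
      real_inner_comm (P.valueL2 smooth.one) (P.valueL2 φ), hφ, ← real_inner_self_eq_norm_mul_norm]
    simp
  by_cases h0 : ‖P.valueL2 φ‖ = 0
  · rw [h0]; positivity
  · exact le_of_mul_le_mul_left h3 (lt_of_le_of_ne (norm_nonneg _) (Ne.symm h0))

/-- Subtraction of the mean value. -/
def centre : smooth →ₗ[ℝ] smooth :=
  LinearMap.id - (LinearMap.toSpanSingleton ℝ smooth smooth.one).comp
    ((‖P.valueL2 smooth.one‖ ^ 2)⁻¹ •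
      ((innerSL ℝ (P.valueL2 smooth.one)).toLinearMap.comp P.valueL2))

theorem centre_eq (φ : smooth) : ∃ t : ℝ, P.centre φ = φ - t • smooth.one :=
  ⟨_, rfl⟩

theorem gradL2_centre (φ : smooth) : P.gradL2 (P.centre φ) = P.gradL2 φ := by
  obtain ⟨t, ht⟩ := P.centre_eq φ
  simp [ht, gradL2_one]

theorem inner_centre (φ : smooth) :
    inner ℝ (P.valueL2 smooth.one) (P.valueL2 (P.centre φ)) = 0 := by
  have h : ‖P.valueL2 smooth.one‖ ≠ 0 := norm_ne_zero_iff.2 P.valueL2_one_ne_zero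
  simp [centre, inner_sub_right, inner_smul_right]
  field_simp
  simp

/-- The centred approximants tend to zero by the Poincaré inequality, so `v` is a limit of
constants, and the constants form a closed subspace. -/
theorem eq_const_of_weakGrad_eq_zero {v : H1 P.dom} (hv : weakGrad P.dom v = 0) :
    ∃ c : ℝ, v.1 = c • P.valueL2 smooth.one := by
  obtain ⟨φ, h1, h2⟩ := P.exists_tendsto v
  rw [hv] at h2
  obtain ⟨C, hC⟩ := P.exists_norm_valueL2_le
  have h3 : Tendsto (fun k ↦ P.valueL2 (P.centre (φ k))) atTop (𝓝 0) := by
    refine squeeze_zero_norm (fun k ↦ hC _ (P.inner_centre (φ k))) ?_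
    simp only [gradL2_centre]
    simpa using h2.norm.const_mul C
  have h4 := h1.sub h3
  rw [sub_zero] at h4
  have h5 : v.1 ∈ Submodule.span ℝ {P.valueL2 smooth.one} := by
    refine (Submodule.closed_of_finiteDimensional _).mem_of_tendsto h4 (.of_forall fun k ↦ ?_)
    obtain ⟨t, ht⟩ := P.centre_eq (φ k)
    rw [ht, map_sub, map_smul, sub_sub_cancel]
    exact Submodule.smul_mem _ _ (Submodule.mem_span_singleton_self _)
  obtain ⟨c, hc⟩ := Submodule.mem_span_singleton.1 h5
  exact ⟨c, hc.symm⟩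

end PolygonalDomain

end VirtualElement

namespace VirtualElement

/-! ### Green's formula -/

/-- A form bounded by `‖D x‖` factors through the range of `D`; extend it by Hahn–Banach and
represent it by Riesz. Projecting onto the closure of the range changes no product with `D x` and
makes the representer a limit of elements `D x`. -/
theorem exists_inner_eq_of_norm_le {E H : Type*} [AddCommGroup E] [Module ℝ E]
    [NormedAddCommGroup H] [InnerProductSpace ℝ H] [CompleteSpace H] (D : E →ₗ[ℝ] H)
    (l : E →ₗ[ℝ] ℝ) {C : ℝ} (h : ∀ x, ‖l x‖ ≤ C * ‖D x‖) :
    ∃ G ∈ closure (Set.range D), ∀ x, inner ℝ G (D x) = l x := by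
  have hker : D.ker ≤ l.ker := by
    intro x hx
    rw [LinearMap.mem_ker] at hx ⊢
    have := h x
    rw [hx, norm_zero, mul_zero] at this
    exact norm_le_zero_iff.1 this
  let f₀ : D.range →ₗ[ℝ] ℝ := (D.ker.liftQ l hker).comp D.quotKerEquivRange.symm.toLinearMap
  have hf₀ : ∀ x, f₀ ⟨D x, x, rfl⟩ = l x := by
    intro x
    have : D.quotKerEquivRange.symm ⟨D x, x, rfl⟩ = D.ker.mkQ x :=
      D.quotKerEquivRange_symm_apply_image x _
    simp [f₀, this]
  let f : StrongDual ℝ D.range := f₀.mkContinuous C (by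
    rintro ⟨_, x, rfl⟩
    rw [hf₀]
    exact h x)
  obtain ⟨g, hg, -⟩ := exists_extension_norm_eq D.range f
  set G := (InnerProductSpace.toDual ℝ H).symm g
  set K := D.range.topologicalClosure
  have hKc : CompleteSpace K := D.range.isClosed_topologicalClosure.completeSpace_coe
  refine ⟨K.starProjection G, ?_, fun x ↦ ?_⟩
  · exact K.starProjection_apply_mem G
  · have hx : D x ∈ K := D.range.le_topologicalClosure ⟨x, rfl⟩
    rw [Submodule.inner_starProjection_left_eq_right, Submodule.starProjection_eq_self_iff.2 hx,
      InnerProductSpace.toDual_symm_apply, hg ⟨D x, x, rfl⟩]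
    exact hf₀ x

namespace PolygonalDomain

variable {m : ℕ} (P : PolygonalDomain m)

theorem inner_gradL2 (G : Lp Plane 2 (vol P.dom)) (φ : smooth) :
    inner ℝ G (P.gradL2 φ) = ∫ x in interior P.carrier, inner ℝ (G x) (gradient φ.1 x) := by
  rw [L2.inner_def]
  refine integral_congr_ae ?_
  filter_upwards [P.gradL2_ae φ] with x hx
  rw [hx]

theorem inner_valueL2 (u : Lp ℝ 2 (vol P.dom)) (φ : smooth) :
    inner ℝ u (P.valueL2 φ) = ∫ x in interior P.carrier, u x * φ.1 x := by
  rw [L2.inner_def]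
  refine integral_congr_ae ?_
  filter_upwards [P.valueL2_ae φ] with x hx
  rw [hx]
  simp [mul_comm]

theorem inner_valueL2_valueL2 (φ ψ : smooth) :
    inner ℝ (P.valueL2 φ) (P.valueL2 ψ) = ∫ x in interior P.carrier, φ.1 x * ψ.1 x := by
  rw [inner_valueL2]
  refine integral_congr_ae ?_
  filter_upwards [P.valueL2_ae φ] with x hx
  rw [hx]

theorem inner_arcL2 (g : Lp ℝ 2 (arc P.carrier)) (φ : smooth) :
    inner ℝ g (P.arcL2 φ) = ∫ x in frontier P.carrier, g x * φ.1 x ∂μH[1] := by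
  rw [L2.inner_def]
  refine integral_congr_ae ?_
  filter_upwards [P.arcL2_ae φ] with x hx
  rw [hx]
  simp [mul_comm]

/-- For smooth approximants the identity is Gauss' theorem for `φ k * θ`, which is supported inside.
Both sides are continuous in `L²`. -/
theorem isWeakGradient_of_tendsto {φ : ℕ → smooth} {u : Lp ℝ 2 (vol P.dom)}
    {G : Lp Plane 2 (vol P.dom)} (h1 : Tendsto (fun k ↦ P.valueL2 (φ k)) atTop (𝓝 u))
    (h2 : Tendsto (fun k ↦ P.gradL2 (φ k)) atTop (𝓝 G)) : IsWeakGradient P.dom u G := by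
  intro θ hθ hθc hθs
  refine ext_inner_left ℝ fun e ↦ ?_
  have hga : MemLp (fun x ↦ inner ℝ e (gradient θ x)) 2 (vol P.dom) :=
    P.memLp_dom (continuous_const.inner (continuous_gradient hθ))
  have hb : MemLp (fun x ↦ θ x • e) 2 (vol P.dom) := P.memLp_dom (hθ.continuous.smul continuous_const)
  have e1 : ∀ w : Lp ℝ 2 (vol P.dom), inner ℝ w (hga.toLp _) =
      ∫ x in interior P.carrier, w x * inner ℝ e (gradient θ x) := by
    intro w
    rw [L2.inner_def]
    refine integral_congr_ae ?_
    filter_upwards [hga.coeFn_toLp] with x hx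
    rw [hx]
    simp [mul_comm]
  have e2 : ∀ W : Lp Plane 2 (vol P.dom), inner ℝ W (hb.toLp _) =
      ∫ x in interior P.carrier, θ x * inner ℝ (W x) e := by
    intro w
    rw [L2.inner_def]
    refine integral_congr_ae ?_
    filter_upwards [hb.coeFn_toLp] with x hx
    rw [hx, inner_smul_right]
  have key : ∀ k, inner ℝ (P.valueL2 (φ k)) (hga.toLp _) =
      - inner ℝ (P.gradL2 (φ k)) (hb.toLp _) := by
    intro k
    have h3 := P.integral_gradient_eq_zero (contDiff_mul (φ k).2 hθ)
      (hθc.mul_left (f := (φ k).1)) ((tsupport_mul_subset_right).trans hθs) e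
    have i1 : Integrable (fun x ↦ P.valueL2 (φ k) x * inner ℝ e (gradient θ x)) (vol P.dom) :=
      (Lp.memLp _).integrable_mul hga
    have i2 : Integrable (fun x ↦ θ x * inner ℝ (P.gradL2 (φ k) x) e) (vol P.dom) := by
      refine (P.integrable_inner (Lp.memLp (P.gradL2 (φ k))) hb).congr (.of_forall fun x ↦ ?_)
      exact real_inner_smul_right _ _ _
    have h5 := integral_add i1 i2
    rw [e1, e2, eq_neg_iff_add_eq_zero, ← h3]
    refine h5.symm.trans ?_
    refine integral_congr_ae ?_
    filter_upwards [P.valueL2_ae (φ k), P.gradL2_ae (φ k)] with x hx hx'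
    rw [hx, hx', gradient_mul_of_contDiff (φ k).2 hθ, inner_add_left, real_inner_smul_left,
      real_inner_smul_left, real_inner_comm e (gradient θ x)]
  have h4 : inner ℝ u (hga.toLp _) = - inner ℝ G (hb.toLp _) := by
    refine tendsto_nhds_unique (h1.inner tendsto_const_nhds) ?_
    simp only [key]
    exact (h2.inner tendsto_const_nhds).neg
  rw [e1, e2] at h4
  rw [inner_neg_right, ← integral_inner (integrable_smul_grad u hθ hθc),
    ← integral_inner (integrable_test_smul G hθ hθc)]
  simp only [inner_smul_right]
  refine h4.trans ?_
  simp only [real_inner_comm e]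
  rfl

theorem exists_H1_of_tendsto {φ : ℕ → smooth} {u : Lp ℝ 2 (vol P.dom)}
    {G : Lp Plane 2 (vol P.dom)} (h1 : Tendsto (fun k ↦ P.valueL2 (φ k)) atTop (𝓝 u))
    (h2 : Tendsto (fun k ↦ P.gradL2 (φ k)) atTop (𝓝 G)) :
    ∃ v : H1 P.dom, v.1 = u ∧ weakGrad P.dom v = G :=
  have h := P.isWeakGradient_of_tendsto h1 h2
  ⟨⟨u, G, h⟩, rfl, (isWeakGradient_weakGrad ⟨u, G, h⟩).unique h⟩

/-- The Poincaré inequality makes the centred preimages Cauchy, so a limit of smooth gradients is a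
weak gradient. -/
theorem exists_weakGrad_eq {G : Lp Plane 2 (vol P.dom)} (hG : G ∈ closure (Set.range P.gradL2)) :
    ∃ v : H1 P.dom, weakGrad P.dom v = G := by
  obtain ⟨x, hx, hxG⟩ := mem_closure_iff_seq_limit.1 hG
  choose φ hφ using hx
  obtain ⟨C, hC⟩ := P.exists_norm_valueL2_le
  have h2 : Tendsto (fun k ↦ P.gradL2 (P.centre (φ k))) atTop (𝓝 G) := by
    simpa only [gradL2_centre, hφ] using hxG
  have hcau : CauchySeq fun k ↦ P.valueL2 (P.centre (φ k)) := by
    rw [cauchySeq_iff_tendsto_dist_atTop_0]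
    refine squeeze_zero (fun _ ↦ dist_nonneg) (fun k ↦ ?_)
      (by simpa using (cauchySeq_iff_tendsto_dist_atTop_0.1 h2.cauchySeq).const_mul C)
    rw [dist_eq_norm, dist_eq_norm, ← map_sub, ← map_sub, ← map_sub P.gradL2,
      ← map_sub P.centre]
    exact hC _ (P.inner_centre _)
  obtain ⟨u, hu⟩ := cauchySeq_tendsto_of_complete hcau
  obtain ⟨v, -, hv⟩ := P.exists_H1_of_tendsto hu h2
  exact ⟨v, hv⟩

/-! ### Edgewise constant functions -/

/-- The indicator function of an edge. -/
def edgeL2 (i : Fin m) : Lp ℝ 2 (arc P.carrier) :=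
  indicatorConstLp 2 (P.isClosed_edge i).measurableSet (measure_ne_top (arc P.carrier) _) 1

theorem inner_edgeL2 (i : Fin m) (g : Lp ℝ 2 (arc P.carrier)) :
    inner ℝ (P.edgeL2 i) g = ∫ x in P.edge i, g x ∂μH[1] := by
  rw [edgeL2, L2.inner_indicatorConstLp_one, Measure.restrict_restrict_of_subset
    (P.edge_subset_frontier i)]

/-- The function with the value `c i` on the `i`-th edge. -/
def edgewise : (Fin m → ℝ) →ₗ[ℝ] Lp ℝ 2 (arc P.carrier) :=
  Fintype.linearCombination ℝ P.edgeL2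

theorem inner_edgewise (c : Fin m → ℝ) (g : Lp ℝ 2 (arc P.carrier)) :
    inner ℝ (P.edgewise c) g = ∑ i, c i * ∫ x in P.edge i, g x ∂μH[1] := by
  simp [edgewise, Fintype.linearCombination_apply, sum_inner, inner_smul_left, inner_edgeL2]

theorem eq_of_mem_edge {i j : Fin m} {x : Plane} (hx : ∀ k, x ≠ P.node k) (hi : x ∈ P.edge i)
    (hj : x ∈ P.edge j) : j = i := by
  obtain ⟨s, hs, rfl⟩ := P.mem_edge_iff.1 hi
  refine P.eq_of_point_mem ⟨lt_of_le_of_ne hs.1 ?_, lt_of_le_of_ne hs.2 ?_⟩ hj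
  · rintro rfl
    exact hx _ (P.point_zero i)
  · rintro rfl
    exact hx _ (P.point_one i)

theorem ae_ne_node : ∀ᵐ x ∂(arc P.carrier), ∀ k, x ≠ P.node k := by
  have := Measure.nullSingletonClass_hausdorff Plane (one_pos)
  exact ae_restrict_of_ae (ae_all_iff.2 fun k ↦ Measure.ae_ne _ _)

theorem edgewise_ae (c : Fin m → ℝ) :
    ∀ᵐ x ∂(arc P.carrier), ∀ i, x ∈ P.edge i → P.edgewise c x = c i := by
  have h1 : P.edgewise c =ᵐ[arc P.carrier] ∑ i, c i • ⇑(P.edgeL2 i) := by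
    rw [edgewise, Fintype.linearCombination_apply]
    refine (Lp.coeFn_finsetSum _ _).trans ?_
    have : ∀ᵐ x ∂(arc P.carrier), ∀ i, (c i • P.edgeL2 i) x = c i • P.edgeL2 i x :=
      ae_all_iff.2 fun i ↦ Lp.coeFn_smul _ _
    filter_upwards [this] with x hx
    simp [hx]
  have h2 : ∀ᵐ x ∂(arc P.carrier), ∀ i, P.edgeL2 i x = (P.edge i).indicator (fun _ ↦ 1) x :=
    ae_all_iff.2 fun i ↦ indicatorConstLp_coeFn
  filter_upwards [h1, h2, P.ae_ne_node] with x h1 h2 hx i hi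
  rw [h1, Finset.sum_apply, Finset.sum_eq_single i]
  · simp [h2, hi]
  · intro j _ hj
    have : x ∉ P.edge j := fun h ↦ hj (P.eq_of_mem_edge hx hi h)
    simp [h2, this]
  · simp

theorem eq_edgewise {g : Lp ℝ 2 (arc P.carrier)} {c : Fin m → ℝ}
    (h : ∀ i, ∀ᵐ x ∂(arc P.carrier), x ∈ P.edge i → g x = c i) : g = P.edgewise c := by
  refine Lp.ext ?_
  filter_upwards [ae_all_iff.2 h, P.edgewise_ae c, ae_restrict_mem isClosed_frontier.measurableSet]
    with x h1 h2 hx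
  rw [P.frontier_eq_iUnion, Set.mem_iUnion] at hx
  obtain ⟨i, hi⟩ := hx
  rw [h1 i hi, h2 i hi]

/-! ### The Neumann problem -/

/-- Affine functions are smooth. -/
def _root_.VirtualElement.affine : (Plane →ᴬ[ℝ] ℝ) →ₗ[ℝ] smooth where
  toFun p := ⟨p, contDiff_affine p⟩
  map_add' _ _ := rfl
  map_smul' _ _ := rfl

/-- `v` has the Laplacian `p` and the normal derivative `c i` on the `i`-th edge. -/
def IsNeumannSolution (v : H1 P.dom) (p : Plane →ᴬ[ℝ] ℝ) (c : Fin m → ℝ) : Prop :=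
  ∀ φ, inner ℝ (weakGrad P.dom v) (P.gradL2 φ) + inner ℝ (P.valueL2 (affine p)) (P.valueL2 φ) =
    inner ℝ (P.edgewise c) (P.arcL2 φ)

variable {P} in
-- Smooth functions approximate `w` in value, gradient and trace at once, so the identity extends
-- from smooth tests to `H¹`.
theorem IsNeumannSolution.green {v : H1 P.dom} {p : Plane →ᴬ[ℝ] ℝ} {c : Fin m → ℝ}
    (h : P.IsNeumannSolution v p c) (w : H1 P.dom) :
    inner ℝ (weakGrad P.dom v) (weakGrad P.dom w) + inner ℝ (P.valueL2 (affine p)) w.1 =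
      inner ℝ (P.edgewise c) (P.trace w) := by
  obtain ⟨φ, h1, h2, h3⟩ := P.exists_tendsto_trace w
  refine tendsto_nhds_unique ((tendsto_const_nhds.inner h2).add (tendsto_const_nhds.inner h1)) ?_
  exact (tendsto_const_nhds.inner h3).congr fun k ↦ (h (φ k)).symm

/-- Compatibility says that the right-hand side vanishes on constants. It may then be evaluated on
centred functions, where the Poincaré and trace inequalities bound it by the gradient norm, and the
representer is a weak gradient. -/
theorem exists_isNeumannSolution {p : Plane →ᴬ[ℝ] ℝ} {c : Fin m → ℝ}
    (h : inner ℝ (P.valueL2 (affine p)) (P.valueL2 smooth.one) =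
      inner ℝ (P.edgewise c) (P.arcL2 smooth.one)) : ∃ v, P.IsNeumannSolution v p c := by
  let l : smooth →ₗ[ℝ] ℝ := (innerSL ℝ (P.edgewise c)).toLinearMap.comp P.arcL2 -
    (innerSL ℝ (P.valueL2 (affine p))).toLinearMap.comp P.valueL2
  have hl : ∀ φ, l φ = inner ℝ (P.edgewise c) (P.arcL2 φ) -
    inner ℝ (P.valueL2 (affine p)) (P.valueL2 φ) := fun φ ↦ rfl
  have hl1 : l smooth.one = 0 := by rw [hl, h, sub_self]
  obtain ⟨A, hA⟩ := P.exists_norm_arcL2_le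
  obtain ⟨B, hB⟩ := P.exists_norm_valueL2_le
  obtain ⟨G, hG, hGl⟩ := exists_inner_eq_of_norm_le P.gradL2 l
    (C := ‖P.edgewise c‖ * (|A| * (B + 1)) + ‖P.valueL2 (affine p)‖ * B) fun φ ↦ by
    obtain ⟨t, ht⟩ := P.centre_eq φ
    have e : l φ = l (P.centre φ) := by rw [ht, map_sub, map_smul, hl1, smul_zero, sub_zero]
    have hB' := hB _ (P.inner_centre φ)
    have hA' := hA (P.centre φ)
    rw [gradL2_centre] at hB' hA'
    have hA2 : ‖P.arcL2 (P.centre φ)‖ ≤ |A| * ((B + 1) * ‖P.gradL2 φ‖) := by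
      refine hA'.trans (mul_le_mul (le_abs_self A) ?_ (by positivity) (abs_nonneg A))
      linarith
    rw [e, hl]
    refine (norm_sub_le _ _).trans ?_
    calc ‖inner ℝ (P.edgewise c) (P.arcL2 (P.centre φ))‖ +
          ‖inner ℝ (P.valueL2 (affine p)) (P.valueL2 (P.centre φ))‖
        ≤ ‖P.edgewise c‖ * ‖P.arcL2 (P.centre φ)‖ +
          ‖P.valueL2 (affine p)‖ * ‖P.valueL2 (P.centre φ)‖ :=
          add_le_add (norm_inner_le_norm _ _) (norm_inner_le_norm _ _)
      _ ≤ ‖P.edgewise c‖ * (|A| * ((B + 1) * ‖P.gradL2 φ‖)) +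
          ‖P.valueL2 (affine p)‖ * (B * ‖P.gradL2 φ‖) := by gcongr
      _ = _ := by ring
  obtain ⟨v, hv⟩ := P.exists_weakGrad_eq hG
  refine ⟨v, fun φ ↦ ?_⟩
  rw [hv, hGl, hl]
  ring

/-- Shows that the edge integrals of the trace determine the mean of the weak gradient, and hence
the slope of the Ritz projection. -/
theorem exists_gauss_trace : ∃ n : Fin m → Plane, ∀ (e : Plane) (w : H1 P.dom),
    ∫ x in interior P.carrier, inner ℝ (weakGrad P.dom w x) e =
      inner ℝ (P.edgewise fun i ↦ inner ℝ (n i) e) (P.trace w) := by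
  obtain ⟨n, hn⟩ := P.exists_gauss
  refine ⟨n, fun e w ↦ ?_⟩
  have he : MemLp (fun _ : Plane ↦ e) 2 (vol P.dom) := P.memLp_dom continuous_const
  have e1 : ∀ W : Lp Plane 2 (vol P.dom), inner ℝ W (he.toLp _) =
      ∫ x in interior P.carrier, inner ℝ (W x) e := by
    intro W
    rw [L2.inner_def]
    refine integral_congr_ae ?_
    filter_upwards [he.coeFn_toLp] with x hx
    rw [hx]
  obtain ⟨φ, -, h2, h3⟩ := P.exists_tendsto_trace w
  rw [← e1]
  refine tendsto_nhds_unique (h2.inner tendsto_const_nhds) ?_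
  have key : ∀ k, inner ℝ (P.gradL2 (φ k)) (he.toLp _) =
      inner ℝ (P.edgewise fun i ↦ inner ℝ (n i) e) (P.arcL2 (φ k)) := by
    intro k
    rw [e1, inner_edgewise]
    refine Eq.trans (integral_congr_ae ?_) ((hn e _ (φ k).2).trans ?_)
    · filter_upwards [P.gradL2_ae (φ k)] with x hx
      rw [hx]
    · refine Finset.sum_congr rfl fun i _ ↦ congrArg _ (integral_congr_ae ?_)
      exact (EventuallyEq.symm
        (ae_restrict_of_ae_restrict_of_subset (P.edge_subset_frontier i) (P.arcL2_ae (φ k))))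
  simp only [key]
  exact tendsto_const_nhds.inner h3

end PolygonalDomain

end VirtualElement

namespace VirtualElement

/-! ### Affine functions -/

/-- The gradient of an affine function. -/
def slope : (Plane →ᴬ[ℝ] ℝ) →ₗ[ℝ] Plane where
  toFun q := (InnerProductSpace.toDual ℝ Plane).symm q.contLinear
  map_add' p q := by rw [← map_add]; rfl
  map_smul' c q := by
    rw [RingHom.id_apply, ← conj_trivial c, ← map_smulₛₗ, conj_trivial]
    rfl

theorem affine_eq (q : Plane →ᴬ[ℝ] ℝ) (x : Plane) : q x = inner ℝ (slope q) x + q 0 := by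
  have h := congrFun q.decomp x
  rw [h]
  simp [slope]

theorem gradient_affine (q : Plane →ᴬ[ℝ] ℝ) (x : Plane) : gradient q x = slope q := by
  have h : HasFDerivAt q q.contLinear x := by
    rw [q.decomp]
    exact q.contLinear.hasFDerivAt.add_const _
  rw [gradient, h.fderiv]
  rfl

/-- The linear form `x ↦ ⟪e, x⟫` as an affine function. -/
def linearForm : Plane →ₗ[ℝ] (Plane →ᴬ[ℝ] ℝ) where
  toFun e := (innerSL ℝ e).toContinuousAffineMap
  map_add' e f := by
    ext x
    simp
  map_smul' c e := by
    ext x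
    simp

theorem slope_linearForm (e : Plane) : slope (linearForm e) = e := by
  refine ext_inner_right ℝ fun x ↦ ?_
  have h := affine_eq (linearForm e) x
  simp only [linearForm, LinearMap.coe_mk, AddHom.coe_mk] at h ⊢
  simpa using h.symm

/-- The constant affine function `1`. -/
def affineOne : Plane →ᴬ[ℝ] ℝ := ContinuousAffineMap.const ℝ Plane 1

theorem slope_affineOne : slope affineOne = 0 := by
  rw [← gradient_affine affineOne 0]
  exact congrFun (gradient_const 1) 0

theorem affine_affineOne : affine affineOne = smooth.one := rfl

theorem finrank_affine : Module.finrank ℝ (Plane →ᴬ[ℝ] ℝ) = 3 := by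
  rw [(ContinuousAffineMap.decompLinearIsometryEquiv ℝ ℝ Plane ℝ).toLinearEquiv.finrank_eq,
    Module.finrank_prod, ← (InnerProductSpace.toDual ℝ Plane).toLinearEquiv.finrank_eq]
  simp

instance finiteDimensional_affine : FiniteDimensional ℝ (Plane →ᴬ[ℝ] ℝ) :=
  Module.finite_of_finrank_pos (by rw [finrank_affine]; norm_num)

theorem eq_zero_of_eqOn_zero {q : Plane →ᴬ[ℝ] ℝ} {U : Set Plane} (hU : IsOpen U)
    (hne : U.Nonempty) (h : ∀ x ∈ U, q x = 0) : q = 0 := by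
  have : q.toAffineMap = (0 : Plane →ᴬ[ℝ] ℝ).toAffineMap :=
    AffineMap.ext_on (hU.affineSpan_eq_top hne) fun x hx ↦ h x hx
  ext x
  exact congrArg (fun f : Plane →ᵃ[ℝ] ℝ ↦ f x) this

namespace PolygonalDomain

variable {m : ℕ} (P : PolygonalDomain m)

/-! ### The extended space -/

theorem arcL2_eq_zero {φ : smooth} (h : tsupport φ.1 ⊆ interior P.carrier) : P.arcL2 φ = 0 := by
  refine Lp.eq_zero_iff_ae_eq_zero.2 ?_
  filter_upwards [P.arcL2_ae φ, ae_restrict_mem isClosed_frontier.measurableSet] with x hx hx'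
  rw [hx]
  exact image_eq_zero_of_notMem_tsupport fun h' ↦ hx'.2 (h h')

theorem isNormalDerivative_iff {v : H1 P.dom} {p : Plane →ᴬ[ℝ] ℝ} {c : Fin m → ℝ} :
    IsNormalDerivative P.carrier v p (P.edgewise c) ↔ P.IsNeumannSolution v p c := by
  have e : ∀ φ : smooth, inner ℝ (weakGrad P.dom v) (P.gradL2 φ) +
      inner ℝ (P.valueL2 (affine p)) (P.valueL2 φ) =
      (∫ x in interior P.carrier, inner ℝ (weakGrad _ v x) (gradient φ.1 x)) +
        ∫ x in interior P.carrier, p x * φ.1 x := fun φ ↦ by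
    rw [inner_gradL2, inner_valueL2_valueL2]
    rfl
  constructor
  · intro h φ
    rw [e, inner_arcL2]
    exact h φ.1 φ.2
  · intro h φ hφ
    have := h ⟨φ, hφ⟩
    rwa [e, inner_arcL2] at this

/-- Green's formula for test functions supported inside already contains the equation for the
Laplacian, so the two requirements merge into one. -/
theorem mem_extendedSpace_iff {v : H1 P.dom} :
    v ∈ P.extendedSpace ↔ ∃ p c, P.IsNeumannSolution v p c := by
  constructor
  · rintro ⟨p, -, g, hg, hc⟩
    choose c hc using hc
    rw [P.eq_edgewise hc] at hg
    exact ⟨p, c, P.isNormalDerivative_iff.1 hg⟩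
  · rintro ⟨p, c, h⟩
    refine ⟨p, fun φ hφ _ hs ↦ ?_, P.edgewise c, P.isNormalDerivative_iff.2 h, fun i ↦ ⟨c i, ?_⟩⟩
    · have h1 := P.isNormalDerivative_iff.2 h φ hφ
      have h2 : ∫ x in frontier P.carrier, P.edgewise c x * φ x ∂μH[1] = 0 := by
        have := P.inner_arcL2 (P.edgewise c) ⟨φ, hφ⟩
        rw [P.arcL2_eq_zero hs, inner_zero_right] at this
        exact this.symm
      rw [h2] at h1
      exact neg_eq_of_add_eq_zero_right h1
    · filter_upwards [P.edgewise_ae c] with x hx hi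
      exact hx i hi

variable {P} in
theorem IsNeumannSolution.add {v w : H1 P.dom} {p q : Plane →ᴬ[ℝ] ℝ} {c d : Fin m → ℝ}
    (h : P.IsNeumannSolution v p c) (h' : P.IsNeumannSolution w q d) :
    P.IsNeumannSolution (v + w) (p + q) (c + d) := by
  intro φ
  simp only [map_add, inner_add_left, ← h φ, ← h' φ]
  ring

variable {P} in
theorem IsNeumannSolution.smul {v : H1 P.dom} {p : Plane →ᴬ[ℝ] ℝ} {c : Fin m → ℝ} (a : ℝ)
    (h : P.IsNeumannSolution v p c) : P.IsNeumannSolution (a • v) (a • p) (a • c) := by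
  intro φ
  simp only [map_smul, real_inner_smul_left, ← h φ]
  ring

variable {P} in
-- Tests supported inside detect `p`. A bump at the midpoint of an edge that avoids all other edges
-- detects the flux there.
theorem IsNeumannSolution.eq_zero {p : Plane →ᴬ[ℝ] ℝ} {c : Fin m → ℝ}
    (h : P.IsNeumannSolution 0 p c) : p = 0 ∧ c = 0 := by
  have h0 : ∀ φ, inner ℝ (P.valueL2 (affine p)) (P.valueL2 φ) =
      inner ℝ (P.edgewise c) (P.arcL2 φ) := fun φ ↦ by
    rw [← h φ, map_zero, inner_zero_left, zero_add]
  have hp : p = 0 := by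
    have key : ∀ᵐ x ∂(vol P.dom), x ∈ interior P.carrier → p x = 0 := by
      refine isOpen_interior.ae_eq_zero_of_integral_contDiff_smul_eq_zero
        (((P.memLp_dom p.continuous).locallyIntegrable (by norm_num)).locallyIntegrableOn _) ?_
      intro φ hφ _ hs
      have h1 := h0 ⟨φ, hφ⟩
      rw [P.arcL2_eq_zero hs, inner_zero_right, inner_valueL2_valueL2] at h1
      simp only [smul_eq_mul, mul_comm (φ _)]
      exact h1
    refine eq_zero_of_eqOn_zero isOpen_interior P.isConnected_interior.nonempty
      (Measure.eqOn_open_of_ae_eq (μ := volume) (g := fun _ ↦ 0) ?_ isOpen_interior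
        p.continuous.continuousOn continuousOn_const)
    filter_upwards [key, ae_restrict_mem isOpen_interior.measurableSet] with x hx hx'
    exact hx hx'
  refine ⟨hp, ?_⟩
  subst hp
  ext1 i
  have hs : (1 / 2 : ℝ) ∈ Set.Ioo (0 : ℝ) 1 := by constructor <;> norm_num
  obtain ⟨r, hr, hball⟩ : ∃ r > 0, Metric.ball (P.point i (1 / 2)) r ⊆
      (⋃ j ∈ {j | j ≠ i}, P.edge j)ᶜ := by
    refine Metric.isOpen_iff.1 ((Set.toFinite {j | j ≠ i}).isClosed_biUnion
      fun j _ ↦ P.isClosed_edge j).isOpen_compl _ fun hmem ↦ ?_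
    obtain ⟨j, hj, hx⟩ := Set.mem_iUnion₂.1 hmem
    exact hj (P.eq_of_point_mem hs hx)
  obtain ⟨ψ, hψ, -, hψ1, hψs, hψ0⟩ := exists_bump (P.point i (1 / 2)) hr
  have h1 := h0 ⟨ψ, hψ⟩
  rw [map_zero, map_zero, inner_zero_left, inner_edgewise, Finset.sum_eq_single i] at h1
  · have h2 : ∫ x in P.edge i, P.arcL2 ⟨ψ, hψ⟩ x ∂μH[1] = ∫ x in P.edge i, ψ x ∂μH[1] :=
      integral_congr_ae (ae_restrict_of_ae_restrict_of_subset (P.edge_subset_frontier i)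
        (P.arcL2_ae ⟨ψ, hψ⟩))
    have h3 : 0 < ∫ x in P.edge i, ψ x ∂μH[1] := by
      rw [integral_edge _ _ hψ.continuous, integral_Icc_eq_integral_Ioc,
        ← intervalIntegral.integral_of_le zero_le_one]
      refine mul_pos (norm_pos_iff.2 (P.dir_ne_zero i)) ?_
      refine intervalIntegral.integral_pos zero_lt_one
        (hψ.continuous.comp (P.continuous_point i)).continuousOn (fun _ _ ↦ hψ0 _)
        ⟨1 / 2, ⟨hs.1.le, hs.2.le⟩, ?_⟩
      rw [hψ1.self_of_nhds]
      exact one_pos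
    rw [h2] at h1
    exact (mul_eq_zero.1 h1.symm).resolve_right h3.ne'
  · intro j _ hj
    rw [integral_eq_zero_of_ae, mul_zero]
    filter_upwards [ae_restrict_of_ae_restrict_of_subset (P.edge_subset_frontier j)
      (P.arcL2_ae ⟨ψ, hψ⟩), ae_restrict_mem (P.isClosed_edge j).measurableSet] with x hx hxj
    rw [hx]
    refine image_eq_zero_of_notMem_tsupport fun hmem ↦ hball (hψs hmem) ?_
    exact Set.mem_iUnion₂.2 ⟨j, hj, hxj⟩
  · simp

variable {P} in
theorem IsNeumannSolution.unique {v : H1 P.dom} {p q : Plane →ᴬ[ℝ] ℝ} {c d : Fin m → ℝ}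
    (h : P.IsNeumannSolution v p c) (h' : P.IsNeumannSolution v q d) : (p, c) = (q, d) := by
  have h1 := h.add (h'.smul (-1))
  rw [neg_one_smul, neg_one_smul, neg_one_smul, add_neg_cancel] at h1
  obtain ⟨h2, h3⟩ := h1.eq_zero
  exact Prod.ext (eq_of_sub_eq_zero (by rw [sub_eq_add_neg]; exact h2))
    (eq_of_sub_eq_zero (by rw [sub_eq_add_neg]; exact h3))

theorem exists_neumannData (v : P.extendedSpace) :
    ∃ d : (Plane →ᴬ[ℝ] ℝ) × (Fin m → ℝ), P.IsNeumannSolution v.1 d.1 d.2 := by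
  obtain ⟨p, c, h⟩ := P.mem_extendedSpace_iff.1 v.2
  exact ⟨(p, c), h⟩

/-- The Laplacian and the normal derivatives of a function in the extended space. -/
def neumannData : P.extendedSpace →ₗ[ℝ] (Plane →ᴬ[ℝ] ℝ) × (Fin m → ℝ) where
  toFun v := (P.exists_neumannData v).choose
  map_add' v w := (P.exists_neumannData (v + w)).choose_spec.unique
    ((P.exists_neumannData v).choose_spec.add (P.exists_neumannData w).choose_spec)
  map_smul' c v := (P.exists_neumannData (c • v)).choose_spec.unique
    ((P.exists_neumannData v).choose_spec.smul c)

theorem isNeumannSolution_neumannData (v : P.extendedSpace) :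
    P.IsNeumannSolution v.1 (P.neumannData v).1 (P.neumannData v).2 :=
  (P.exists_neumannData v).choose_spec

theorem neumannData_eq {v : P.extendedSpace} {p : Plane →ᴬ[ℝ] ℝ} {c : Fin m → ℝ}
    (h : P.IsNeumannSolution v.1 p c) : P.neumannData v = (p, c) :=
  (P.isNeumannSolution_neumannData v).unique h

/-- The compatibility condition of the Neumann problem. -/
def compatibility : ((Plane →ᴬ[ℝ] ℝ) × (Fin m → ℝ)) →ₗ[ℝ] ℝ :=
  ((innerSL ℝ (P.valueL2 smooth.one)).toLinearMap.comp (P.valueL2.comp affine)).coprod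
    (-((innerSL ℝ (P.arcL2 smooth.one)).toLinearMap.comp P.edgewise))

theorem compatibility_apply (p : Plane →ᴬ[ℝ] ℝ) (c : Fin m → ℝ) :
    P.compatibility (p, c) = inner ℝ (P.valueL2 (affine p)) (P.valueL2 smooth.one) -
      inner ℝ (P.edgewise c) (P.arcL2 smooth.one) := by
  simp [compatibility, real_inner_comm, sub_eq_add_neg]

theorem range_neumannData : P.neumannData.range = P.compatibility.ker := by
  ext ⟨p, c⟩
  rw [LinearMap.mem_ker, compatibility_apply, sub_eq_zero]
  constructor
  · rintro ⟨v, hv⟩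
    have h := P.isNeumannSolution_neumannData v smooth.one
    rwa [hv, gradL2_one, inner_zero_right, zero_add] at h
  · intro h
    obtain ⟨v, hv⟩ := P.exists_isNeumannSolution h
    exact ⟨⟨v, P.mem_extendedSpace_iff.2 ⟨p, c, hv⟩⟩, P.neumannData_eq hv⟩

theorem finrank_ker_compatibility : Module.finrank ℝ P.compatibility.ker = 2 + m := by
  -- The data `(1, 0)` violate compatibility, since the domain has positive area.
  have hne : P.compatibility ≠ 0 := by
    intro h
    have h1 := P.compatibility_apply affineOne 0
    rw [h, affine_affineOne, map_zero, inner_zero_left, sub_zero] at h1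
    exact P.valueL2_one_ne_zero (inner_self_eq_zero.1 h1.symm)
  have h1 := P.compatibility.finrank_range_add_finrank_ker
  rw [LinearMap.range_eq_top.2 (LinearMap.surjective hne), finrank_top, Module.finrank_self,
    Module.finrank_prod, finrank_affine, Module.finrank_fin_fun] at h1
  omega

/-- The constant function `1` in the extended space. -/
theorem exists_one : ∃ u : P.extendedSpace, u.1.1 = P.valueL2 smooth.one ∧
    P.IsNeumannSolution u.1 0 0 := by
  obtain ⟨v, hv, hv'⟩ := P.exists_H1_of_tendsto (φ := fun _ ↦ smooth.one) tendsto_const_nhds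
    tendsto_const_nhds
  have h : P.IsNeumannSolution v 0 0 := fun φ ↦ by simp [hv', gradL2_one]
  exact ⟨⟨v, P.mem_extendedSpace_iff.2 ⟨0, 0, h⟩⟩, hv, h⟩

/-- With zero data, Green's formula tested with the solution itself gives a vanishing gradient, so
only constants remain. -/
theorem exists_ker_neumannData : ∃ u : P.extendedSpace, u ≠ 0 ∧
    P.neumannData.ker = Submodule.span ℝ {u} := by
  obtain ⟨u, hu, hu'⟩ := P.exists_one
  refine ⟨u, ?_, le_antisymm (fun v hv ↦ ?_) ?_⟩
  · rintro rfl
    exact P.valueL2_one_ne_zero hu.symm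
  · have h := P.isNeumannSolution_neumannData v
    rw [LinearMap.mem_ker.1 hv] at h
    have h1 := h.green v.1
    simp only [Prod.fst_zero, Prod.snd_zero, map_zero, inner_zero_left, add_zero,
      inner_self_eq_zero] at h1
    obtain ⟨c, hc⟩ := P.eq_const_of_weakGrad_eq_zero h1
    rw [← hu] at hc
    exact Submodule.mem_span_singleton.2 ⟨c, Subtype.ext (Subtype.ext hc.symm)⟩
  · rw [Submodule.span_singleton_le_iff_mem, LinearMap.mem_ker]
    exact P.neumannData_eq hu'

instance finiteDimensional_extendedSpace : FiniteDimensional ℝ P.extendedSpace := by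
  obtain ⟨u, -, hu⟩ := P.exists_ker_neumannData
  have h1 : Module.Finite ℝ P.neumannData.ker := by rw [hu]; infer_instance
  have h2 : Module.Finite ℝ (P.extendedSpace ⧸ P.neumannData.ker) :=
    Module.Finite.equiv P.neumannData.quotKerEquivRange.symm
  exact Module.Finite.of_submodule_quotient P.neumannData.ker

theorem finrank_extendedSpace : Module.finrank ℝ P.extendedSpace = 3 + m := by
  obtain ⟨u, hu0, hu⟩ := P.exists_ker_neumannData
  have h := P.neumannData.finrank_range_add_finrank_ker
  rw [range_neumannData, finrank_ker_compatibility, hu, finrank_span_singleton hu0] at h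
  omega

/-! ### The Ritz projection -/

/-- The constant vector field `e`. -/
def constL2 : Plane →L[ℝ] Lp Plane 2 (vol P.dom) := Lp.constL 2 (vol P.dom) ℝ

theorem constL2_ae (e : Plane) : P.constL2 e =ᵐ[vol P.dom] fun _ ↦ e := Lp.coeFn_const _ _ _

theorem inner_constL2 (W : Lp Plane 2 (vol P.dom)) (e : Plane) :
    inner ℝ W (P.constL2 e) = ∫ x in interior P.carrier, inner ℝ (W x) e := by
  rw [L2.inner_def]
  refine integral_congr_ae ?_
  filter_upwards [P.constL2_ae e] with x hx
  rw [hx]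

/-- The area of the polygon. -/
def area : ℝ := volume.real (interior P.carrier)

theorem area_ne_zero : P.area ≠ 0 := by
  refine (ENNReal.toReal_pos ?_ ?_).ne'
  · exact isOpen_interior.measure_ne_zero volume P.isConnected_interior.nonempty
  · exact ((measure_mono interior_subset).trans_lt P.isCompact.measure_lt_top).ne

theorem inner_constL2_constL2 (e f : Plane) :
    inner ℝ (P.constL2 e) (P.constL2 f) = P.area * inner ℝ e f := by
  rw [inner_constL2, integral_congr_ae (g := fun _ ↦ inner ℝ e f)]
  · simp [area]
  · filter_upwards [P.constL2_ae e] with x hx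
    rw [hx]

theorem integral_inner_gradient_sub (v : H1 P.dom) (q χ : Plane →ᴬ[ℝ] ℝ) :
    ∫ x in interior P.carrier, inner ℝ (gradient q x - weakGrad P.dom v x) (gradient χ x) =
      P.area * inner ℝ (slope q) (slope χ) -
        inner ℝ (weakGrad P.dom v) (P.constL2 (slope χ)) := by
  rw [← inner_constL2_constL2, ← inner_sub_left, inner_constL2]
  refine integral_congr_ae ?_
  filter_upwards [P.constL2_ae (slope q), Lp.coeFn_sub (P.constL2 (slope q)) (weakGrad P.dom v)]
    with x h1 h2
  rw [h2, Pi.sub_apply, h1, gradient_affine, gradient_affine]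

theorem hausdorffMeasure_edge (i : Fin m) :
    (μH[1] : Measure Plane).real (P.edge i) = ‖P.dir i‖ := by
  rw [measureReal_def, edge_eq_segment, hausdorffMeasure_segment, ← dist_edist, dist_comm,
    dist_eq_norm]
  rfl

theorem integral_edge_one (i : Fin m) :
    ∫ x in P.edge i, P.arcL2 smooth.one x ∂μH[1] = ‖P.dir i‖ := by
  rw [integral_congr_ae (g := fun _ ↦ 1) (ae_restrict_of_ae_restrict_of_subset
    (P.edge_subset_frontier i) (P.arcL2_ae smooth.one)), ← hausdorffMeasure_edge]
  simp

theorem edgewise_one : P.edgewise 1 = P.arcL2 smooth.one := by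
  refine (P.eq_edgewise fun i ↦ ?_).symm
  filter_upwards [P.arcL2_ae smooth.one] with x hx _
  rw [hx]
  rfl

theorem arcL2_one_ne_zero : P.arcL2 smooth.one ≠ 0 := by
  intro h
  have h1 := P.integral_edge_one ⟨0, by have := P.three_le; omega⟩
  rw [← inner_edgeL2, h, inner_zero_right] at h1
  exact norm_ne_zero_iff.2 (P.dir_ne_zero _) h1.symm

/-- The gradient of the Ritz projection. -/
def ritzSlope : H1 P.dom →ₗ[ℝ] Plane :=
  P.area⁻¹ • (P.constL2.adjoint.toLinearMap.comp (weakGrad P.dom))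

theorem area_mul_inner_ritzSlope (v : H1 P.dom) (e : Plane) :
    P.area * inner ℝ (P.ritzSlope v) e = inner ℝ (weakGrad P.dom v) (P.constL2 e) := by
  have h := P.area_ne_zero
  rw [← ContinuousLinearMap.adjoint_inner_left]
  simp only [ritzSlope, LinearMap.smul_apply, LinearMap.comp_apply, real_inner_smul_left]
  field_simp
  rfl

/-- The constant part of the Ritz projection. -/
def ritzConst : H1 P.dom →ₗ[ℝ] ℝ :=
  (‖P.arcL2 smooth.one‖ ^ 2)⁻¹ • (innerSL ℝ (P.arcL2 smooth.one)).toLinearMap.comp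
    (P.trace - P.arcL2.comp (affine.comp (linearForm.comp P.ritzSlope)))

/-- The Ritz projection. -/
def ritz : H1 P.dom →ₗ[ℝ] (Plane →ᴬ[ℝ] ℝ) :=
  linearForm.comp P.ritzSlope + P.ritzConst.smulRight affineOne

theorem slope_ritz (v : H1 P.dom) : slope (P.ritz v) = P.ritzSlope v := by
  simp [ritz, slope_linearForm, slope_affineOne]

theorem inner_arcL2_ritz (v : H1 P.dom) :
    inner ℝ (P.arcL2 smooth.one) (P.arcL2 (affine (P.ritz v))) =
      inner ℝ (P.arcL2 smooth.one) (P.trace v) := by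
  have h : ‖P.arcL2 smooth.one‖ ≠ 0 := norm_ne_zero_iff.2 P.arcL2_one_ne_zero
  simp only [ritz, ritzConst, LinearMap.add_apply, LinearMap.comp_apply, map_add,
    LinearMap.smulRight_apply, map_smul, affine_affineOne, inner_add_right, inner_smul_right,
    real_inner_self_eq_norm_sq, LinearMap.smul_apply, LinearMap.sub_apply, smul_eq_mul,
    ContinuousLinearMap.coe_coe, innerSL_apply_apply, inner_sub_right]
  field_simp
  ring

theorem integral_frontier (g : Lp ℝ 2 (arc P.carrier)) :
    ∫ x in frontier P.carrier, g x ∂μH[1] = inner ℝ (P.arcL2 smooth.one) g := by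
  rw [real_inner_comm, inner_arcL2]
  simp [smooth.one]

theorem integral_frontier_affine (q : Plane →ᴬ[ℝ] ℝ) :
    ∫ x in frontier P.carrier, q x ∂μH[1] =
      inner ℝ (P.arcL2 smooth.one) (P.arcL2 (affine q)) := by
  rw [← integral_frontier]
  exact integral_congr_ae (P.arcL2_ae (affine q)).symm

theorem isRitzProjection_ritz (v : H1 P.dom) : P.IsRitzProjection v (P.ritz v) := by
  refine ⟨fun χ ↦ ?_, P.trace v, P.hasTrace_boundaryTrace v, ?_⟩
  · rw [integral_inner_gradient_sub, slope_ritz, area_mul_inner_ritzSlope, sub_self]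
  · rw [integral_frontier_affine, integral_frontier, inner_arcL2_ritz]

variable {P} in
-- Vanishing edge integrals kill the mean gradient by Gauss' theorem, hence the slope, and then the
-- boundary mean, hence the constant. The affine function is arbitrary because the enhanced space
-- only asks for some Ritz projection.
theorem IsRitzProjection.eq_zero {v : H1 P.dom} {q : Plane →ᴬ[ℝ] ℝ} (h : P.IsRitzProjection v q)
    (hv : ∀ c, inner ℝ (P.edgewise c) (P.trace v) = 0) : q = 0 := by
  obtain ⟨h1, g, hg, h2⟩ := h
  obtain ⟨n, hn⟩ := P.exists_gauss_trace
  rw [P.hasTrace_unique hg (P.hasTrace_boundaryTrace v), integral_frontier, ← edgewise_one] at h2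
  have h3 := hv 1
  change inner ℝ _ (boundaryTrace P.carrier v) = 0 at h3
  have hs : slope q = 0 := by
    have h4 := h1 (linearForm (slope q))
    rw [integral_inner_gradient_sub, slope_linearForm, inner_constL2, hn, hv, sub_zero] at h4
    exact inner_self_eq_zero.1 ((mul_eq_zero.1 h4).resolve_left P.area_ne_zero)
  have hq : q = q 0 • affineOne := by
    ext x
    rw [affine_eq q x, hs]
    simp [affineOne]
  have h5 : q 0 = 0 := by
    rw [h3, integral_frontier_affine, hq, map_smul, map_smul, affine_affineOne,
      inner_smul_right] at h2
    have h6 := (mul_eq_zero.1 h2).resolve_right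
      fun h ↦ P.arcL2_one_ne_zero (inner_self_eq_zero.1 h)
    simpa using h6
  rw [hq, h5, zero_smul]

/-! ### The enhanced space -/

/-- The moments of `v - Π v` against the affine functions. -/
def moments : P.extendedSpace →ₗ[ℝ] Module.Dual ℝ (Plane →ᴬ[ℝ] ℝ) :=
  ((innerₗ (Lp ℝ 2 (vol P.dom))).compl₂ (P.valueL2.comp affine)).comp
    (((H1 P.dom).subtype - P.valueL2.comp (affine.comp P.ritz)).comp P.extendedSpace.subtype)

theorem integral_sub_mul (v : H1 P.dom) (q χ : Plane →ᴬ[ℝ] ℝ) :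
    ∫ x in interior P.carrier, (v.1 x - q x) * χ x =
      inner ℝ (v.1 - P.valueL2 (affine q)) (P.valueL2 (affine χ)) := by
  rw [inner_valueL2]
  refine integral_congr_ae ?_
  filter_upwards [Lp.coeFn_sub v.1 (P.valueL2 (affine q)), P.valueL2_ae (affine q)] with x h1 h2
  rw [h1, Pi.sub_apply, h2]
  rfl

/-- This inclusion is enough for the lower dimension bound; the upper bound comes from the
injectivity of the edge means. -/
theorem map_ker_moments_le : P.moments.ker.map P.extendedSpace.subtype ≤ P.enhancedSpace := by
  rintro _ ⟨v, hv, rfl⟩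
  refine ⟨v.2, P.ritz v.1, P.isRitzProjection_ritz v.1, fun χ ↦ ?_⟩
  have h := LinearMap.congr_fun (LinearMap.mem_ker.1 hv) χ
  rw [integral_sub_mul]
  exact h

theorem enhancedSpace_le : P.enhancedSpace ≤ P.extendedSpace := fun _ h ↦ h.1

instance finiteDimensional_enhancedSpace : FiniteDimensional ℝ P.enhancedSpace :=
  Submodule.finiteDimensional_of_le P.enhancedSpace_le

/-- Three linear conditions lower the dimension `3 + m` by at most three. -/
theorem le_finrank_enhancedSpace : m ≤ Module.finrank ℝ P.enhancedSpace := by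
  have h1 := P.moments.finrank_range_add_finrank_ker
  have h2 := Submodule.finrank_le P.moments.range
  rw [Subspace.dual_finrank_eq, finrank_affine] at h2
  have h3 := Submodule.finrank_mono P.map_ker_moments_le
  rw [Submodule.finrank_map_subtype_eq] at h3
  rw [finrank_extendedSpace] at h1
  omega

/-! ### Degrees of freedom and unisolvence -/

theorem dof_eq (i : Fin m) (v : H1 P.dom) :
    P.dof i v = ‖P.dir i‖⁻¹ * inner ℝ (P.edgeL2 i) (P.trace v) := by
  rw [dof, setAverage_eq, hausdorffMeasure_edge, inner_edgeL2]
  rfl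

/-- The degrees of freedom as a linear map. -/
def dofs : P.enhancedSpace →ₗ[ℝ] (Fin m → ℝ) where
  toFun v i := P.dof i v
  map_add' v w := by
    ext1 i
    simp only [dof_eq, Submodule.coe_add, map_add, inner_add_right, Pi.add_apply]
    ring
  map_smul' c v := by
    ext1 i
    simp only [dof_eq, Submodule.coe_smul, map_smul, inner_smul_right, Pi.smul_apply, smul_eq_mul,
      RingHom.id_apply]
    ring

/-- Vanishing edge means annihilate the Ritz projection, so `v` is orthogonal to the affine
functions, in particular to its own Laplacian. Both remaining terms in Green's formula for `v`
against itself vanish, `v` is constant, and orthogonality to `1` makes it zero. -/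
theorem dofs_injective : Function.Injective P.dofs := by
  refine (injective_iff_map_eq_zero P.dofs).2 fun v hv ↦ ?_
  have h0 : ∀ i, inner ℝ (P.edgeL2 i) (P.trace v.1) = 0 := by
    intro i
    have h : P.dof i v.1 = 0 := congrFun hv i
    rw [dof_eq] at h
    exact (mul_eq_zero.1 h).resolve_left (inv_ne_zero (norm_ne_zero_iff.2 (P.dir_ne_zero i)))
  have h1 : ∀ c, inner ℝ (P.edgewise c) (P.trace v.1) = 0 := by
    intro c
    rw [inner_edgewise]
    exact Finset.sum_eq_zero fun i _ ↦ by rw [← inner_edgeL2, h0, mul_zero]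
  obtain ⟨hext, q, hq, horth⟩ := v.2
  obtain rfl := hq.eq_zero h1
  have h2 : ∀ χ, inner ℝ v.1.1 (P.valueL2 (affine χ)) = 0 := by
    intro χ
    have h := horth χ
    rwa [integral_sub_mul, map_zero, map_zero, sub_zero] at h
  obtain ⟨p, c, hpc⟩ := P.mem_extendedSpace_iff.1 hext
  have h3 := hpc.green v.1
  rw [h1, real_inner_comm, real_inner_comm v.1.1, h2, add_zero, inner_self_eq_zero] at h3
  obtain ⟨t, ht⟩ := P.eq_const_of_weakGrad_eq_zero h3
  have h4 := h2 affineOne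
  rw [affine_affineOne, ht, inner_smul_left] at h4
  have h5 : t = 0 := by
    simpa using (mul_eq_zero.1 h4).resolve_right
      fun h ↦ P.valueL2_one_ne_zero (inner_self_eq_zero.1 h)
  refine Subtype.ext (Subtype.ext ?_)
  rw [ht, h5, zero_smul]
  rfl

theorem finrank_enhancedSpace : Module.finrank ℝ P.enhancedSpace = m := by
  refine le_antisymm ?_ P.le_finrank_enhancedSpace
  simpa using LinearMap.finrank_le_finrank_of_injective P.dofs_injective

theorem dofs_bijective : Function.Bijective P.dofs :=
  ⟨P.dofs_injective, (LinearMap.injective_iff_surjective_of_finrank_eq_finrank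
    (by rw [finrank_enhancedSpace, Module.finrank_fin_fun])).1 P.dofs_injective⟩

theorem isCiarletFiniteElement : IsCiarletFiniteElement P.carrier P.enhancedSpace
    (fun (i : Fin m) (v : P.enhancedSpace) ↦ P.dof i v) where
  isCompact := P.isCompact
  nonempty_interior := P.isConnected_interior.nonempty
  hasLipschitzBoundary := P.hasLipschitzBoundary
  finiteDimensional := P.finiteDimensional_enhancedSpace
  isLinearMap i := ((LinearMap.proj i).comp P.dofs).isLinear
  linearIndependent := by
    rw [Fintype.linearIndependent_iff]
    intro a ha i
    -- Evaluating the linear relation at the dual basis function of the edge `i` isolates the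
    -- coefficient `a i`.
    obtain ⟨v, hv⟩ := P.dofs_bijective.2 (Pi.single i 1)
    have h := congrFun ha v
    have hv' : ∀ j, P.dof j v.1 = (Pi.single i 1 : Fin m → ℝ) j := congrFun hv
    simpa [hv', Pi.single_apply] using h
  unisolvent α := by
    obtain ⟨v, hv⟩ := P.dofs_bijective.2 α
    exact ⟨v, congrFun hv, fun w hw ↦ P.dofs_injective ((funext hw).trans hv.symm)⟩

end PolygonalDomain

end VirtualElement

end

theorem mainTheorem10 {m : ℕ} (P : VirtualElement.PolygonalDomain m) :
    Module.finrank ℝ P.extendedSpace = 3 + m ∧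
    Module.finrank ℝ P.enhancedSpace = m ∧
    VirtualElement.IsCiarletFiniteElement P.carrier P.enhancedSpace
      (fun (i : Fin m) (v : P.enhancedSpace) ↦ P.dof i v) := by
  exact ⟨P.finrank_extendedSpace, P.finrank_enhancedSpace, P.isCiarletFiniteElement⟩
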